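/- Let $\mathbb S^2\subset\mathbb R^3$ be the unit sphere with surface measure, $H$ the closed subspace of $\mathbb L^2(\mathbb S^2)$ of tangent, (weakly) divergence-free vector fields, $P_H$ the orthogonal projection of $\mathbb L^2(\mathbb S^2)$ onto $H$, and $X=\mathbb L^4(\mathbb S^2)\cap H$ with $|x|_X=|x|_H+|x|_{\mathbb L^4}$. Let $A=-P_H(\mathbf\Delta+2\,\mathrm{Ric})$ be the Stokes operator ($\mathbf\Delta$ the Laplace–de Rham operator, $\mathrm{Ric}$ the Ricci tensor, which is the identity), let $\mathbf C=P_H\mathbf C_1$ with $(\mathbf C_1v)(x)=2\Omega_0\,x_3\,(x\times v(x))$, $\Omega_0\in\mathbb R$, be the Coriolis operator, let $\nu>0$ and $\widehat A=\nu A+\mathbf C$, and let $(e^{-t\widehat A})_{t\ge0}$ be the strongly continuous semigroup on $X$ generated by $-\widehat A$ (with $\widehat A$ taken in $X$). Let $(e_l)$ be a complete orthonormal system of $H$ with $Ae_l=\lambda_le_l$, let $\beta\in(1,2)$, and let $(\sigma_l)$ be real numbers such that $\lambda_l>0$ whenever $\sigma_l\ne0$ and $$\sum_l|\sigma_l|^\beta\lambda_l^{\beta/2}<\infty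 .$$ On the space $D(\mathbb R,X)$ of càdlàg paths, with the $\sigma$-algebra generated by the evaluations $\omega\mapsto\omega(t)$, let $\mathbb P$ be the probability measure under which the canonical process $\omega(t)$ is the two-sided Lévy process $\sum_l\sigma_lL_l(t)e_l$, where the $L_l$ are independent two-sided symmetric $\beta$-stable Lévy processes, $\mathbb E\,e^{i\theta(L_l(t)-L_l(s))}=e^{-(t-s)|\theta|^\beta/2}$ for $s\le t$. Put $(\vartheta_s\omega)(t)=\omega(t+s)-\omega(s)$ and $$\hat z(\omega)(t)=\int_{-\infty}^t\widehat Ae^{-(t-r)\widehat A}\bigl(\omega(t)-\omega(r)\bigr)\,dr ,\qquad t\in\mathbb R .$$ Theorem. For $\mathbb P$-a.e. $\omega\in D(\mathbb R,X)$ and all $s,t\in\mathbb R$, the integrals defining $\hat z(\vartheta_s\omega)(t)$ and $\hat z(\omega)(t+s)$ are well defined (as absolutely convergent Bochner integrals in $X$), and $$\hat z(\vartheta_s\omega)(t)=\hat z(\omega)(t+s).$$ -/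

import Mathlib

open MeasureTheory ProbabilityTheory Set Filter Topology
open scoped ENNReal ContDiff InnerProductSpace

noncomputable section

namespace RotatingSphere

/-! ## Vector fields on the unit sphere of `ℝ³` -/

/-- The ambient Euclidean space `ℝ³`. -/
abbrev E3 : Type := EuclideanSpace ℝ (Fin 3)

/-- The unit sphere `𝕊²`. -/
abbrev S2 : Type := Metric.sphere (0 : E3) 1

/-- The surface measure of `𝕊²`. -/
abbrev surf : Measure S2 := (volume : Measure E3).toSphere

instance fact_one_le_four : Fact ((1 : ℝ≥0∞) ≤ 4) := ⟨by norm_num⟩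

/-- The cross product `x × y` of `ℝ³`. -/
def cross (x y : E3) : E3 :=
  !₂[x 1 * y 2 - x 2 * y 1, x 2 * y 0 - x 0 * y 2, x 0 * y 1 - x 1 * y 0]

/-- The partial derivative `∂ⱼ Vᵢ` of a vector field on `ℝ³`. -/
def partialDeriv (V : E3 → E3) (i j : Fin 3) (x : E3) : ℝ :=
  fderiv ℝ V x (EuclideanSpace.single j 1) i

/-- The classical curl of a vector field on `ℝ³`. -/
def curl (V : E3 → E3) (x : E3) : E3 :=
  !₂[partialDeriv V 2 1 x - partialDeriv V 1 2 x,
     partialDeriv V 0 2 x - partialDeriv V 2 0 x,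
     partialDeriv V 1 0 x - partialDeriv V 0 1 x]

/-- The vorticity (normal component of the curl). On `𝕊²` it is the surface curl of `V`, for
any field `V` whose restriction to the sphere is tangent. -/
def vorticity (V : E3 → E3) (x : E3) : ℝ := ⟪x, curl V x⟫_ℝ

/-- The Laplace–de Rham operator `𝚫 V = grad div V - Curl curl V` on a divergence-free tangent
field, so that the first term is absent; here `Curl q = -x × ∇q` is the surface curl of a scalar.
Only tangential derivatives of the vorticity enter. -/
def laplaceDeRham (V : E3 → E3) (x : E3) : E3 := cross x (gradient (vorticity V) x)

/-- A field on the sphere is tangent and (weakly) divergence-free. For a tangent field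
`⟪g x, ∇φ x⟫` only sees the surface gradient of `φ`. -/
def IsSolenoidal (g : S2 → E3) : Prop :=
  (∀ᵐ x ∂surf, ⟪g x, (x : E3)⟫_ℝ = 0) ∧
    ∀ φ : E3 → ℝ, ContDiff ℝ ∞ φ → ∫ x, ⟪g x, gradient φ (x : E3)⟫_ℝ ∂surf = 0

theorem integrable_inner_gradient (u : Lp E3 2 surf) {φ : E3 → ℝ} (hφ : ContDiff ℝ ∞ φ) :
    Integrable (fun x : S2 => ⟪u x, gradient φ (x : E3)⟫_ℝ) surf := by
  have hc : Continuous (fun x : S2 => gradient φ (x : E3)) := by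
    unfold gradient
    exact ((InnerProductSpace.toDual ℝ E3).symm.continuous.comp
      (hφ.continuous_fderiv (by simp))).comp continuous_subtype_val
  have hL : MemLp (fun x : S2 => gradient φ (x : E3)) 2 surf := by
    obtain ⟨C, hC⟩ := (isCompact_univ (X := S2)).exists_bound_of_continuousOn hc.continuousOn
    exact MemLp.of_bound hc.aestronglyMeasurable C (Eventually.of_forall fun x => hC x trivial)
  refine (L2.integrable_inner (𝕜 := ℝ) u (hL.toLp _)).congr ?_
  filter_upwards [hL.coeFn_toLp] with x hx
  rw [hx]

/-- The space `H` of square integrable tangent divergence-free vector fields on `𝕊²`, with the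
`𝕃²` inner product. -/
def H : Submodule ℝ (Lp E3 2 surf) where
  carrier := {u | IsSolenoidal u}
  zero_mem' := by
    have h0 : ∀ᵐ x ∂surf, (0 : Lp E3 2 surf) x = (0 : E3) := Lp.coeFn_zero E3 2 surf
    refine ⟨?_, fun φ _ => ?_⟩
    · filter_upwards [h0] with x hx
      rw [hx, inner_zero_left]
    · refine integral_eq_zero_of_ae ?_
      filter_upwards [h0] with x hx
      rw [hx, inner_zero_left, Pi.zero_apply]
  add_mem' := by
    rintro u v ⟨hu, hu'⟩ ⟨hv, hv'⟩
    refine ⟨?_, fun φ hφ => ?_⟩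
    · filter_upwards [Lp.coeFn_add u v, hu, hv] with x hx h1 h2
      rw [hx, Pi.add_apply, inner_add_left, h1, h2, add_zero]
    · rw [integral_congr_ae (g := fun x : S2 => ⟪u x, gradient φ (x : E3)⟫_ℝ
        + ⟪v x, gradient φ (x : E3)⟫_ℝ),
        integral_add (integrable_inner_gradient u hφ) (integrable_inner_gradient v hφ),
        hu' φ hφ, hv' φ hφ, add_zero]
      filter_upwards [Lp.coeFn_add u v] with x hx
      rw [hx, Pi.add_apply, inner_add_left]
  smul_mem' := by
    rintro c u ⟨hu, hu'⟩
    refine ⟨?_, fun φ hφ => ?_⟩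
    · filter_upwards [Lp.coeFn_smul c u, hu] with x hx h1
      rw [hx, Pi.smul_apply, real_inner_smul_left, h1, mul_zero]
    · rw [integral_congr_ae (g := fun x : S2 => c * ⟪u x, gradient φ (x : E3)⟫_ℝ),
        integral_const_mul, hu' φ hφ, mul_zero]
      filter_upwards [Lp.coeFn_smul c u] with x hx
      rw [hx, Pi.smul_apply, real_inner_smul_left]

/-- The space `X = 𝕃⁴ ∩ H`: pairs of an element of `H` and an element of `𝕃⁴` that are the same
vector field, with the norm `|x|_X = |x|_H + |x|_{𝕃⁴}`. -/
def X : Submodule ℝ (WithLp 1 (H × Lp E3 4 surf)) where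
  carrier := {w | ((w.fst : Lp E3 2 surf) : S2 → E3) =ᵐ[surf] (w.snd : S2 → E3)}
  zero_mem' := by
    have h2 := Lp.coeFn_zero E3 2 surf
    have h4 := Lp.coeFn_zero E3 4 surf
    exact h2.trans h4.symm
  add_mem' := by
    intro w w' h h'
    have h : ((w.fst : Lp E3 2 surf) : S2 → E3) =ᵐ[surf] (w.snd : S2 → E3) := h
    have h' : ((w'.fst : Lp E3 2 surf) : S2 → E3) =ᵐ[surf] (w'.snd : S2 → E3) := h'
    have h2 := Lp.coeFn_add (w.fst : Lp E3 2 surf) (w'.fst : Lp E3 2 surf)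
    have h4 := Lp.coeFn_add w.snd w'.snd
    exact h2.trans ((h.add h').trans h4.symm)
  smul_mem' := by
    intro c w h
    have h : ((w.fst : Lp E3 2 surf) : S2 → E3) =ᵐ[surf] (w.snd : S2 → E3) := h
    have h2 := Lp.coeFn_smul c (w.fst : Lp E3 2 surf)
    have h4 := Lp.coeFn_smul c w.snd
    exact h2.trans ((h.const_smul c).trans h4.symm)

instance : NormedAddCommGroup X := Submodule.normedAddCommGroup X

instance : NormedSpace ℝ X := Submodule.normedSpace X

theorem norm_eq (x : X) :
    ‖x‖ = ‖(x : WithLp 1 (H × Lp E3 4 surf)).fst‖ + ‖(x : WithLp 1 (H × Lp E3 4 surf)).snd‖ :=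
  WithLp.prod_norm_eq_of_L1 (x : WithLp 1 (H × Lp E3 4 surf))

/-- The inclusion `X ⊂ H`. -/
def toH (x : X) : H := (x : WithLp 1 (H × Lp E3 4 surf)).fst

/-! ## The Stokes and Coriolis operators -/

/-- `u ∈ D(A)` and `A u = f` for the Stokes operator `A = -P(𝚫 + 2 Ric)` in `H`, where `Ric` is
the identity on the unit sphere: the identity holds weakly, that is, tested against all smooth
tangent divergence-free fields. -/
def IsStokes (u f : H) : Prop :=
  ∀ V : E3 → E3, ContDiff ℝ ∞ V → IsSolenoidal (fun x => V x) →
    ∫ x, ⟪(f : Lp E3 2 surf) x, V x⟫_ℝ ∂surf =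
      - ∫ x, ⟪(u : Lp E3 2 surf) x, laplaceDeRham V x + (2 : ℝ) • V x⟫_ℝ ∂surf

/-- The Coriolis force `(C₁ u)(x) = 2 Ω cos θ (x × u(x))`, where `cos θ` is the third coordinate
of `x`. -/
def coriolisForce (Om : ℝ) (u : S2 → E3) (x : S2) : E3 :=
  (2 * Om * (x : E3) 2) • cross x (u x)

/-- `C u = f` for the Coriolis operator `C = P C₁` in `H`: the field `f` is the orthogonal
projection of `C₁ u` to `H`. -/
def IsCoriolis (Om : ℝ) (u f : H) : Prop :=
  ∀ v : H, ∫ x, ⟪(f : Lp E3 2 surf) x, (v : Lp E3 2 surf) x⟫_ℝ ∂surf =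
    ∫ x, ⟪coriolisForce Om (u : Lp E3 2 surf) x, (v : Lp E3 2 surf) x⟫_ℝ ∂surf

/-- `u ∈ D(Â)` and `Â u = f` for the operator `Â = ν A + C` in the space `X`. -/
def IsAhat (nu Om : ℝ) (u f : X) : Prop :=
  ∃ a c : H, IsStokes (toH u) a ∧ IsCoriolis Om (toH u) c ∧ toH f = nu • a + c

/-- `u` belongs to the domain of `Â` in `X`. -/
def InDomainAhat (nu Om : ℝ) (u : X) : Prop := ∃ f, IsAhat nu Om u f

open Classical in
/-- The operator `Â` in `X` as a total function, set to `0` off its domain. -/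
def Ahat (nu Om : ℝ) (u : X) : X :=
  if h : InDomainAhat nu Om u then h.choose else 0

/-! ## Semigroups -/

/-- `S` is a strongly continuous semigroup (only the times `t ≥ 0` matter). -/
structure IsC0Semigroup {E : Type*} [NormedAddCommGroup E] [NormedSpace ℝ E]
    (S : ℝ → E →L[ℝ] E) : Prop where
  zero : S 0 = ContinuousLinearMap.id ℝ E
  add : ∀ s t, 0 ≤ s → 0 ≤ t → S (s + t) = (S s).comp (S t)
  cont : ∀ x, Tendsto (fun t => S t x) (𝓝[>] 0) (𝓝 x)

/-- The infinitesimal generator of `S` is the operator whose graph is `G`. -/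
def HasGenerator {E : Type*} [NormedAddCommGroup E] [NormedSpace ℝ E]
    (S : ℝ → E →L[ℝ] E) (G : E → E → Prop) : Prop :=
  ∀ u f, G u f ↔ Tendsto (fun h : ℝ => h⁻¹ • (S h u - u)) (𝓝[>] 0) (𝓝 f)

/-- `S` is the strongly continuous semigroup on `X` generated by `-Â`. -/
def IsStokesCoriolisSemigroup (nu Om : ℝ) (S : ℝ → X →L[ℝ] X) : Prop :=
  IsC0Semigroup S ∧ HasGenerator S (fun u f => IsAhat nu Om u (-f))

open Classical in
/-- The semigroup `e^{-tÂ}`, `t ≥ 0`, on `X`. (A semigroup is determined by its generator.) -/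
def expNegAhat (nu Om : ℝ) : ℝ → X →L[ℝ] X :=
  if h : ∃ S, IsStokesCoriolisSemigroup nu Om S then h.choose else 0

/-! ## The canonical path space -/

/-- Càdlàg paths: right continuous with left limits. -/
def IsCadlagPath {E : Type*} [TopologicalSpace E] (f : ℝ → E) : Prop :=
  ∀ t, ContinuousWithinAt f (Ici t) t ∧ ∃ l, Tendsto f (𝓝[<] t) (𝓝 l)

/-- The canonical sample space `D(ℝ, X)`. -/
def PathSpace : Type := {f : ℝ → X // IsCadlagPath f}

/-- The `σ`-algebra on `D(ℝ, X)` generated by the evaluation maps. -/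
instance : MeasurableSpace PathSpace :=
  ⨆ t : ℝ, (borel X).comap (fun w : PathSpace => w.1 t)

/-- The shift `(ϑ_s ω)(t) = ω(t + s) - ω(s)`. -/
def shift (s : ℝ) (w : PathSpace) : PathSpace :=
  ⟨fun t => w.1 (t + s) - w.1 s, by
    intro t
    obtain ⟨h1, l, h2⟩ := w.2 (t + s)
    refine ⟨?_, l - w.1 s, ?_⟩
    · refine ContinuousWithinAt.sub ?_ continuousWithinAt_const
      refine ContinuousWithinAt.comp (t := Ici (t + s)) h1
        (by fun_prop) (fun r hr => ?_)
      simpa using hr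
    · refine Tendsto.sub_const (h2.comp ?_) _
      refine tendsto_nhdsWithin_iff.2 ⟨?_, ?_⟩
      · exact ((continuous_id.add continuous_const).tendsto t).mono_left nhdsWithin_le_nhds
      · filter_upwards [self_mem_nhdsWithin] with r hr
        simpa using hr⟩

/-! ## The driving noise -/

/-- `Y` is a two-sided symmetric `β`-stable Lévy process with scale `c`: it starts from `0`, has
independent increments, and, for `s ≤ t`, the increment `Y(t) - Y(s)` is symmetric `β`-stable with
scale parameter `c (t - s)^{1/β}`, that is, its characteristic function is
`θ ↦ exp(-(t - s) c^β |θ|^β / 2)`. -/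
structure IsTwoSidedStable {W : Type*} [MeasurableSpace W] (beta c : ℝ) (Y : ℝ → W → ℝ)
    (P : Measure W) : Prop where
  zero : ∀ᵐ w ∂P, Y 0 w = 0
  indep : HasIndepIncrements Y P
  charFun_increment : ∀ s t : ℝ, s ≤ t → ∀ θ : ℝ,
    charFun (P.map (fun w => Y t w - Y s w)) θ =
      ((Real.exp (-((t - s) * c ^ beta * |θ| ^ beta / 2)) : ℝ) : ℂ)

/-- The coordinate `⟨ω(t), e_l⟩` of the canonical process with respect to a basis of `H`. -/
def coord (e : HilbertBasis ℕ ℝ H) (l : ℕ) (t : ℝ) (w : PathSpace) : ℝ :=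
  ⟪toH (w.1 t), e l⟫_ℝ

/-- Under `P` the canonical process is the two-sided Lévy process `L(t) = ∑_l σ_l L_l(t) e_l`
with independent two-sided symmetric `β`-stable Lévy processes `L_l`: the coordinate processes
`σ_l L_l` are independent, and the `l`-th one is symmetric `β`-stable with scale `|σ_l|`. -/
structure IsNoiseLaw (beta : ℝ) (e : HilbertBasis ℕ ℝ H) (sigma : ℕ → ℝ)
    (P : Measure PathSpace) : Prop where
  indep : iIndepFun (fun (l : ℕ) (w : PathSpace) (t : ℝ) => coord e l t w) P
  stable : ∀ l, IsTwoSidedStable beta |sigma l| (coord e l) P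

/-! ## The Ornstein–Uhlenbeck functional -/

/-- The integrand `r ↦ Â e^{-(t-r)Â} (ω(t) - ω(r))`. -/
def ouIntegrand (nu Om : ℝ) (w : PathSpace) (t r : ℝ) : X :=
  Ahat nu Om (expNegAhat nu Om (t - r) (w.1 t - w.1 r))

/-- The integral that defines `ẑ(ω)(t)` makes sense: for `r < t` the operator `Â` is applied to
elements of its domain, and the integrand is Bochner integrable in `X` over `(-∞, t]`. -/
def OUWellDefined (nu Om : ℝ) (w : PathSpace) (t : ℝ) : Prop :=
  (∀ r < t, InDomainAhat nu Om (expNegAhat nu Om (t - r) (w.1 t - w.1 r))) ∧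
    IntegrableOn (ouIntegrand nu Om w t) (Iic t)

/-- `ẑ(ω)(t) = ∫_{-∞}^t Â e^{-(t-r)Â} (ω(t) - ω(r)) dr`, a Bochner integral in `X`. -/
def ouFunctional (nu Om : ℝ) (w : PathSpace) (t : ℝ) : X :=
  ∫ r in Iic t, ouIntegrand nu Om w t r

end RotatingSphere

end

/-!
Since the integrand of `ẑ` at time `t` involves the path only through the increment `ω(t) - ω(r)`,
the shift identity is the translation invariance of Lebesgue measure (`ouFunctional_shift`). The
substance is that for almost every path the integral converges absolutely in `X`. This has three
ingredients: the semigroup exists, it smooths, and the noise is regular and grows slowly.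

*Diagonalization.* Let `angVec p = x × ∇p`. For a harmonic polynomial `p` that is homogeneous of
degree `n`, this field is an eigenfield of the Stokes operator with eigenvalue
`μₙ = n (n + 1) - 2` (`stokesEv`), and such fields span a dense subspace of `H`. The Coriolis operator maps each
eigenspace `eigSp n` into itself and is skew-symmetric there, so the semigroup acts on `eigSp n` as
`exp (-ν μₙ t)` times an isometry (`norm_eigProj_semigroup`). Integration by parts on the sphere
rests on the rotation invariance of the surface measure: the angular momentum operators are
infinitesimal rotations, so their images integrate to zero.

*Smoothing.* The supremum of a field in `eigSp n` is at most a multiple of `n + 1` times its norm in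
`H` (`norm_angVec_le`): by rotation invariance the reproducing kernel of the homogeneous polynomials
of degree `n` is constant on the diagonal, and its integral is their dimension. The `L⁴` norm is
interpolated between the supremum and the `L²` norm. Thus for `x` with `∑ μₙ ‖Pₙ x‖² < ∞` and
without component of degree one, `Â e^{-τÂ} x` exists in `X` and its norm is
`O(e^{-2ντ} (τ^{-1/2} + τ^{-15/16}))` (`exists_isAhat_semigroup`), which is integrable at `τ = 0`
and absorbs polynomial growth as `τ → ∞`. The component of degree one, where `μ₁ = 0`, is absent
from the noise because `σₗ ≠ 0` forces `λₗ > 0`.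

*The noise.* It therefore suffices that `⟨A ω(t), ω(t)⟩ = ∑ λₗ ⟨eₗ, ω(t)⟩²` grows at most
polynomially in `t` (`ae_hasModerateGrowth`). The characteristic function gives the tail bound
`a^{-β}` for the increments of a stable process, Ottaviani's inequality carries it over to the
supremum over a bounded interval, and truncated second moments, together with the summability of
`|σₗ|^β λₗ^{β/2}`, control the sum over `l`. The Borel–Cantelli lemma concludes.

*The semigroup.* The statement refers to the semigroup generated by `-Â` on `X`, so its existence
has to be shown (`exists_isStokesCoriolisSemigroup`). On polynomial fields the heat flow is
explicit, and it contracts the `L⁴` norm because the Laplacian is dissipative there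
(`integral_normSq_mul_casimirSum_nonpos`); it extends to `X` by density. The rest of `-Â`, the
Coriolis operator and a multiple of the identity, is bounded on `X` by a Sobolev embedding proved by
dyadic decomposition (`exists_toH_of_sobolev`). It commutes with the heat flow, so multiplying by
its exponential yields the semigroup; the generator is then identified componentwise
(`tendsto_expMul_iff`).
-/

noncomputable section

namespace AngularMomentum

open MvPolynomial

/-! ### Angular momentum operators on polynomials -/

/-- Real polynomials in the three coordinates of `ℝ³`. -/
abbrev Poly : Type := MvPolynomial (Fin 3) ℝ

/-- The `i`-th component of the angular momentum operator `x × ∇` on polynomials, as a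
derivation; the indices are cyclic. -/
def ang (i : Fin 3) : Derivation ℝ Poly Poly :=
  (X (i + 1) : Poly) • pderiv (i + 2) - (X (i + 2) : Poly) • pderiv (i + 1)

/-- The Laplacian on polynomials. -/
def lap (p : Poly) : Poly := ∑ i, MvPolynomial.pderiv i (MvPolynomial.pderiv i p)

/-- The squared Euclidean norm as a polynomial. -/
def rsq : Poly := ∑ i, MvPolynomial.X i ^ 2

theorem ang_apply (i : Fin 3) (p : Poly) :
    ang i p = X (i + 1) * pderiv (i + 2) p - X (i + 2) * pderiv (i + 1) p := by
  simp [ang]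

theorem pderiv_comm (i j : Fin 3) (p : Poly) :
    pderiv i (pderiv j p) = pderiv j (pderiv i p) := by
  have h : ⁅(pderiv i : Derivation ℝ Poly Poly), (pderiv j : Derivation ℝ Poly Poly)⁆ = 0 := by
    refine MvPolynomial.derivation_ext fun k => ?_
    rw [Derivation.commutator_apply]
    simp [pderiv_X, Pi.single_apply, apply_ite (pderiv i), apply_ite (pderiv j)]
  have := congrArg (fun D => D p) h
  simpa [Derivation.commutator_apply, sub_eq_zero] using this

theorem ang0 (p : Poly) : ang 0 p = X 1 * pderiv 2 p - X 2 * pderiv 1 p := ang_apply 0 p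
theorem ang1 (p : Poly) : ang 1 p = X 2 * pderiv 0 p - X 0 * pderiv 2 p := ang_apply 1 p
theorem ang2 (p : Poly) : ang 2 p = X 0 * pderiv 1 p - X 1 * pderiv 0 p := ang_apply 2 p

theorem lap_eq (p : Poly) : lap p = pderiv 0 (pderiv 0 p) + pderiv 1 (pderiv 1 p)
    + pderiv 2 (pderiv 2 p) := by simp [lap, Fin.sum_univ_three]

theorem rsq_eq : rsq = X 0 ^ 2 + X 1 ^ 2 + X 2 ^ 2 := by simp [rsq, Fin.sum_univ_three]

theorem euler {n : ℕ} {p : Poly} (hp : p.IsHomogeneous n) :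
    X 0 * pderiv 0 p + X 1 * pderiv 1 p + X 2 * pderiv 2 p = (n : Poly) * p := by
  have := hp.sum_X_mul_pderiv
  simpa [Fin.sum_univ_three, nsmul_eq_mul] using this

/-- Euler's identity for the partial derivatives of a homogeneous polynomial. -/
theorem euler_pderiv {n : ℕ} {p : Poly} (hp : p.IsHomogeneous n) (j : Fin 3) :
    X 0 * pderiv 0 (pderiv j p) + X 1 * pderiv 1 (pderiv j p) + X 2 * pderiv 2 (pderiv j p)
      = (n : Poly) * pderiv j p - pderiv j p := by
  have h := congrArg (pderiv j) (euler hp)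
  rw [pderiv_comm 0 j, pderiv_comm 1 j, pderiv_comm 2 j]
  have hn : pderiv j ((n : Poly)) = 0 := by simp
  simp only [map_add, Derivation.leibniz, smul_eq_mul, hn, mul_zero, add_zero] at h
  fin_cases j <;> simp [pderiv_X] at h ⊢ <;> linear_combination h

theorem sum_ang_pderiv (p : Poly) : ∑ i, ang i (pderiv i p) = 0 := by
  simp only [Fin.sum_univ_three, ang0, ang1, ang2]
  rw [pderiv_comm 1 0, pderiv_comm 2 0, pderiv_comm 2 1]
  ring

theorem ang_rsq (i : Fin 3) : ang i rsq = 0 := by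
  rw [rsq_eq]
  fin_cases i <;> simp [ang_apply, pderiv_X] <;> ring

theorem lap_ang (i : Fin 3) (p : Poly) : lap (ang i p) = ang i (lap p) := by
  rw [lap_eq, lap_eq, ang_apply, ang_apply]
  fin_cases i <;>
  simp [pderiv_X] <;>
  simp only [pderiv_comm 1 0, pderiv_comm 2 0, pderiv_comm 2 1] <;> ring

/-- The Casimir operator of the rotation group, on homogeneous polynomials. -/
theorem sum_ang_ang {n : ℕ} {p : Poly} (hp : p.IsHomogeneous n) :
    ∑ i, ang i (ang i p) = rsq * lap p - ((n : Poly) * (n + 1)) * p := by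
  have h := euler hp
  have h0 := euler_pderiv hp 0
  have h1 := euler_pderiv hp 1
  have h2 := euler_pderiv hp 2
  rw [lap_eq, rsq_eq]
  simp only [Fin.sum_univ_three, ang0, ang1, ang2, Derivation.leibniz, map_sub, smul_eq_mul,
    pderiv_X]
  simp only [pderiv_comm 1 0, pderiv_comm 2 0, pderiv_comm 2 1] at *
  simp
  linear_combination (-X 0) * h0 - X 1 * h1 - X 2 * h2 - (n + 1 : Poly) * h

theorem lap_add (p q : Poly) : lap (p + q) = lap p + lap q := by
  simp [lap, Finset.sum_add_distrib]

theorem lap_sub (p q : Poly) : lap (p - q) = lap p - lap q := by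
  simp [lap, Finset.sum_sub_distrib]

theorem lap_smul (c : ℝ) (p : Poly) : lap (c • p) = c • lap p := by
  simp [lap, Finset.smul_sum]

theorem lap_rsq_mul {n : ℕ} {p : Poly} (hp : p.IsHomogeneous n) :
    lap (rsq * p) = rsq * lap p + (4 * (n : Poly) + 6) * p := by
  have h := euler hp
  rw [lap_eq, lap_eq, rsq_eq]
  simp only [sq]
  simp [pderiv_X]
  linear_combination 4 * h

/-- The decomposition that shows that tangential polynomial fields are, up to normal fields,
sums of gradients and of fields `x × ∇ψ`. -/
theorem ang_ang_eq {n : ℕ} {p : Poly} (hp : p.IsHomogeneous n) (i j : Fin 3) :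
    ang i (ang j p) = (n : Poly) * pderiv i (X j * p)
      + (if i = j then rsq * lap p - (n : Poly) * (n + 1) * p else 0)
      - rsq * pderiv i (pderiv j p) + X i * (((n : Poly) - 1) * pderiv j p - X j * lap p) := by
  have h := euler hp
  have h0 := euler_pderiv hp 0
  have h1 := euler_pderiv hp 1
  have h2 := euler_pderiv hp 2
  rw [lap_eq, rsq_eq]
  simp only [pderiv_comm 1 0, pderiv_comm 2 0, pderiv_comm 2 1] at *
  fin_cases i <;> fin_cases j <;>
  simp [ang0, ang1, ang2, pderiv_X, pderiv_comm 1 0, pderiv_comm 2 0, pderiv_comm 2 1]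
  · linear_combination X 0 * h0 - X 1 * h1 - X 2 * h2 - (n : Poly) * h
  · linear_combination X 0 * h1 + X 1 * h0
  · linear_combination X 0 * h2 + X 2 * h0
  · linear_combination X 0 * h1 + X 1 * h0
  · linear_combination X 1 * h1 - X 0 * h0 - X 2 * h2 - (n : Poly) * h
  · linear_combination X 1 * h2 + X 2 * h1
  · linear_combination X 0 * h2 + X 2 * h0
  · linear_combination X 1 * h2 + X 2 * h1
  · linear_combination X 2 * h2 - X 0 * h0 - X 1 * h1 - (n : Poly) * h

theorem isHomogeneous_ang {n : ℕ} {p : Poly} (hp : p.IsHomogeneous n) (i : Fin 3) :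
    (ang i p).IsHomogeneous n := by
  rcases Nat.eq_zero_or_pos n with rfl | hn
  · have : p = C (p.coeff 0) := by
      rw [← MvPolynomial.totalDegree_eq_zero_iff_eq_C]
      exact (MvPolynomial.totalDegree_zero_iff_isHomogeneous _).2 hp
    rw [this, ang_apply]
    simpa using isHomogeneous_zero _ _ _
  · rw [ang_apply]
    have h : 1 + (n - 1) = n := by omega
    have key : ∀ k l : Fin 3, (X k * pderiv l p : Poly).IsHomogeneous n := fun k l => by
      have := (isHomogeneous_X ℝ k).mul (hp.pderiv (i := l))
      rwa [h] at this
    exact (key _ _).sub (key _ _)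

theorem isHomogeneous_lap {n : ℕ} {p : Poly} (hp : p.IsHomogeneous n) :
    (lap p).IsHomogeneous (n - 2) := by
  refine IsHomogeneous.sum _ _ _ fun i _ => ?_
  exact (hp.pderiv (i := i)).pderiv (i := i)

theorem lap_eq_zero_of_lt {n : ℕ} (hn : n < 2) {p : Poly} (hp : p.IsHomogeneous n) :
    lap p = 0 := by
  have key : ∀ q : Poly, q.IsHomogeneous 0 → ∀ i, pderiv i q = 0 := fun q hq i => by
    have : q = C (q.coeff 0) := by
      rw [← MvPolynomial.totalDegree_eq_zero_iff_eq_C]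
      exact (MvPolynomial.totalDegree_zero_iff_isHomogeneous _).2 hq
    rw [this]; simp
  refine Finset.sum_eq_zero fun i _ => key _ ?_ i
  have := hp.pderiv (i := i)
  rwa [show n - 1 = 0 by omega] at this

theorem isHomogeneous_rsq : rsq.IsHomogeneous 2 :=
  IsHomogeneous.sum _ _ _ fun i _ => isHomogeneous_X_pow i 2

/-- The operator `r²Δ + c` is onto on homogeneous polynomials when `c > 0`. -/
theorem exists_rsq_lap_add (m : ℕ) : ∀ (f : Poly), f.IsHomogeneous m → ∀ c : ℝ, 0 < c →
    ∃ q : Poly, q.IsHomogeneous m ∧ rsq * lap q + C c * q = f := by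
  induction m using Nat.strong_induction_on with
  | _ m ih =>
    intro f hf c hc
    have hcc : (C c : Poly) * C c⁻¹ = 1 := by rw [← C_mul, mul_inv_cancel₀ hc.ne', C_1]
    rcases Nat.lt_or_ge m 2 with hm | hm
    · refine ⟨C c⁻¹ * f, hf.C_mul _, ?_⟩
      rw [lap_eq_zero_of_lt hm (hf.C_mul _)]
      linear_combination f * hcc
    · have h4 : (0 : ℝ) < c + (4 * ((m - 2 : ℕ) : ℝ) + 6) := by positivity
      obtain ⟨g, hg, hg'⟩ := ih (m - 2) (by omega) (lap f) (isHomogeneous_lap hf) _ h4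
      have hrg : (rsq * g).IsHomogeneous m := by
        have := isHomogeneous_rsq.mul hg
        rwa [show 2 + (m - 2) = m by omega] at this
      have hl := lap_rsq_mul hg
      refine ⟨C c⁻¹ * (f - rsq * g), (hf.sub hrg).C_mul _, ?_⟩
      rw [C_mul', lap_smul, ← C_mul', lap_sub, hl, ← C_mul']
      have : (C (c + (4 * ((m - 2 : ℕ) : ℝ) + 6)) : Poly) = C c + (4 * ((m - 2 : ℕ) : Poly) + 6) := by
        simp [map_ofNat]
      rw [this] at hg'
      linear_combination (f - rsq * g) * hcc - rsq * C c⁻¹ * hg' + rsq * g * hcc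

/-- Fischer decomposition: a homogeneous polynomial is the sum of a harmonic one and a multiple
of `r²`. -/
theorem fischer {n : ℕ} {p : Poly} (hp : p.IsHomogeneous n) (hn : 2 ≤ n) :
    ∃ q : Poly, q.IsHomogeneous (n - 2) ∧ lap (p - rsq * q) = 0 ∧
      (p - rsq * q).IsHomogeneous n := by
  obtain ⟨q, hq, hq'⟩ := exists_rsq_lap_add (n - 2) (lap p) (isHomogeneous_lap hp)
    (4 * ((n - 2 : ℕ) : ℝ) + 6) (by positivity)
  refine ⟨q, hq, ?_, ?_⟩
  · rw [lap_sub, lap_rsq_mul hq, ← hq']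
    simp [map_ofNat]
  · have := isHomogeneous_rsq.mul hq
    rw [show 2 + (n - 2) = n by omega] at this
    exact hp.sub this

end AngularMomentum
end

noncomputable section

namespace RotatingSphere

open AngularMomentum

/-! ### Angular momentum operators on smooth functions -/

/-- Evaluation of a polynomial at a point of `ℝ³`. -/
def ev (p : Poly) (x : E3) : ℝ := MvPolynomial.eval (fun i => x i) p

@[simp] theorem ev_add (p q : Poly) (x : E3) : ev (p + q) x = ev p x + ev q x := by simp [ev]
@[simp] theorem ev_sub (p q : Poly) (x : E3) : ev (p - q) x = ev p x - ev q x := by simp [ev]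
@[simp] theorem ev_mul (p q : Poly) (x : E3) : ev (p * q) x = ev p x * ev q x := by simp [ev]
@[simp] theorem ev_smul (c : ℝ) (p : Poly) (x : E3) : ev (c • p) x = c * ev p x := by simp [ev]
@[simp] theorem ev_zero (x : E3) : ev 0 x = 0 := by simp [ev]
@[simp] theorem ev_one (x : E3) : ev 1 x = 1 := by simp [ev]
@[simp] theorem ev_X (i : Fin 3) (x : E3) : ev (MvPolynomial.X i) x = x i := by simp [ev]
@[simp] theorem ev_C (c : ℝ) (x : E3) : ev (MvPolynomial.C c) x = c := by simp [ev]
@[simp] theorem ev_natCast (n : ℕ) (x : E3) : ev (n : Poly) x = n := by simp [ev]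
theorem ev_sum {ι : Type*} (s : Finset ι) (f : ι → Poly) (x : E3) :
    ev (∑ i ∈ s, f i) x = ∑ i ∈ s, ev (f i) x := by simp [ev]

theorem ev_rsq (x : S2) : ev rsq x = 1 := by
  have h : ‖(x : E3)‖ = 1 := by simp
  have h2 := EuclideanSpace.norm_sq_eq (x : E3)
  rw [h] at h2
  rw [rsq, ev_sum]
  simpa [ev, sq_abs] using h2.symm

theorem hasFDerivAt_ev (p : Poly) (x : E3) :
    HasFDerivAt (ev p) (∑ i, ev (MvPolynomial.pderiv i p) x • EuclideanSpace.proj (𝕜 := ℝ) i) x := by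
  induction p using MvPolynomial.induction_on with
  | C a =>
    have : ev (MvPolynomial.C a) = fun _ => a := by funext y; simp
    rw [this]
    simpa using hasFDerivAt_const a x
  | add p q hp hq =>
    have : ev (p + q) = fun y => ev p y + ev q y := by funext y; simp
    rw [this]
    refine (hp.add hq).congr_fderiv ?_
    simp [Finset.sum_add_distrib, add_smul]
  | mul_X p j hp =>
    have : ev (p * MvPolynomial.X j) = fun y => ev p y * EuclideanSpace.proj (𝕜 := ℝ) j y := by
      funext y; simp
    rw [this]
    refine (hp.mul (EuclideanSpace.proj (𝕜 := ℝ) j).hasFDerivAt).congr_fderiv ?_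
    ext v
    simp [Fin.sum_univ_three, MvPolynomial.pderiv_X, Pi.single_apply]
    fin_cases j <;> simp <;> ring

theorem contDiff_ev (p : Poly) : ContDiff ℝ ∞ (ev p) := by
  induction p using MvPolynomial.induction_on with
  | C a =>
    have : ev (MvPolynomial.C a) = fun _ => a := by funext y; simp
    rw [this]; exact contDiff_const
  | add p q hp hq =>
    have : ev (p + q) = fun y => ev p y + ev q y := by funext y; simp
    rw [this]; exact hp.add hq
  | mul_X p j hp =>
    have : ev (p * MvPolynomial.X j) = fun y => ev p y * EuclideanSpace.proj (𝕜 := ℝ) j y := by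
      funext y; simp
    rw [this]; exact hp.mul (EuclideanSpace.proj (𝕜 := ℝ) j).contDiff

theorem continuous_ev (p : Poly) : Continuous (ev p) := (contDiff_ev p).continuous

/-- The `i`-th component of the angular momentum operator `x × ∇` on functions on `ℝ³`. -/
def lop (i : Fin 3) (f : E3 → ℝ) (x : E3) : ℝ :=
  x (i + 1) * fderiv ℝ f x (EuclideanSpace.single (i + 2) 1)
    - x (i + 2) * fderiv ℝ f x (EuclideanSpace.single (i + 1) 1)

theorem fderiv_ev (p : Poly) (x : E3) (j : Fin 3) :
    fderiv ℝ (ev p) x (EuclideanSpace.single j 1) = ev (MvPolynomial.pderiv j p) x := by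
  rw [(hasFDerivAt_ev p x).fderiv]
  simp [Fin.sum_univ_three]
  fin_cases j <;> simp

theorem lop_ev (i : Fin 3) (p : Poly) (x : E3) : lop i (ev p) x = ev (ang i p) x := by
  simp [lop, fderiv_ev, ang_apply]

theorem lop_mul (i : Fin 3) {f g : E3 → ℝ} {x : E3} (hf : DifferentiableAt ℝ f x)
    (hg : DifferentiableAt ℝ g x) :
    lop i (fun y => f y * g y) x = f x * lop i g x + lop i f x * g x := by
  simp only [lop, fderiv_fun_mul hf hg]
  simp
  ring

theorem gradient_apply (f : E3 → ℝ) (x : E3) (j : Fin 3) :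
    gradient f x j = fderiv ℝ f x (EuclideanSpace.single j 1) := by
  have h : ⟪gradient f x, EuclideanSpace.single j (1 : ℝ)⟫_ℝ
      = fderiv ℝ f x (EuclideanSpace.single j 1) := by
    simp [gradient]
  rw [← h, EuclideanSpace.inner_single_right]
  simp

theorem cross_gradient (f : E3 → ℝ) (x : E3) (i : Fin 3) :
    cross x (gradient f x) i = lop i f x := by
  fin_cases i <;> simp [cross, lop, gradient_apply]

theorem vorticity_eq {V : E3 → E3} (x : E3) (hV : DifferentiableAt ℝ V x) :
    vorticity V x = ∑ i, lop i (fun y => V y i) x := by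
  have h : ∀ i v, fderiv ℝ (fun y => V y i) x v = fderiv ℝ V x v i := fun i v => by
    have := ((EuclideanSpace.proj (𝕜 := ℝ) i).hasFDerivAt.comp x hV.hasFDerivAt).fderiv
    have h2 : (fun y => V y i) = (EuclideanSpace.proj (𝕜 := ℝ) i) ∘ V := rfl
    rw [h2, this]; rfl
  simp only [vorticity, curl, lop, h, partialDeriv, PiLp.inner_apply, Fin.sum_univ_three]
  simp
  ring

theorem contDiff_lop (i : Fin 3) {f : E3 → ℝ} (hf : ContDiff ℝ ∞ f) : ContDiff ℝ ∞ (lop i f) := by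
  have h : ∀ v : E3, ContDiff ℝ ∞ (fun x => fderiv ℝ f x v) := fun v =>
    (hf.fderiv_right (m := ∞) (by simp)).clm_apply contDiff_const
  have hx : ∀ j : Fin 3, ContDiff ℝ ∞ (fun x : E3 => x j) := fun j =>
    (EuclideanSpace.proj (𝕜 := ℝ) j).contDiff
  exact ((hx _).mul (h _)).sub ((hx _).mul (h _))

/-! ### Rotation invariance and integration by parts on the sphere -/

theorem integrable_of_continuous {F : Type*} [NormedAddCommGroup F] [SecondCountableTopology F]
    {f : S2 → F} (hf : Continuous f) : Integrable f surf := by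
  borelize F
  obtain ⟨C, hC⟩ := (isCompact_univ (X := S2)).exists_bound_of_continuousOn hf.continuousOn
  exact Integrable.of_bound hf.aestronglyMeasurable C (Eventually.of_forall fun x => hC x trivial)

/-- The action of a linear isometry on the unit sphere. -/
def sphereMap (g : E3 ≃ₗᵢ[ℝ] E3) (x : S2) : S2 :=
  ⟨g x, by have h : ‖(x : E3)‖ = 1 := by simp
           simp [h]⟩

theorem continuous_sphereMap (g : E3 ≃ₗᵢ[ℝ] E3) : Continuous (sphereMap g) :=
  (g.continuous.comp continuous_subtype_val).subtype_mk _

open scoped Pointwise in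
theorem measurePreserving_sphereMap (g : E3 ≃ₗᵢ[ℝ] E3) :
    MeasurePreserving (sphereMap g) surf surf := by
  refine ⟨(continuous_sphereMap g).measurable, ?_⟩
  ext s hs
  rw [Measure.map_apply (continuous_sphereMap g).measurable hs,
    Measure.toSphere_apply' _ ((continuous_sphereMap g).measurable hs),
    Measure.toSphere_apply' _ hs]
  congr 1
  have hset : (Ioo (0 : ℝ) 1 • ((↑) '' (sphereMap g ⁻¹' s) : Set E3))
      = g ⁻¹' (Ioo (0 : ℝ) 1 • ((↑) '' s : Set E3)) := by
    ext y
    simp only [Set.mem_smul, mem_image, mem_preimage, Subtype.exists]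
    constructor
    · rintro ⟨r, hr, _, ⟨z, hz, hz', rfl⟩, rfl⟩
      exact ⟨r, hr, g z, ⟨g z, (sphereMap g ⟨z, hz⟩).2, hz', rfl⟩, by simp⟩
    · rintro ⟨r, hr, _, ⟨z, hz, hz', rfl⟩, h⟩
      have hz1 : g.symm z ∈ Metric.sphere (0 : E3) 1 := by
        have : ‖z‖ = 1 := by simpa using hz
        simp [this]
      refine ⟨r, hr, g.symm z, ⟨g.symm z, hz1, ?_, rfl⟩, ?_⟩
      · have : sphereMap g ⟨g.symm z, hz1⟩ = ⟨z, hz⟩ := Subtype.ext (by simp [sphereMap])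
        rwa [this]
      · apply g.injective
        rw [← h]; simp
  rw [hset]
  exact g.measurePreserving.measure_preimage_equiv (f := g.toMeasurableEquiv) _

theorem integral_sphereMap (g : E3 ≃ₗᵢ[ℝ] E3) {f : E3 → ℝ} (hf : Continuous f) :
    ∫ x : S2, f (g x) ∂surf = ∫ x : S2, f x ∂surf := by
  have h := (measurePreserving_sphereMap g)
  have h2 := integral_map (μ := surf) h.measurable.aemeasurable (f := fun x : S2 => f x)
    (hf.comp continuous_subtype_val).aestronglyMeasurable
  rw [h.map_eq] at h2
  exact h2.symm

/-- Differentiation under the integral over the sphere. -/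
theorem hasDerivAt_integral_sphere {F F' : ℝ → S2 → ℝ} (hF : ∀ θ, Continuous (F θ))
    (hF' : Continuous (fun z : ℝ × S2 => F' z.1 z.2))
    (hd : ∀ x θ, HasDerivAt (fun θ => F θ x) (F' θ x) θ) (θ : ℝ) :
    HasDerivAt (fun θ => ∫ x, F θ x ∂surf) (∫ x, F' θ x ∂surf) θ := by
  obtain ⟨C, hC⟩ := ((isCompact_Icc (a := θ - 1) (b := θ + 1)).prod
    (isCompact_univ (X := S2))).exists_bound_of_continuousOn hF'.continuousOn
  have hcF' : Continuous (F' θ) :=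
    hF'.comp (by fun_prop : Continuous (fun x : S2 => (θ, x)))
  exact (hasDerivAt_integral_of_dominated_loc_of_deriv_le (μ := surf)
    (F := F) (F' := F') (x₀ := θ) (s := Icc (θ - 1) (θ + 1))
    (bound := fun _ => C) (Icc_mem_nhds (by linarith) (by linarith))
    (Eventually.of_forall fun θ => (hF θ).aestronglyMeasurable)
    (integrable_of_continuous (hF θ)) hcF'.aestronglyMeasurable
    (Eventually.of_forall fun x θ hθ => hC (θ, x) ⟨hθ, trivial⟩) (integrable_const C)
    (Eventually.of_forall fun x θ _ => hd x θ)).2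

theorem hasDerivAt_integral_comp_flow {f : E3 → ℝ} (hf : ContDiff ℝ ∞ f) {γ γ' : ℝ → E3 → E3}
    (hγ : Continuous (fun z : ℝ × E3 => γ z.1 z.2))
    (hγ' : Continuous (fun z : ℝ × E3 => γ' z.1 z.2))
    (hd : ∀ θ x, HasDerivAt (fun θ => γ θ x) (γ' θ x) θ) (θ : ℝ) :
    HasDerivAt (fun θ => ∫ x : S2, f (γ θ x) ∂surf)
      (∫ x : S2, fderiv ℝ f (γ θ x) (γ' θ x) ∂surf) θ := by
  have hpair : Continuous (fun z : ℝ × S2 => (z.1, (z.2 : E3))) := by fun_prop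
  have hdf : Continuous (fderiv ℝ f) := hf.continuous_fderiv (by simp)
  have h1 : Continuous (fun z : ℝ × S2 => γ z.1 z.2) := hγ.comp hpair
  have h2 : Continuous (fun z : ℝ × S2 => γ' z.1 z.2) := hγ'.comp hpair
  refine hasDerivAt_integral_sphere (F := fun θ x => f (γ θ x))
    (F' := fun θ x => fderiv ℝ f (γ θ x) (γ' θ x)) (fun θ => ?_) ?_ (fun x θ => ?_) θ
  · exact hf.continuous.comp (h1.comp (by fun_prop : Continuous (fun x : S2 => (θ, x))))
  · exact (hdf.comp h1).clm_apply h2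
  · exact (hf.differentiable (by simp) (γ θ x)).hasFDerivAt.comp_hasDerivAt θ (hd θ x)

/-- Angular momentum operators have integral zero over the sphere: differentiate the integral of
`f` composed with the reflections in the lines spanned by `cos θ e_j + sin θ e_k`. -/
theorem integral_lop (i : Fin 3) {f : E3 → ℝ} (hf : ContDiff ℝ ∞ f) :
    ∫ x : S2, lop i f x ∂surf = 0 := by
  set a : E3 := EuclideanSpace.single (i + 1) 1 with ha
  set b : E3 := EuclideanSpace.single (i + 2) 1 with hb
  have hne : i + 1 ≠ i + 2 := by fin_cases i <;> decide
  have hne' : i + 2 ≠ i + 1 := hne.symm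
  let v : ℝ → E3 := fun θ => Real.cos θ • a + Real.sin θ • b
  let v' : ℝ → E3 := fun θ => (-Real.sin θ) • a + Real.cos θ • b
  let γ : ℝ → E3 → E3 := fun θ x => x - (2 * ⟪v θ, x⟫_ℝ) • v θ
  let γ' : ℝ → E3 → E3 := fun θ x => - ((2 * ⟪v θ, x⟫_ℝ) • v' θ + (2 * ⟪v' θ, x⟫_ℝ) • v θ)
  have hvn : ∀ θ, ‖v θ‖ = 1 := fun θ => by
    have : ‖v θ‖ ^ 2 = 1 := by
      rw [← real_inner_self_eq_norm_sq]
      simp only [v, ha, hb, inner_add_left, inner_add_right, real_inner_smul_left,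
        real_inner_smul_right, EuclideanSpace.inner_single_left]
      simp [hne, hne']
      nlinarith [Real.sin_sq_add_cos_sq θ]
    nlinarith [norm_nonneg (v θ)]
  have hγ : ∀ θ x, γ θ x = (ℝ ∙ (v θ))ᗮ.reflection x := fun θ x => by
    rw [Submodule.reflection_orthogonal_apply, Submodule.reflection_apply,
      Submodule.starProjection_unit_singleton ℝ (hvn θ)]
    simp only [γ]
    module
  have hv : ∀ θ, HasDerivAt v (v' θ) θ := fun θ =>
    ((Real.hasDerivAt_cos θ).smul_const a).add ((Real.hasDerivAt_sin θ).smul_const b)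
  have hγd : ∀ θ x, HasDerivAt (fun θ => γ θ x) (γ' θ x) θ := fun θ x => by
    have h1 : HasDerivAt (fun θ => 2 * ⟪v θ, x⟫_ℝ) (2 * ⟪v' θ, x⟫_ℝ) θ := by
      have := (hv θ).inner ℝ (hasDerivAt_const θ x)
      simp only [inner_zero_right, zero_add] at this
      exact this.const_mul 2
    have := (h1.smul (hv θ)).const_sub x
    exact this
  have hcv : Continuous v := by fun_prop
  have hcv' : Continuous v' := by fun_prop
  have hcγ : Continuous (fun z : ℝ × E3 => γ z.1 z.2) := by fun_prop
  have hcγ' : Continuous (fun z : ℝ × E3 => γ' z.1 z.2) := by fun_prop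
  have key := hasDerivAt_integral_comp_flow hf hcγ hcγ' hγd 0
  have hconst : (fun θ => ∫ x : S2, f (γ θ x) ∂surf) = fun _ => ∫ x : S2, f x ∂surf := by
    funext θ
    simp_rw [hγ θ]
    exact integral_sphereMap _ hf.continuous
  rw [hconst] at key
  have h0 := key.unique (hasDerivAt_const _ _)
  -- at `θ = 0` the velocity field of the reflections is twice the rotation field
  have hval : ∀ x : S2, fderiv ℝ f (γ 0 x) (γ' 0 x) = 2 * lop i f (γ 0 x) := fun x => by
    have hx1 : γ 0 x (i + 1) = - (x : E3) (i + 1) := by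
      simp [γ, v, ha, hb, EuclideanSpace.inner_single_left]; ring
    have hx2 : γ 0 x (i + 2) = (x : E3) (i + 2) := by
      simp [γ, v, ha, hb, hne', EuclideanSpace.inner_single_left]
    have hg : γ' 0 x = (2 * γ 0 x (i + 1)) • b - (2 * γ 0 x (i + 2)) • a := by
      rw [hx1, hx2]
      simp [γ', v, v', ha, hb, EuclideanSpace.inner_single_left]
      module
    simp only [hg, map_sub, map_smul, lop, smul_eq_mul, ← ha, ← hb]
    ring
  simp_rw [hval] at h0
  rw [integral_const_mul] at h0
  have h1 : ∫ x : S2, lop i f (γ 0 x) ∂surf = ∫ x : S2, lop i f x ∂surf := by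
    simp_rw [hγ 0]
    exact integral_sphereMap _ (contDiff_lop i hf).continuous
  rw [h1] at h0
  linarith

theorem integral_mul_lop (i : Fin 3) {f g : E3 → ℝ} (hf : ContDiff ℝ ∞ f)
    (hg : ContDiff ℝ ∞ g) :
    ∫ x : S2, f x * lop i g x ∂surf = - ∫ x : S2, lop i f x * g x ∂surf := by
  have h := integral_lop i (hf.mul hg)
  have h1 : ∀ x : S2, lop i (fun y => f y * g y) x = f x * lop i g x + lop i f x * g x :=
    fun x => lop_mul i (hf.differentiable (by simp) _) (hg.differentiable (by simp) _)
  have hc : ∀ {u v : E3 → ℝ}, ContDiff ℝ ∞ u → ContDiff ℝ ∞ v →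
      Integrable (fun x : S2 => u x * v x) surf := fun hu hv =>
    integrable_of_continuous ((hu.mul hv).continuous.comp continuous_subtype_val)
  change ∫ x : S2, lop i (fun y => f y * g y) x ∂surf = 0 at h
  simp_rw [h1] at h
  rw [integral_add (hc hf (contDiff_lop i hg)) (hc (contDiff_lop i hf) hg)] at h
  linarith

/-! ### The solenoidal fields `x × ∇p` -/

/-- The vector field `x × ∇p` on `ℝ³`, for a polynomial `p`. -/
def angVec (p : Poly) (x : E3) : E3 := WithLp.toLp 2 (fun i => ev (ang i p) x)

@[simp] theorem angVec_apply (p : Poly) (x : E3) (i : Fin 3) : angVec p x i = ev (ang i p) x := rfl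

theorem contDiff_angVec (p : Poly) : ContDiff ℝ ∞ (angVec p) := by
  rw [contDiff_euclidean]
  exact fun i => contDiff_ev _

theorem inner_eq_sum (x y : E3) : ⟪x, y⟫_ℝ = ∑ i, x i * y i := by
  rw [PiLp.inner_apply]
  exact Finset.sum_congr rfl fun i _ => mul_comm _ _

theorem integrable_ev_mul {f : E3 → ℝ} (p : Poly) (hf : ContDiff ℝ ∞ f) :
    Integrable (fun x : S2 => ev p x * f x) surf :=
  integrable_of_continuous (((contDiff_ev p).mul hf).continuous.comp continuous_subtype_val)

theorem inner_angVec_self (p : Poly) (x : E3) : ⟪angVec p x, x⟫_ℝ = 0 := by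
  simp [inner_eq_sum, Fin.sum_univ_three, ang0, ang1, ang2]
  ring

/-- The scalar triple product `∇φ · (x × ∇p) = -∇p · (x × ∇φ)`. -/
theorem inner_angVec_gradient (p : Poly) (φ : E3 → ℝ) (x : E3) :
    ⟪angVec p x, gradient φ x⟫_ℝ = - ∑ i, ev (MvPolynomial.pderiv i p) x * lop i φ x := by
  simp only [inner_eq_sum, Fin.sum_univ_three, gradient_apply, lop, angVec_apply, ang0, ang1, ang2]
  simp
  ring

theorem isSolenoidal_angVec (p : Poly) : IsSolenoidal (fun x => angVec p x) := by
  refine ⟨Eventually.of_forall fun x => inner_angVec_self p x, fun φ hφ => ?_⟩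
  simp_rw [inner_angVec_gradient]
  rw [integral_neg, integral_finsetSum _ fun i _ => integrable_ev_mul _ (contDiff_lop i hφ)]
  simp_rw [fun i => integral_mul_lop i (contDiff_ev (MvPolynomial.pderiv i p)) hφ, lop_ev]
  rw [Finset.sum_neg_distrib, neg_neg, ← integral_finsetSum _ fun i _ => integrable_ev_mul _ hφ]
  simp_rw [← Finset.sum_mul, ← ev_sum, sum_ang_pderiv]
  simp

/-- The restriction to the sphere of the field `x × ∇p`, as a continuous field. -/
def angC : Poly →ₗ[ℝ] C(S2, E3) where
  toFun p := ⟨fun x => angVec p x, (contDiff_angVec p).continuous.comp continuous_subtype_val⟩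
  map_add' p q := by ext x i; simp
  map_smul' c p := by ext x i; simp

@[simp] theorem angC_apply (p : Poly) (x : S2) : angC p x = angVec p x := rfl

theorem angC_ae (p : Poly) (r : ℝ≥0∞) [Fact (1 ≤ r)] :
    (ContinuousMap.toLp (E := E3) r surf ℝ (angC p) : S2 → E3) =ᵐ[surf] fun x => angVec p x :=
  ContinuousMap.coeFn_toLp surf (𝕜 := ℝ) (angC p)

theorem IsSolenoidal.congr {u v : S2 → E3} (hu : IsSolenoidal u) (h : v =ᵐ[surf] u) :
    IsSolenoidal v := by
  refine ⟨?_, fun φ hφ => ?_⟩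
  · filter_upwards [hu.1, h] with x h1 h2
    rw [h2, h1]
  · rw [← hu.2 φ hφ]
    refine integral_congr_ae ?_
    filter_upwards [h] with x h2
    rw [h2]

/-- The field `x × ∇p` as an element of `H`. -/
def angH : Poly →ₗ[ℝ] H where
  toFun p := ⟨ContinuousMap.toLp (E := E3) 2 surf ℝ (angC p),
    (isSolenoidal_angVec p).congr (angC_ae p 2)⟩
  map_add' p q := by ext1; simp
  map_smul' c p := by ext1; simp

theorem angH_ae (p : Poly) : ((angH p : Lp E3 2 surf) : S2 → E3) =ᵐ[surf] fun x => angVec p x :=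
  angC_ae p 2

/-- The field `x × ∇p` as an element of `X`. -/
def angX : Poly →ₗ[ℝ] X where
  toFun p := ⟨WithLp.toLp 1 (angH p, ContinuousMap.toLp (E := E3) 4 surf ℝ (angC p)),
    (angC_ae p 2).trans (angC_ae p 4).symm⟩
  map_add' p q := by ext1; simp; rfl
  map_smul' c p := by ext1; simp; rfl

@[simp] theorem toH_angX (p : Poly) : toH (angX p) = angH p := rfl

theorem inner_H (u v : H) : ⟪u, v⟫_ℝ
    = ∫ x, ⟪(u : Lp E3 2 surf) x, (v : Lp E3 2 surf) x⟫_ℝ ∂surf := rfl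

theorem inner_smul_H (c : ℝ) (u v : H) : ⟪c • u, v⟫_ℝ = c * ⟪u, v⟫_ℝ :=
  real_inner_smul_left u v c

theorem inner_angH (u : H) (p : Poly) :
    ⟪u, angH p⟫_ℝ = ∫ x, ⟪(u : Lp E3 2 surf) x, angVec p x⟫_ℝ ∂surf := by
  rw [inner_H]
  refine integral_congr_ae ?_
  filter_upwards [angH_ae p] with x hx
  rw [hx]

theorem inner_angH_angH (p q : Poly) :
    ⟪angH p, angH q⟫_ℝ = ∑ i, ∫ x : S2, ev (ang i p) x * ev (ang i q) x ∂surf := by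
  rw [inner_angH, ← integral_finsetSum _ fun i _ => integrable_ev_mul _ (contDiff_ev _)]
  refine integral_congr_ae ?_
  filter_upwards [angH_ae p] with x hx
  rw [hx, inner_eq_sum]
  rfl

/-! ### The Stokes operator -/

/-- A harmonic polynomial, homogeneous of degree `n`. -/
def IsHarm (n : ℕ) (p : Poly) : Prop := p.IsHomogeneous n ∧ lap p = 0

theorem IsHarm.ang {n : ℕ} {p : Poly} (hp : IsHarm n p) (i : Fin 3) : IsHarm n (ang i p) :=
  ⟨isHomogeneous_ang hp.1 i, by rw [lap_ang, hp.2, map_zero]⟩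

theorem IsHarm.casimir {n : ℕ} {p : Poly} (hp : IsHarm n p) :
    ∑ i, AngularMomentum.ang i (AngularMomentum.ang i p) = (-((n : ℝ) * (n + 1))) • p := by
  rw [sum_ang_ang hp.1, hp.2, MvPolynomial.smul_eq_C_mul]
  simp

/-- The eigenvalues of the Stokes operator. -/
def stokesEv (n : ℕ) : ℝ := n * (n + 1) - 2

theorem cross_eq_angVec {V : E3 → E3} {p : Poly} {x : E3}
    (h : ∀ y, vorticity V y = ev p y) : laplaceDeRham V x = angVec p x := by
  have h' : vorticity V = ev p := funext h
  ext i
  rw [laplaceDeRham, cross_gradient, h', lop_ev, angVec_apply]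

theorem laplaceDeRham_angVec {n : ℕ} {p : Poly} (hp : IsHarm n p) (x : E3) :
    laplaceDeRham (angVec p) x = (-((n : ℝ) * (n + 1))) • angVec p x := by
  rw [cross_eq_angVec (p := (-((n : ℝ) * (n + 1))) • p)]
  · ext i; rw [angVec_apply, Derivation.map_smul, ev_smul]; rfl
  · intro y
    rw [vorticity_eq y ((contDiff_angVec p).differentiable (by simp) y), ← hp.casimir, ev_sum]
    exact Finset.sum_congr rfl fun i _ => lop_ev i _ y

/-- Testing the Stokes operator with a harmonic field. -/
theorem IsStokes.inner_angH {u f : H} (h : IsStokes u f) {n : ℕ} {p : Poly} (hp : IsHarm n p) :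
    ⟪f, angH p⟫_ℝ = stokesEv n * ⟪u, angH p⟫_ℝ := by
  rw [RotatingSphere.inner_angH, RotatingSphere.inner_angH,
    h (angVec p) (contDiff_angVec p) (isSolenoidal_angVec p), ← integral_const_mul, ← integral_neg]
  refine integral_congr_ae (Eventually.of_forall fun x => ?_)
  simp only [laplaceDeRham_angVec hp, ← add_smul, real_inner_smul_right, stokesEv]
  ring

/-- The fields `x × ∇p` with `p` harmonic are eigenfields of the Stokes operator. -/
theorem isStokes_angH {n : ℕ} {p : Poly} (hp : IsHarm n p) :
    IsStokes (angH p) (stokesEv n • angH p) := by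
  intro V hV hVs
  have hVi : ∀ i, ContDiff ℝ ∞ (fun y => V y i) := fun i =>
    (EuclideanSpace.proj (𝕜 := ℝ) i).contDiff.comp hV
  have hvor : ContDiff ℝ ∞ (vorticity V) := by
    have : vorticity V = fun x => ∑ i, lop i (fun y => V y i) x :=
      funext fun x => vorticity_eq x (hV.differentiable (by simp) x)
    rw [this]
    exact ContDiff.sum fun i _ => contDiff_lop i (hVi i)
  have hint : ∀ i, Integrable (fun x : S2 => ev (ang i p) x * V x i) surf := fun i =>
    integrable_ev_mul _ (hVi i)
  have hint2 : ∀ i, Integrable (fun x : S2 => ev (ang i p) x * lop i (vorticity V) x) surf :=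
    fun i => integrable_ev_mul _ (contDiff_lop i hvor)
  have hL : ∫ x, ⟪((stokesEv n • angH p : H) : Lp E3 2 surf) x, V x⟫_ℝ ∂surf
      = stokesEv n * ∑ i, ∫ x : S2, ev (ang i p) x * V x i ∂surf := by
    rw [← integral_finsetSum _ fun i _ => hint i, ← integral_const_mul]
    refine integral_congr_ae ?_
    filter_upwards [angH_ae p, Lp.coeFn_smul (stokesEv n) (angH p : Lp E3 2 surf)] with x h1 h2
    rw [Submodule.coe_smul, h2, Pi.smul_apply, h1, real_inner_smul_left, inner_eq_sum]
    rfl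
  have hR : ∫ x, ⟪(angH p : Lp E3 2 surf) x, laplaceDeRham V x + (2 : ℝ) • V x⟫_ℝ ∂surf
      = (∑ i, ∫ x : S2, ev (ang i p) x * lop i (vorticity V) x ∂surf)
        + 2 * ∑ i, ∫ x : S2, ev (ang i p) x * V x i ∂surf := by
    rw [← integral_finsetSum _ fun i _ => hint i, ← integral_finsetSum _ fun i _ => hint2 i,
      ← integral_const_mul, ← integral_add (integrable_finsetSum _ fun i _ => hint2 i)
        ((integrable_finsetSum _ fun i _ => hint i).const_mul 2)]
    refine integral_congr_ae ?_
    filter_upwards [angH_ae p] with x h1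
    rw [h1, inner_add_right, real_inner_smul_right, inner_eq_sum, inner_eq_sum]
    simp only [laplaceDeRham, cross_gradient]
    rfl
  have h1 : ∑ i, ∫ x : S2, ev (ang i p) x * lop i (vorticity V) x ∂surf
      = (n : ℝ) * (n + 1) * ∫ x : S2, ev p x * vorticity V x ∂surf := by
    simp_rw [fun i => integral_mul_lop i (contDiff_ev (ang i p)) hvor, lop_ev]
    rw [Finset.sum_neg_distrib, ← integral_finsetSum _ fun i _ => integrable_ev_mul _ hvor]
    simp_rw [← Finset.sum_mul, ← ev_sum, hp.casimir, ev_smul, mul_assoc, integral_const_mul]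
    ring
  have h2 : ∫ x : S2, ev p x * vorticity V x ∂surf
      = - ∑ i, ∫ x : S2, ev (ang i p) x * V x i ∂surf := by
    have : ∀ x : S2, ev p x * vorticity V x = ∑ i, ev p x * lop i (fun y => V y i) x := fun x => by
      rw [vorticity_eq _ (hV.differentiable (by simp) _), Finset.mul_sum]
    simp_rw [this]
    rw [integral_finsetSum _ fun i _ => integrable_ev_mul _ (contDiff_lop i (hVi i))]
    simp_rw [fun i => integral_mul_lop i (contDiff_ev p) (hVi i), lop_ev]
    rw [Finset.sum_neg_distrib]
  rw [hL, hR, h1, h2, stokesEv]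
  ring

/-! ### The Coriolis operator -/

theorem integrable_inner_cont (v : H) {V : S2 → E3} (hV : Continuous V) :
    Integrable (fun x => ⟪(v : Lp E3 2 surf) x, V x⟫_ℝ) surf := by
  have hL : MemLp V 2 surf := by
    obtain ⟨C, hC⟩ := (isCompact_univ (X := S2)).exists_bound_of_continuousOn hV.continuousOn
    exact MemLp.of_bound hV.aestronglyMeasurable C (Eventually.of_forall fun x => hC x trivial)
  refine (L2.integrable_inner (𝕜 := ℝ) (v : Lp E3 2 surf) (hL.toLp _)).congr ?_
  filter_upwards [hL.coeFn_toLp] with x hx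
  rw [hx]

theorem inner_gradient_eq_zero (v : H) (p : Poly) :
    ∫ x, ⟪(v : Lp E3 2 surf) x, gradient (ev p) x⟫_ℝ ∂surf = 0 :=
  v.2.2 _ (contDiff_ev p)

theorem continuous_gradient_ev (p : Poly) : Continuous (fun x : S2 => gradient (ev p) x) := by
  have : (fun x : S2 => gradient (ev p) x)
      = fun x : S2 => WithLp.toLp 2 (fun i => ev (MvPolynomial.pderiv i p) x) := by
    funext x; ext i; rw [gradient_apply, fderiv_ev]
  rw [this]
  refine (PiLp.continuous_toLp 2 _).comp (continuous_pi fun i => ?_)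
  exact (continuous_ev _).comp continuous_subtype_val

theorem integrable_coord_mul (v : H) (j : Fin 3) (p : Poly) :
    Integrable (fun x : S2 => (v : Lp E3 2 surf) x j * ev p x) surf := by
  have hc : Continuous (fun x : S2 => ev p x • EuclideanSpace.single j (1 : ℝ)) :=
    ((continuous_ev p).comp continuous_subtype_val).smul continuous_const
  refine (integrable_inner_cont v hc).congr (Eventually.of_forall fun x => ?_)
  simp [real_inner_smul_right, EuclideanSpace.inner_single_right, mul_comm]

/-- The pairing of a solenoidal field with `x × ∇(ang j p)` only sees the `j`-th component. -/
theorem inner_angH_ang (v : H) (j : Fin 3) {n : ℕ} {p : Poly} (hp : p.IsHomogeneous n) :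
    ⟪v, angH (ang j p)⟫_ℝ =
      ∫ x : S2, (v : Lp E3 2 surf) x j * ev (lap p - ((n : Poly) * (n + 1)) * p) x ∂surf := by
  have key : ∀ᵐ x : S2 ∂surf, ⟪(v : Lp E3 2 surf) x, angVec (ang j p) x⟫_ℝ
      = (n : ℝ) * ⟪(v : Lp E3 2 surf) x, gradient (ev (MvPolynomial.X j * p)) x⟫_ℝ
        - ⟪(v : Lp E3 2 surf) x, gradient (ev (MvPolynomial.pderiv j p)) x⟫_ℝ
        + (v : Lp E3 2 surf) x j * ev (lap p - ((n : Poly) * (n + 1)) * p) x := by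
    filter_upwards [v.2.1] with x hx
    have hr := ev_rsq x
    have ha : ∀ i, ev (ang i (ang j p)) x = (n : ℝ) * ev (MvPolynomial.pderiv i (MvPolynomial.X j * p)) x
      + (if i = j then ev (lap p - ((n : Poly) * (n + 1)) * p) x else 0)
      - ev (MvPolynomial.pderiv i (MvPolynomial.pderiv j p)) x
      + (x : E3) i * ev (((n : Poly) - 1) * MvPolynomial.pderiv j p - MvPolynomial.X j * lap p) x := by
      intro i
      rw [ang_ang_eq hp i j]
      split_ifs <;> simp [hr]
    rw [inner_eq_sum] at hx
    simp only [inner_eq_sum, angVec_apply, ha, gradient_apply, fderiv_ev]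
    simp only [Fin.sum_univ_three] at hx ⊢
    generalize ev (((n : Poly) - 1) * MvPolynomial.pderiv j p - MvPolynomial.X j * lap p) x = c at *
    fin_cases j <;> simp <;> linear_combination c * hx
  rw [inner_angH, integral_congr_ae key, integral_add, integral_sub, integral_const_mul,
    inner_gradient_eq_zero, inner_gradient_eq_zero]
  · simp
  · exact (integrable_inner_cont v (continuous_gradient_ev _)).const_mul _
  · exact integrable_inner_cont v (continuous_gradient_ev _)
  · exact ((integrable_inner_cont v (continuous_gradient_ev _)).const_mul _).sub
      (integrable_inner_cont v (continuous_gradient_ev _))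
  · exact integrable_coord_mul v j _

theorem inner_cross_comm (x u v : E3) : ⟪cross x u, v⟫_ℝ = - ⟪cross x v, u⟫_ℝ := by
  simp [inner_eq_sum, Fin.sum_univ_three, cross]
  ring

/-- The Coriolis operator is skew-symmetric. -/
theorem IsCoriolis.inner_eq_neg {Om : ℝ} {u v c d : H} (hu : IsCoriolis Om u c)
    (hv : IsCoriolis Om v d) : ⟪c, v⟫_ℝ = - ⟪u, d⟫_ℝ := by
  rw [real_inner_comm d u, inner_H, inner_H, hu v, hv u, ← integral_neg]
  refine integral_congr_ae (Eventually.of_forall fun x => ?_)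
  simp only [coriolisForce, real_inner_smul_left]
  rw [inner_cross_comm]
  ring

theorem norm_cross_le {x u : E3} (hx : ‖x‖ = 1) : ‖cross x u‖ ≤ ‖u‖ := by
  have h1 : ‖cross x u‖ ^ 2 = ‖x‖ ^ 2 * ‖u‖ ^ 2 - ⟪x, u⟫_ℝ ^ 2 := by
    simp only [← real_inner_self_eq_norm_sq, inner_eq_sum, Fin.sum_univ_three, cross]
    simp
    ring
  rw [hx] at h1
  refine (sq_le_sq₀ (norm_nonneg _) (norm_nonneg _)).1 ?_
  nlinarith [sq_nonneg ⟪x, u⟫_ℝ]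

theorem norm_sphere (x : S2) : ‖(x : E3)‖ = 1 := by simp

theorem abs_coord_sphere (x : S2) (i : Fin 3) : |(x : E3) i| ≤ 1 := by
  have := PiLp.norm_apply_le (x : E3) i
  rwa [norm_sphere] at this

theorem norm_coriolisForce_le (Om : ℝ) (u : S2 → E3) (x : S2) :
    ‖coriolisForce Om u x‖ ≤ 2 * |Om| * ‖u x‖ := by
  rw [coriolisForce, norm_smul, Real.norm_eq_abs, abs_mul, abs_mul, abs_two]
  have h1 := abs_coord_sphere x 2
  have h2 := norm_cross_le (u := u x) (norm_sphere x)
  have h3 : 2 * |Om| * |(x : E3) 2| ≤ 2 * |Om| * 1 := by gcongr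
  rw [mul_one] at h3
  exact mul_le_mul h3 h2 (norm_nonneg _) (by positivity)

theorem IsCoriolis.norm_le {Om : ℝ} {u c : H} (hu : IsCoriolis Om u c) :
    ‖c‖ ≤ 2 * |Om| * ‖u‖ := by
  have hi : ∀ v : H, Integrable
      (fun x => ⟪(v : Lp E3 2 surf) x, (v : Lp E3 2 surf) x⟫_ℝ) surf := fun v =>
    L2.integrable_inner (𝕜 := ℝ) (v : Lp E3 2 surf) (v : Lp E3 2 surf)
  have h1 : ⟪c, c⟫_ℝ ≤ 2⁻¹ * ⟪c, c⟫_ℝ + 2 * Om ^ 2 * ⟪u, u⟫_ℝ := by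
    have h : ⟪c, c⟫_ℝ = ∫ x, ⟪coriolisForce Om (u : Lp E3 2 surf) x, (c : Lp E3 2 surf) x⟫_ℝ ∂surf :=
      hu c
    conv_lhs => rw [h]
    rw [inner_H, inner_H, ← integral_const_mul, ← integral_const_mul,
      ← integral_add ((hi c).const_mul _) ((hi u).const_mul _)]
    refine (le_abs_self _).trans ((abs_integral_le_integral_abs).trans ?_)
    refine integral_mono_of_nonneg (Eventually.of_forall fun x => abs_nonneg _)
      (((hi c).const_mul _).add ((hi u).const_mul _)) (Eventually.of_forall fun x => ?_)
    simp only [real_inner_self_eq_norm_sq]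
    have h2 := abs_real_inner_le_norm (coriolisForce Om (u : Lp E3 2 surf) x)
      ((c : Lp E3 2 surf) x)
    have h3 := norm_coriolisForce_le Om (u : Lp E3 2 surf) x
    have h4 := mul_le_mul_of_nonneg_right h3 (norm_nonneg ((c : Lp E3 2 surf) x))
    have h5 := sq_nonneg (‖(c : Lp E3 2 surf) x‖ - 2 * |Om| * ‖(u : Lp E3 2 surf) x‖)
    have h6 : |Om| ^ 2 = Om ^ 2 := sq_abs Om
    nlinarith
  rw [real_inner_self_eq_norm_sq, real_inner_self_eq_norm_sq] at h1
  refine (sq_le_sq₀ (norm_nonneg _) (by positivity)).1 ?_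
  rw [mul_pow, mul_pow, sq_abs]
  linarith

/-- The Coriolis operator preserves the eigenspaces of the Stokes operator. -/
theorem isCoriolis_angH (Om : ℝ) {n : ℕ} (hn : n ≠ 0) {p : Poly} (hp : IsHarm n p) :
    IsCoriolis Om (angH p) ((-(2 * Om) / ((n : ℝ) * (n + 1))) • angH (ang 2 p)) := by
  intro v
  have hn' : (n : ℝ) * (n + 1) ≠ 0 := by positivity
  have hL : ∫ x, ⟪((((-(2 * Om) / ((n : ℝ) * (n + 1))) • angH (ang 2 p) : H)) : Lp E3 2 surf) x,
      (v : Lp E3 2 surf) x⟫_ℝ ∂surf = 2 * Om * ∫ x : S2, (v : Lp E3 2 surf) x 2 * ev p x ∂surf := by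
    rw [← inner_H, inner_smul_H, real_inner_comm, inner_angH_ang v 2 hp.1, hp.2]
    have : ∀ x : S2, (v : Lp E3 2 surf) x 2 * ev (0 - ((n : Poly) * (n + 1)) * p) x
        = -((n : ℝ) * (n + 1)) * ((v : Lp E3 2 surf) x 2 * ev p x) := fun x => by
      simp only [ev_sub, ev_zero, ev_mul, ev_natCast, ev_add, ev_one]; ring
    simp_rw [this, integral_const_mul]
    field_simp
  rw [hL]
  have key : ∀ᵐ x : S2 ∂surf,
      ⟪coriolisForce Om (angH p : Lp E3 2 surf) x, (v : Lp E3 2 surf) x⟫_ℝ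
      = 2 * Om * ((v : Lp E3 2 surf) x 2 * ev p x)
        - 2 * Om * ⟪(v : Lp E3 2 surf) x, gradient (ev (MvPolynomial.X 2 * p)) x⟫_ℝ := by
    filter_upwards [v.2.1, angH_ae p] with x hx h1
    have hr := ev_rsq x
    rw [rsq_eq] at hr
    simp only [ev_add, ev_X, sq, ev_mul] at hr
    rw [coriolisForce, h1, real_inner_smul_left]
    simp only [inner_eq_sum, gradient_apply, fderiv_ev] at hx ⊢
    simp only [Fin.sum_univ_three, cross] at hx ⊢
    simp [ang0, ang1, ang2]
    set P0 := ev (MvPolynomial.pderiv 0 p) x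
    set P1 := ev (MvPolynomial.pderiv 1 p) x
    set P2 := ev (MvPolynomial.pderiv 2 p) x
    set w := (v : Lp E3 2 surf) x
    linear_combination 2 * Om * (x : E3) 2 * ((x : E3) 0 * P0 + (x : E3) 1 * P1 + (x : E3) 2 * P2) * hx
      - 2 * Om * (x : E3) 2 * (w 0 * P0 + w 1 * P1 + w 2 * P2) * hr
  rw [integral_congr_ae key, integral_sub, integral_const_mul, integral_const_mul,
    inner_gradient_eq_zero]
  · simp
  · exact (integrable_coord_mul v 2 p).const_mul _
  · exact (integrable_inner_cont v (continuous_gradient_ev _)).const_mul _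

/-! ### Completeness of the Stokes eigenspaces -/

theorem angH_rsq_mul (q : Poly) : angH (rsq * q) = angH q := by
  have : angC (rsq * q) = angC q := by
    ext x i
    simp [angVec_apply, ang_rsq, ev_rsq]
  ext1
  exact congrArg (ContinuousMap.toLp (E := E3) 2 surf ℝ) this

/-- On the sphere every homogeneous polynomial is a sum of harmonic ones, so that the test fields
`x × ∇p` with `p` harmonic detect all homogeneous `p`. -/
theorem inner_angH_eq_zero_of_isHomogeneous {v : H}
    (hv : ∀ n p, IsHarm n p → ⟪v, angH p⟫_ℝ = 0) (n : ℕ) :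
    ∀ p : Poly, p.IsHomogeneous n → ⟪v, angH p⟫_ℝ = 0 := by
  induction n using Nat.strong_induction_on with
  | _ n ih =>
    intro p hp
    rcases Nat.lt_or_ge n 2 with hn | hn
    · exact hv n p ⟨hp, lap_eq_zero_of_lt hn hp⟩
    · obtain ⟨q, hq, hl, hh⟩ := fischer hp hn
      have h1 := hv n _ ⟨hh, hl⟩
      have h2 := ih (n - 2) (by omega) q hq
      rw [map_sub, angH_rsq_mul, inner_sub_right, h2, sub_zero] at h1
      exact h1

/-- If `v` is orthogonal to the fields `x × ∇p`, its components are orthogonal to all homogeneous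
polynomials: this follows from `inner_angH_ang` by descent on the degree. -/
theorem integral_coord_mul_eq_zero {v : H}
    (hv : ∀ n p, IsHarm n p → ⟪v, angH p⟫_ℝ = 0) (j : Fin 3) (n : ℕ) :
    ∀ p : Poly, p.IsHomogeneous n → ∫ x : S2, (v : Lp E3 2 surf) x j * ev p x ∂surf = 0 := by
  induction n using Nat.strong_induction_on with
  | _ n ih =>
    intro p hp
    rcases Nat.eq_zero_or_pos n with rfl | hn
    · have hpc : p = MvPolynomial.C (p.coeff 0) := by
        rw [← MvPolynomial.totalDegree_eq_zero_iff_eq_C]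
        exact (MvPolynomial.totalDegree_zero_iff_isHomogeneous _).2 hp
      have h := inner_gradient_eq_zero v (MvPolynomial.X j)
      have h2 : ∀ x : S2, (v : Lp E3 2 surf) x j * ev p x
          = ev p 0 * ⟪(v : Lp E3 2 surf) x, gradient (ev (MvPolynomial.X j)) x⟫_ℝ := fun x => by
        rw [hpc]
        simp only [inner_eq_sum, gradient_apply, fderiv_ev, ev_C]
        fin_cases j <;> simp [Fin.sum_univ_three, MvPolynomial.pderiv_X, mul_comm]
      simp_rw [h2, integral_const_mul, h, mul_zero]
    · have h := inner_angH_ang v j hp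
      rw [inner_angH_eq_zero_of_isHomogeneous hv n _ (isHomogeneous_ang hp j)] at h
      have hl : ∫ x : S2, (v : Lp E3 2 surf) x j * ev (lap p) x ∂surf = 0 := by
        rcases Nat.lt_or_ge n 2 with hn2 | hn2
        · simp [lap_eq_zero_of_lt hn2 hp]
        · exact ih (n - 2) (by omega) _ (isHomogeneous_lap hp)
      have h3 : ∀ x : S2, (v : Lp E3 2 surf) x j * ev (lap p - ((n : Poly) * (n + 1)) * p) x
          = (v : Lp E3 2 surf) x j * ev (lap p) x
            - ((n : ℝ) * (n + 1)) * ((v : Lp E3 2 surf) x j * ev p x) := fun x => by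
        simp only [ev_sub, ev_mul, ev_natCast, ev_add, ev_one]; ring
      simp_rw [h3] at h
      rw [integral_sub (integrable_coord_mul v j _) ((integrable_coord_mul v j _).const_mul _),
        hl, integral_const_mul, zero_sub] at h
      have hn' : (n : ℝ) * (n + 1) ≠ 0 := by positivity
      have := neg_eq_zero.1 h.symm
      exact (mul_eq_zero.1 this).resolve_left hn'

/-- The polynomial functions on the sphere, as a subalgebra of the continuous functions. -/
def polyAlg : Subalgebra ℝ C(S2, ℝ) :=
  (MvPolynomial.aeval (R := ℝ) (fun i : Fin 3 =>
    (⟨fun x : S2 => (x : E3) i, by fun_prop⟩ : C(S2, ℝ)))).range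

theorem polyAlg_dense : polyAlg.topologicalClosure = ⊤ := by
  refine ContinuousMap.subalgebra_topologicalClosure_eq_top_of_separatesPoints _ ?_
  intro x y hxy
  have : ∃ i, (x : E3) i ≠ (y : E3) i := by
    by_contra! h
    exact hxy (Subtype.ext (PiLp.ext h))
  obtain ⟨i, hi⟩ := this
  refine ⟨_, ⟨_, ⟨MvPolynomial.X i, rfl⟩, rfl⟩, ?_⟩
  simpa using hi

theorem mem_polyAlg {f : C(S2, ℝ)} (hf : f ∈ polyAlg) : ∃ p : Poly, ∀ x : S2, f x = ev p x := by
  obtain ⟨p, rfl⟩ := hf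
  refine ⟨p, fun x => ?_⟩
  induction p using MvPolynomial.induction_on with
  | C a => simp
  | add p q hp hq => simpa using congrArg₂ (· + ·) hp hq
  | mul_X p i hp => 
    have := congrArg (· * (x : E3) i) hp
    simpa using this

/-- Polynomial vector fields are dense in `Lʳ`, for `r < ∞`: a closed subspace that contains those
with only one component is the whole space. -/
theorem mem_of_forall_polynomial_mem (r : ℝ≥0∞) [Fact (1 ≤ r)] (hr : r ≠ ⊤)
    {R : Submodule ℝ (Lp E3 r surf)} (hcl : IsClosed (R : Set (Lp E3 r surf)))
    (h : ∀ (j : Fin 3) (p : Poly) (V : C(S2, E3)),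
      (∀ x, V x = ev p x • EuclideanSpace.single j (1 : ℝ)) →
        ContinuousMap.toLp (E := E3) r surf ℝ V ∈ R) (u : Lp E3 r surf) : u ∈ R := by
  let ι : Fin 3 → C(S2, ℝ) →L[ℝ] Lp E3 r surf := fun j =>
    (ContinuousMap.toLp (E := E3) r surf ℝ).comp
      ((ContinuousLinearMap.toSpanSingleton ℝ (EuclideanSpace.single j (1 : ℝ) : E3)).compLeftContinuous
        ℝ S2)
  have h2 : ∀ j (f : C(S2, ℝ)), ι j f ∈ R := by
    intro j f
    have hcl' : IsClosed (ι j ⁻¹' R) := hcl.preimage (ι j).continuous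
    have hsub : (polyAlg : Set C(S2, ℝ)) ⊆ ι j ⁻¹' R := by
      intro f hf
      obtain ⟨p, hp⟩ := mem_polyAlg hf
      refine h j p _ fun x => ?_
      rw [← hp]
      rfl
    have : f ∈ (polyAlg.topologicalClosure : Set C(S2, ℝ)) := by rw [polyAlg_dense]; trivial
    rw [Subalgebra.topologicalClosure_coe] at this
    exact (hcl'.closure_subset_iff.2 hsub) this
  have h3 : ∀ V : C(S2, E3), ContinuousMap.toLp (E := E3) r surf ℝ V ∈ R := by
    intro V
    let c : Fin 3 → C(S2, ℝ) := fun j => ⟨fun x => V x j, by fun_prop⟩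
    have : ContinuousMap.toLp (E := E3) r surf ℝ V = ∑ j, ι j (c j) := by
      simp only [ι, ContinuousLinearMap.comp_apply, ← map_sum]
      congr 1
      ext x i
      simp [c, ContinuousLinearMap.compLeftContinuous]
      fin_cases i <;> simp [Fin.sum_univ_three]
    rw [this]
    exact R.sum_mem fun j _ => h2 j _
  exact (ContinuousMap.toLp_denseRange E3 surf ℝ (p := r) hr).induction_on
    (p := fun u => u ∈ (R : Set (Lp E3 r surf))) u hcl h3

/-- The fields `x × ∇p`, with `p` harmonic and homogeneous, are total in `H`. -/
theorem eq_zero_of_inner_angH {v : H} (hv : ∀ n p, IsHarm n p → ⟪v, angH p⟫_ℝ = 0) : v = 0 := by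
  have h1 : ∀ j (p : Poly), ∫ x : S2, (v : Lp E3 2 surf) x j * ev p x ∂surf = 0 := by
    intro j p
    rw [← MvPolynomial.sum_homogeneousComponent p]
    simp_rw [ev_sum, Finset.mul_sum]
    rw [integral_finsetSum _ fun i _ => integrable_coord_mul v j _]
    exact Finset.sum_eq_zero fun i _ => integral_coord_mul_eq_zero hv j i _
      (MvPolynomial.homogeneousComponent_isHomogeneous i p)
  let R : Submodule ℝ (Lp E3 2 surf) := (innerSL ℝ (v : Lp E3 2 surf)).ker
  have hcl : IsClosed (R : Set (Lp E3 2 surf)) :=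
    (innerSL ℝ (v : Lp E3 2 surf)).isClosed_ker
  have h4 : ∀ u : Lp E3 2 surf, u ∈ R := by
    refine mem_of_forall_polynomial_mem 2 (ENNReal.ofNat_ne_top (n := 2)) hcl fun j p V hV => ?_
    change ⟪(v : Lp E3 2 surf), ContinuousMap.toLp (E := E3) 2 surf ℝ V⟫_ℝ = 0
    rw [← h1 j p, L2.inner_def]
    refine integral_congr_ae ?_
    filter_upwards [ContinuousMap.coeFn_toLp (p := 2) surf (𝕜 := ℝ) V] with x hx
    rw [hx, hV, real_inner_smul_right, EuclideanSpace.inner_single_right]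
    simp [mul_comm]
  exact Subtype.ext (inner_self_eq_zero.1 (h4 v))

/-! ### The eigenspaces and their projections -/

/-- Harmonic polynomials homogeneous of degree `n`. -/
def harmSpace (n : ℕ) : Submodule ℝ Poly where
  carrier := {p | IsHarm n p}
  zero_mem' := ⟨MvPolynomial.isHomogeneous_zero _ _ _, by simp [lap]⟩
  add_mem' hp hq := ⟨hp.1.add hq.1, by rw [lap_add, hp.2, hq.2, add_zero]⟩
  smul_mem' c p hp := ⟨(MvPolynomial.homogeneousSubmodule (Fin 3) ℝ n).smul_mem c hp.1,
    by rw [lap_smul, hp.2, smul_zero]⟩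

instance finiteDimensional_homogeneous (n : ℕ) :
    FiniteDimensional ℝ (MvPolynomial.homogeneousSubmodule (Fin 3) ℝ n) :=
  Module.Finite.iff_fg.2 (MvPolynomial.homogeneousSubmodule_fg _ _ n)

instance finiteDimensional_harmSpace (n : ℕ) : FiniteDimensional ℝ (harmSpace n) :=
  Submodule.finiteDimensional_of_le (S₂ := MvPolynomial.homogeneousSubmodule (Fin 3) ℝ n)
    fun _ hp => hp.1

/-- The eigenspace of the Stokes operator for the eigenvalue `n (n + 1) - 2`. -/
def eigSp (n : ℕ) : Submodule ℝ H := (harmSpace n).map angH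

instance finiteDimensional_eigSp (n : ℕ) : FiniteDimensional ℝ (eigSp n) := by
  unfold eigSp; infer_instance

instance hasOrthogonalProjection_eigSp (n : ℕ) : (eigSp n).HasOrthogonalProjection :=
  haveI : CompleteSpace (eigSp n) := FiniteDimensional.complete ℝ _
  Submodule.HasOrthogonalProjection.ofCompleteSpace _

theorem angH_mem_eigSp {n : ℕ} {p : Poly} (hp : IsHarm n p) : angH p ∈ eigSp n := ⟨p, hp, rfl⟩

theorem exists_of_mem_eigSp {n : ℕ} {u : H} (hu : u ∈ eigSp n) : ∃ p, IsHarm n p ∧ angH p = u := hu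

theorem stokesEv_injective : Function.Injective stokesEv := by
  intro n m h
  have h' : ((n : ℝ) - m) * (n + m + 1) = 0 := by unfold stokesEv at h; linear_combination h
  have : (n : ℝ) + m + 1 ≠ 0 := by positivity
  have := (mul_eq_zero.1 h').resolve_right this
  exact_mod_cast sub_eq_zero.1 this

theorem inner_eigSp {n m : ℕ} (h : n ≠ m) {u v : H} (hu : u ∈ eigSp n) (hv : v ∈ eigSp m) :
    ⟪u, v⟫_ℝ = 0 := by
  obtain ⟨p, hp, rfl⟩ := hu
  obtain ⟨q, hq, rfl⟩ := hv
  have := (isStokes_angH hp).inner_angH hq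
  rw [inner_smul_H, ← sub_eq_zero, ← sub_mul] at this
  exact (mul_eq_zero.1 this).resolve_left (sub_ne_zero.2 fun h' => h (stokesEv_injective h'))

/-- The orthogonal projection of `H` onto the `n`-th eigenspace. -/
def eigProj (n : ℕ) : H →L[ℝ] H := (eigSp n).starProjection

theorem eigProj_mem (n : ℕ) (u : H) : eigProj n u ∈ eigSp n :=
  Submodule.starProjection_apply_mem _ u

theorem eigProj_of_mem {n : ℕ} {u : H} (hu : u ∈ eigSp n) : eigProj n u = u :=
  Submodule.starProjection_eq_self_iff.2 hu

theorem inner_eigProj_left (n : ℕ) (u v : H) : ⟪eigProj n u, v⟫_ℝ = ⟪u, eigProj n v⟫_ℝ :=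
  Submodule.inner_starProjection_left_eq_right _ u v

theorem inner_eigProj_of_mem {n : ℕ} (u : H) {z : H} (hz : z ∈ eigSp n) :
    ⟪eigProj n u, z⟫_ℝ = ⟪u, z⟫_ℝ := by
  rw [inner_eigProj_left, eigProj_of_mem hz]

theorem eigProj_of_mem_of_ne {n m : ℕ} (h : n ≠ m) {u : H} (hu : u ∈ eigSp m) :
    eigProj n u = 0 := by
  have : ⟪eigProj n u, eigProj n u⟫_ℝ = 0 := by
    rw [inner_eigProj_of_mem _ (eigProj_mem n u)]
    exact inner_eigSp h.symm hu (eigProj_mem n u)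
  exact inner_self_eq_zero.1 this

theorem eq_of_eigProj_eq {u v : H} (h : ∀ n, eigProj n u = eigProj n v) : u = v := by
  rw [← sub_eq_zero]
  refine eq_zero_of_inner_angH fun n p hp => ?_
  rw [← inner_eigProj_of_mem _ (angH_mem_eigSp hp), map_sub, h n, sub_self, inner_zero_left]

/-- The Stokes operator is single valued. -/
theorem IsStokes.unique {u f g : H} (hf : IsStokes u f) (hg : IsStokes u g) : f = g := by
  rw [← sub_eq_zero]
  refine eq_zero_of_inner_angH fun n p hp => ?_
  rw [inner_sub_left, hf.inner_angH hp, hg.inner_angH hp, sub_self]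

theorem IsCoriolis.unique {Om : ℝ} {u f g : H} (hf : IsCoriolis Om u f) (hg : IsCoriolis Om u g) :
    f = g := by
  refine ext_inner_right ℝ fun v => ?_
  rw [inner_H, inner_H, hf v, hg v]

theorem toH_injective : Function.Injective toH := by
  intro x y h
  have h2 : (x : WithLp 1 (H × Lp E3 4 surf)).snd = (y : WithLp 1 (H × Lp E3 4 surf)).snd := by
    have hx : (((x : WithLp 1 (H × Lp E3 4 surf)).fst : Lp E3 2 surf) : S2 → E3) =ᵐ[surf]
      ((x : WithLp 1 (H × Lp E3 4 surf)).snd : S2 → E3) := x.2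
    have hy : (((y : WithLp 1 (H × Lp E3 4 surf)).fst : Lp E3 2 surf) : S2 → E3) =ᵐ[surf]
      ((y : WithLp 1 (H × Lp E3 4 surf)).snd : S2 → E3) := y.2
    refine Lp.ext (hx.symm.trans (EventuallyEq.trans ?_ hy))
    have h : (x : WithLp 1 (H × Lp E3 4 surf)).fst = (y : WithLp 1 (H × Lp E3 4 surf)).fst := h
    rw [h]
  refine Subtype.ext (WithLp.ofLp_injective 1 (Prod.ext h h2))

theorem IsAhat.unique {nu Om : ℝ} {u f g : X} (hf : IsAhat nu Om u f) (hg : IsAhat nu Om u g) :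
    f = g := by
  obtain ⟨a, c, ha, hc, h⟩ := hf
  obtain ⟨a', c', ha', hc', h'⟩ := hg
  exact toH_injective (by rw [h, h', ha.unique ha', hc.unique hc'])

theorem IsAhat.ahat_eq {nu Om : ℝ} {u f : X} (hf : IsAhat nu Om u f) : Ahat nu Om u = f := by
  have h : InDomainAhat nu Om u := ⟨f, hf⟩
  rw [Ahat, dif_pos h]
  exact h.choose_spec.unique hf

/-! ### The supremum of a homogeneous polynomial on the sphere -/

/-- The composition of a polynomial with a linear isometry. -/
def polyComp (g : E3 ≃ₗᵢ[ℝ] E3) (p : Poly) : Poly :=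
  MvPolynomial.aeval (fun i => ∑ j, MvPolynomial.C (g (EuclideanSpace.single j 1) i)
    * (MvPolynomial.X j : Poly)) p

theorem ev_polyComp (g : E3 ≃ₗᵢ[ℝ] E3) (p : Poly) (x : E3) :
    ev (polyComp g p) x = ev p (g x) := by
  have hx : x = ∑ j, x j • EuclideanSpace.single j (1 : ℝ) := by
    ext i; fin_cases i <;> simp [Fin.sum_univ_three]
  induction p using MvPolynomial.induction_on with
  | C a => simp [polyComp]
  | add p q hp hq => simp only [polyComp, map_add, ev_add] at *; rw [hp, hq]
  | mul_X p i hp =>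
    simp only [polyComp, map_mul, ev_mul, MvPolynomial.aeval_X, ev_sum, ev_C, ev_X] at *
    rw [hp]
    congr 1
    conv_rhs => rw [hx]
    simp [map_sum, mul_comm]

theorem isHomogeneous_polyComp (g : E3 ≃ₗᵢ[ℝ] E3) {n : ℕ} {p : Poly} (hp : p.IsHomogeneous n) :
    (polyComp g p).IsHomogeneous n := by
  have := hp.aeval (S := ℝ) (n := 1) (fun i => ∑ j, MvPolynomial.C (g (EuclideanSpace.single j 1) i)
    * (MvPolynomial.X j : Poly)) fun i =>
      MvPolynomial.IsHomogeneous.sum _ _ _ fun j _ => MvPolynomial.isHomogeneous_C_mul_X _ _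
  rwa [one_mul] at this

/-- A polynomial as an element of `L²` of the sphere. -/
def polyL2 : Poly →ₗ[ℝ] Lp ℝ 2 surf where
  toFun p := ContinuousMap.toLp (E := ℝ) 2 surf ℝ
    ⟨fun x : S2 => ev p x, (continuous_ev p).comp continuous_subtype_val⟩
  map_add' p q := by
    rw [← map_add]; congr 1; ext x; simp
  map_smul' c p := by
    rw [RingHom.id_apply, ← map_smul]; congr 1; ext x; simp

theorem polyL2_ae (p : Poly) : (polyL2 p : S2 → ℝ) =ᵐ[surf] fun x => ev p x :=
  ContinuousMap.coeFn_toLp surf (𝕜 := ℝ) _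

theorem ev_eq_of_polyL2_eq {p q : Poly} (h : polyL2 p = polyL2 q) (x : S2) : ev p x = ev q x := by
  have := ContinuousMap.toLp_injective (E := ℝ) (p := 2) (𝕜 := ℝ) surf h
  exact DFunLike.congr_fun this x

theorem norm_polyL2_sq (p : Poly) : ‖polyL2 p‖ ^ 2 = ∫ x : S2, ev p x ^ 2 ∂surf := by
  rw [← real_inner_self_eq_norm_sq, L2.inner_def]
  refine integral_congr_ae ?_
  filter_upwards [polyL2_ae p] with x hx
  rw [hx, real_inner_self_eq_norm_sq, Real.norm_eq_abs, sq_abs]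

theorem finrank_homogeneous_le (n : ℕ) :
    Module.finrank ℝ (MvPolynomial.homogeneousSubmodule (Fin 3) ℝ n) ≤ (n + 1) ^ 2 := by
  classical
  let d : ℕ × ℕ → (Fin 3 →₀ ℕ) := fun a => Finsupp.equivFunOnFinite.symm ![a.1, a.2, n - a.1 - a.2]
  let s : Finset Poly := (Finset.range (n + 1) ×ˢ Finset.range (n + 1)).image
    fun a => MvPolynomial.monomial (d a) 1
  have hs : s.card ≤ (n + 1) ^ 2 := Finset.card_image_le.trans (by simp [sq])
  have hle : MvPolynomial.homogeneousSubmodule (Fin 3) ℝ n ≤ Submodule.span ℝ (s : Set Poly) := by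
    intro p hp
    rw [MvPolynomial.as_sum p]
    refine Submodule.sum_mem _ fun m hm => ?_
    have hdeg : m.degree = n := by
      by_contra h
      exact MvPolynomial.mem_support_iff.1 hm (MvPolynomial.IsHomogeneous.coeff_eq_zero hp h)
    rw [Finsupp.degree_eq_sum, Fin.sum_univ_three] at hdeg
    have hm' : m = d (m 0, m 1) := by
      ext i
      fin_cases i <;> simp [d]
      omega
    have : MvPolynomial.monomial m (MvPolynomial.coeff m p)
        = MvPolynomial.coeff m p • (MvPolynomial.monomial m (1 : ℝ) : Poly) := by
      rw [MvPolynomial.smul_monomial]; simp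
    rw [this]
    refine Submodule.smul_mem _ _ (Submodule.subset_span ?_)
    rw [hm']
    refine Finset.mem_coe.2 (Finset.mem_image.2 ⟨(m 0, m 1), ?_, rfl⟩)
    simp only [Finset.mem_product, Finset.mem_range]
    omega
  exact ((Submodule.finrank_mono hle).trans (finrank_span_finset_le_card s)).trans hs

theorem exists_isometry_sphere (x y : S2) : ∃ g : E3 ≃ₗᵢ[ℝ] E3, g x = y :=
  ⟨(ℝ ∙ ((x : E3) - y))ᗮ.reflection, Submodule.reflection_sub (by simp)⟩

/-- Pointwise bound of a homogeneous polynomial by its `L²` norm on the sphere. The reproducing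
kernel of the space of homogeneous polynomials is constant on the diagonal because the space is
invariant under isometries, and its integral is the dimension of the space. -/
theorem ev_sq_le {n : ℕ} {p : Poly} (hp : p.IsHomogeneous n) (x : S2) :
    ev p x ^ 2 * surf.real univ ≤ ((n : ℝ) + 1) ^ 2 * ∫ y : S2, ev p y ^ 2 ∂surf := by
  let W : Submodule ℝ (Lp ℝ 2 surf) := (MvPolynomial.homogeneousSubmodule (Fin 3) ℝ n).map polyL2
  have : FiniteDimensional ℝ W := by unfold W; infer_instance
  let b := stdOrthonormalBasis ℝ W
  have hb : ∀ j, ∃ q : Poly, q.IsHomogeneous n ∧ polyL2 q = (b j : Lp ℝ 2 surf) := fun j => (b j).2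
  choose q hq hqb using hb
  let K : S2 → ℝ := fun y => ∑ j, ev (q j) y ^ 2
  have hon : ∀ j, ‖polyL2 (q j)‖ ^ 2 = 1 := fun j => by
    rw [hqb, ← Submodule.coe_norm, b.orthonormal.1 j, one_pow]
  -- norms of linear combinations of the basis
  have hcomb : ∀ c : Fin (Module.finrank ℝ W) → ℝ, ‖polyL2 (∑ j, c j • q j)‖ ^ 2 = ∑ j, c j ^ 2 := by
    intro c
    have : polyL2 (∑ j, c j • q j) = ((∑ j, c j • b j : W) : Lp ℝ 2 surf) := by
      simp [map_sum, hqb]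
    rw [this, ← Submodule.coe_norm, ← real_inner_self_eq_norm_sq, b.orthonormal.inner_sum]
    simp [sq]
  have hrep : ∀ r : Poly, r.IsHomogeneous n → ∀ y : S2, ev r y ^ 2 ≤ K y * ‖polyL2 r‖ ^ 2 := by
    intro r hr y
    obtain ⟨c, hc⟩ : ∃ c : Fin (Module.finrank ℝ W) → ℝ, polyL2 r = polyL2 (∑ j, c j • q j) := by
      let w : W := ⟨polyL2 r, ⟨r, hr, rfl⟩⟩
      have h := congrArg (fun v : W => (v : Lp ℝ 2 surf)) (b.sum_repr w)
      refine ⟨fun j => b.repr w j, h.symm.trans ?_⟩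
      simp only [map_sum, map_smul, hqb]
      simp
    rw [hc, hcomb, ev_eq_of_polyL2_eq hc y, ev_sum, mul_comm]
    simp only [ev_smul]
    exact Finset.sum_mul_sq_le_sq_mul_sq _ _ _
  have hKnn : ∀ y, 0 ≤ K y := fun y => Finset.sum_nonneg fun j _ => sq_nonneg _
  have hK : ∀ y z : S2, K z ≤ K y := by
    intro y z
    obtain ⟨g, hg⟩ := exists_isometry_sphere y z
    let r : Poly := ∑ j, ev (q j) z • q j
    have hr : r.IsHomogeneous n := MvPolynomial.IsHomogeneous.sum _ _ _ fun j _ =>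
      (MvPolynomial.homogeneousSubmodule (Fin 3) ℝ n).smul_mem _ (hq j)
    have h1 := hrep _ (isHomogeneous_polyComp g hr) y
    have h2 : ‖polyL2 (polyComp g r)‖ ^ 2 = K z := by
      rw [norm_polyL2_sq]
      simp_rw [ev_polyComp]
      rw [integral_sphereMap g (f := fun x => ev r x ^ 2) ((continuous_ev r).pow 2),
        ← norm_polyL2_sq, hcomb]
    have h3 : ev r z = K z := by
      simp only [r, ev_sum, ev_smul, K, sq]
    rw [h2, ev_polyComp, hg, h3] at h1
    rcases (hKnn z).eq_or_lt with h | h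
    · rw [← h]; exact hKnn y
    · nlinarith
  have hint : ∫ y, K y ∂surf = Module.finrank ℝ W := by
    simp only [K]
    rw [integral_finsetSum]
    · simp_rw [← norm_polyL2_sq, hon]; simp
    · exact fun j _ => integrable_of_continuous
        (((continuous_ev _).pow 2).comp continuous_subtype_val)
  have hKx : K x * surf.real univ ≤ ((n : ℝ) + 1) ^ 2 := by
    have h1 : ∫ y, K y ∂surf = K x * surf.real univ := by
      have : K = fun _ => K x := funext fun y => le_antisymm (hK x y) (hK y x)
      rw [this, integral_const, smul_eq_mul, mul_comm]
    rw [← h1, hint]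
    have := (Submodule.finrank_map_le polyL2
      (MvPolynomial.homogeneousSubmodule (Fin 3) ℝ n)).trans (finrank_homogeneous_le n)
    exact_mod_cast this
  have h := hrep p hp x
  rw [← norm_polyL2_sq]
  have hs : 0 ≤ surf.real (univ : Set S2) := measureReal_nonneg
  calc ev p x ^ 2 * surf.real univ ≤ (K x * ‖polyL2 p‖ ^ 2) * surf.real univ := by gcongr
    _ = (K x * surf.real univ) * ‖polyL2 p‖ ^ 2 := by ring
    _ ≤ _ := by gcongr

theorem surf_univ_pos : 0 < surf.real (univ : Set S2) := by
  rw [measureReal_def, ENNReal.toReal_pos_iff]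
  refine ⟨?_, measure_lt_top _ _⟩
  exact (isOpen_univ.measure_pos surf ⟨⟨EuclideanSpace.single 0 1, by simp⟩, trivial⟩)

/-- The constant in the pointwise bound of the eigenfields. -/
def supConst : ℝ := (Real.sqrt (surf.real (univ : Set S2)))⁻¹

theorem supConst_pos : 0 < supConst := inv_pos.2 (Real.sqrt_pos.2 surf_univ_pos)

/-- Pointwise bound of the eigenfields of the Stokes operator. -/
theorem norm_angVec_le {n : ℕ} {p : Poly} (hp : p.IsHomogeneous n) (x : S2) :
    ‖angVec p x‖ ≤ supConst * (n + 1) * ‖angH p‖ := by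
  have h1 : ‖angVec p x‖ ^ 2 = ∑ i, ev (ang i p) x ^ 2 := by
    rw [EuclideanSpace.norm_sq_eq]; simp
  have h2 : ‖angH p‖ ^ 2 = ∑ i, ∫ y : S2, ev (ang i p) y ^ 2 ∂surf := by
    rw [← real_inner_self_eq_norm_sq, inner_angH_angH]; simp [sq]
  have h3 : ‖angVec p x‖ ^ 2 * surf.real univ ≤ ((n : ℝ) + 1) ^ 2 * ‖angH p‖ ^ 2 := by
    rw [h1, h2, Finset.sum_mul, Finset.mul_sum]
    exact Finset.sum_le_sum fun i _ => ev_sq_le (isHomogeneous_ang hp i) x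
  have hs := supConst_pos
  have hs2 : supConst ^ 2 * surf.real (univ : Set S2) = 1 := by
    rw [supConst, inv_pow, Real.sq_sqrt surf_univ_pos.le, inv_mul_cancel₀ surf_univ_pos.ne']
  refine (sq_le_sq₀ (norm_nonneg _) (by positivity)).1 ?_
  calc ‖angVec p x‖ ^ 2 = supConst ^ 2 * (‖angVec p x‖ ^ 2 * surf.real univ) := by
        linear_combination (-‖angVec p x‖ ^ 2) * hs2
    _ ≤ supConst ^ 2 * (((n : ℝ) + 1) ^ 2 * ‖angH p‖ ^ 2) := by gcongr
    _ = _ := by ring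

theorem norm_toLp_four_pow (V : C(S2, E3)) :
    ‖ContinuousMap.toLp (E := E3) 4 surf ℝ V‖ ^ 4 = ∫ x : S2, ‖V x‖ ^ 4 ∂surf := by
  have hae : (ContinuousMap.toLp (E := E3) 4 surf ℝ V : S2 → E3) =ᵐ[surf] V :=
    ContinuousMap.coeFn_toLp surf (𝕜 := ℝ) V
  have hm : MemLp V 4 surf := (Lp.memLp (ContinuousMap.toLp (E := E3) 4 surf ℝ V)).ae_eq hae
  have h0 : 0 ≤ ∫ x : S2, ‖V x‖ ^ (4 : ℝ) ∂surf := integral_nonneg fun x => by positivity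
  have : ‖ContinuousMap.toLp (E := E3) 4 surf ℝ V‖
      = (∫ x : S2, ‖V x‖ ^ (4 : ℝ) ∂surf) ^ ((4 : ℝ)⁻¹) := by
    rw [Lp.norm_def, eLpNorm_congr_ae hae,
      hm.eLpNorm_eq_integral_rpow_norm (by norm_num) (by norm_num)]
    rw [ENNReal.toReal_ofReal (by positivity)]
    simp
  rw [this, ← Real.rpow_natCast, ← Real.rpow_mul h0]
  norm_num

/-- Interpolation of the `L⁴` norm between the supremum and the `L²` norm. -/
theorem norm_angX_snd_le {p : Poly} {s : ℝ} (hs : ∀ x : S2, ‖angVec p x‖ ≤ s) :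
    ‖((angX p : X) : WithLp 1 (H × Lp E3 4 surf)).snd‖ ≤ Real.sqrt (s * ‖angH p‖) := by
  have hs0 : 0 ≤ s := (norm_nonneg _).trans (hs ⟨EuclideanSpace.single 0 1, by simp⟩)
  have h4 : ‖((angX p : X) : WithLp 1 (H × Lp E3 4 surf)).snd‖ ^ 4
      = ∫ x : S2, ‖angVec p x‖ ^ 4 ∂surf :=
    norm_toLp_four_pow (angC p)
  have h2 : ‖angH p‖ ^ 2 = ∫ x : S2, ‖angVec p x‖ ^ 2 ∂surf := by
    rw [← real_inner_self_eq_norm_sq, inner_angH]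
    refine integral_congr_ae ?_
    filter_upwards [angH_ae p] with x hx
    rw [hx, real_inner_self_eq_norm_sq]
  have hc : Continuous fun x : S2 => angVec p x :=
    (contDiff_angVec p).continuous.comp continuous_subtype_val
  have h : ∫ x : S2, ‖angVec p x‖ ^ 4 ∂surf ≤ s ^ 2 * ∫ x : S2, ‖angVec p x‖ ^ 2 ∂surf := by
    rw [← integral_const_mul]
    refine integral_mono (integrable_of_continuous (hc.norm.pow 4))
      (integrable_of_continuous ((hc.norm.pow 2).const_mul _)) fun x => ?_
    have := pow_le_pow_left₀ (norm_nonneg _) (hs x) 2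
    have h' := mul_le_mul_of_nonneg_right this (sq_nonneg ‖angVec p x‖)
    calc ‖angVec p x‖ ^ 4 = ‖angVec p x‖ ^ 2 * ‖angVec p x‖ ^ 2 := by ring
      _ ≤ _ := h'
  rw [← h4, ← h2] at h
  refine Real.le_sqrt_of_sq_le ?_
  refine (sq_le_sq₀ (sq_nonneg _) (by positivity)).1 ?_
  calc _ = _ := by ring
    _ ≤ _ := h
    _ = _ := by ring

/-! ### Completeness of `H` and `X` -/

theorem exists_subseq_ae {r : ℝ≥0∞} [Fact (1 ≤ r)] {f : ℕ → Lp E3 r surf} {g : Lp E3 r surf}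
    (h : Tendsto f atTop (𝓝 g)) : ∃ ns : ℕ → ℕ, StrictMono ns ∧
      ∀ᵐ x ∂surf, Tendsto (fun i => f (ns i) x) atTop (𝓝 (g x)) :=
  (tendstoInMeasure_of_tendsto_Lp h).exists_seq_tendsto_ae

theorem isClosed_H : IsClosed (H : Set (Lp E3 2 surf)) := by
  refine IsSeqClosed.isClosed fun u v hu huv => ⟨?_, fun φ hφ => ?_⟩
  · obtain ⟨ns, -, hns⟩ := exists_subseq_ae huv
    have h0 : ∀ᵐ x ∂surf, ∀ i, ⟪u (ns i) x, (x : E3)⟫_ℝ = 0 := ae_all_iff.2 fun i => (hu (ns i)).1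
    filter_upwards [hns, h0] with x hx hx0
    have := hx.inner (𝕜 := ℝ) (tendsto_const_nhds (x := (x : E3)))
    simp only [hx0] at this
    exact tendsto_nhds_unique this tendsto_const_nhds
  · have hc : Continuous (fun x : S2 => gradient φ (x : E3)) := by
      unfold gradient
      exact ((InnerProductSpace.toDual ℝ E3).symm.continuous.comp
        (hφ.continuous_fderiv (by simp))).comp continuous_subtype_val
    have hpair : ∀ w : Lp E3 2 surf, ∫ x, ⟪w x, gradient φ (x : E3)⟫_ℝ ∂surf
        = ⟪w, ContinuousMap.toLp (E := E3) 2 surf ℝ ⟨_, hc⟩⟫_ℝ := fun w => by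
      rw [L2.inner_def]
      refine integral_congr_ae ?_
      filter_upwards [ContinuousMap.coeFn_toLp (p := 2) surf (𝕜 := ℝ) (⟨_, hc⟩ : C(S2, E3))] with x hx
      rw [hx]; rfl
    have h1 : Tendsto (fun k => ∫ x, ⟪u k x, gradient φ (x : E3)⟫_ℝ ∂surf) atTop
        (𝓝 (∫ x, ⟪v x, gradient φ (x : E3)⟫_ℝ ∂surf)) := by
      simp_rw [hpair]
      exact huv.inner tendsto_const_nhds
    have h2 : ∀ k, ∫ x, ⟪u k x, gradient φ (x : E3)⟫_ℝ ∂surf = 0 := fun k => (hu k).2 φ hφ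
    simp_rw [h2] at h1
    exact tendsto_nhds_unique h1 tendsto_const_nhds

instance completeSpace_H : CompleteSpace H := isClosed_H.completeSpace_coe

theorem isClosed_X : IsClosed (X : Set (WithLp 1 (H × Lp E3 4 surf))) := by
  refine IsSeqClosed.isClosed fun u v hu huv => ?_
  have hf : Tendsto (fun k => ((u k).fst : Lp E3 2 surf)) atTop (𝓝 (v.fst : Lp E3 2 surf)) :=
    (continuous_subtype_val.tendsto _).comp
      (((WithLp.prod_continuous_ofLp 1 H (Lp E3 4 surf)).fst.tendsto v).comp huv)
  have hs : Tendsto (fun k => (u k).snd) atTop (𝓝 v.snd) :=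
    ((WithLp.prod_continuous_ofLp 1 H (Lp E3 4 surf)).snd.tendsto v).comp huv
  obtain ⟨ns, hmono, hns⟩ := exists_subseq_ae hf
  obtain ⟨ms, hmono', hms⟩ := exists_subseq_ae (hs.comp hmono.tendsto_atTop)
  have h0 : ∀ᵐ x ∂surf, ∀ k, ((u k).fst : Lp E3 2 surf) x = (u k).snd x := ae_all_iff.2 fun k => hu k
  change ((v.fst : Lp E3 2 surf) : S2 → E3) =ᵐ[surf] (v.snd : S2 → E3)
  filter_upwards [hns, hms, h0] with x h1 h2 h3
  refine tendsto_nhds_unique (h1.comp hmono'.tendsto_atTop) ?_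
  refine h2.congr fun i => ?_
  simp [h3]

instance completeSpace_X : CompleteSpace X := isClosed_X.completeSpace_coe

theorem norm_toH_le (x : X) : ‖toH x‖ ≤ ‖x‖ := by
  have h := norm_eq x
  have h2 := norm_nonneg (x : WithLp 1 (H × Lp E3 4 surf)).snd
  change ‖(x : WithLp 1 (H × Lp E3 4 surf)).fst‖ ≤ _
  linarith

/-- The inclusion `X ⊂ H` as a linear map. -/
def toHLin : X →ₗ[ℝ] H where
  toFun := toH
  map_add' _ _ := rfl
  map_smul' _ _ := rfl

/-- The inclusion `X ⊂ H` as a continuous linear map. -/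
def toHL : X →L[ℝ] H := toHLin.mkContinuous 1 fun x => by
  rw [one_mul]; exact norm_toH_le x

/-! ### Strongly continuous semigroups -/

section Semigroup

variable {E : Type*} [NormedAddCommGroup E] [NormedSpace ℝ E] {S : ℝ → E →L[ℝ] E}

theorem IsC0Semigroup.tendsto_zero (hS : IsC0Semigroup S) (x : E) :
    Tendsto (fun t => S t x) (𝓝[≥] 0) (𝓝 x) := by
  rw [← Ioi_insert, nhdsWithin_insert]
  refine Tendsto.sup ?_ (hS.cont x)
  rw [tendsto_pure_left]
  intro s hs
  rw [hS.zero]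
  exact mem_of_mem_nhds hs

theorem IsC0Semigroup.exists_bound_near_zero [CompleteSpace E] (hS : IsC0Semigroup S) :
    ∃ δ > 0, ∃ M : ℝ, ∀ t ∈ Icc 0 δ, ‖S t‖ ≤ M := by
  by_contra! h
  have h' : ∀ n : ℕ, ∃ t ∈ Icc (0 : ℝ) (1 / ((n : ℝ) + 1)), (n : ℝ) < ‖S t‖ := fun n =>
    h _ (by positivity) n
  choose t ht htn using h'
  have ht0 : Tendsto t atTop (𝓝[≥] 0) := tendsto_nhdsWithin_iff.2
    ⟨squeeze_zero (fun n => (ht n).1) (fun n => (ht n).2) tendsto_one_div_add_atTop_nhds_zero_nat,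
      Eventually.of_forall fun n => (ht n).1⟩
  obtain ⟨C, hC⟩ := banach_steinhaus (g := fun n => S (t n)) fun x => by
    obtain ⟨C, hC⟩ := (Metric.isBounded_range_of_tendsto _ ((hS.tendsto_zero x).comp ht0)).exists_norm_le
    exact ⟨C, fun n => hC _ ⟨n, rfl⟩⟩
  obtain ⟨n, hn⟩ := exists_nat_gt C
  exact absurd ((hn.trans (htn n)).trans_le (hC n)) (lt_irrefl _)

theorem IsC0Semigroup.exists_bound [CompleteSpace E] (hS : IsC0Semigroup S) (T : ℝ) :
    ∃ M : ℝ, 0 ≤ M ∧ ∀ t ∈ Icc 0 T, ‖S t‖ ≤ M := by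
  obtain ⟨δ, hδ, M, hM⟩ := hS.exists_bound_near_zero
  have hM0 : 0 ≤ M := (norm_nonneg _).trans (hM 0 ⟨le_rfl, hδ.le⟩)
  have key : ∀ n : ℕ, ∃ M' : ℝ, 0 ≤ M' ∧ ∀ t ∈ Icc 0 (n * δ), ‖S t‖ ≤ M' := by
    intro n
    induction n with
    | zero => exact ⟨M, hM0, fun t ht => hM t ⟨ht.1, ht.2.trans (by simpa using hδ.le)⟩⟩
    | succ n ih =>
      obtain ⟨M', h0, hM'⟩ := ih
      refine ⟨max M (M * M'), le_max_of_le_left hM0, fun t ht => ?_⟩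
      rcases le_total t δ with h | h
      · exact (hM t ⟨ht.1, h⟩).trans (le_max_left _ _)
      · have h1 : t - δ ∈ Icc 0 (n * δ) := ⟨by linarith, by have := ht.2; push_cast at this; linarith⟩
        have h2 : S t = (S δ).comp (S (t - δ)) := by
          rw [← hS.add _ _ hδ.le h1.1]; congr 1; ring
        rw [h2]
        refine ((ContinuousLinearMap.opNorm_comp_le _ _).trans ?_).trans (le_max_right _ _)
        exact mul_le_mul (hM δ ⟨hδ.le, le_rfl⟩) (hM' _ h1) (norm_nonneg _) hM0
  obtain ⟨n, hn⟩ := exists_nat_ge (T / δ)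
  obtain ⟨M', h0, hM'⟩ := key n
  exact ⟨M', h0, fun t ht => hM' t ⟨ht.1, ht.2.trans ((div_le_iff₀ hδ).1 hn)⟩⟩

/-- The map `(t, x) ↦ S t x`, extended by `x` to negative times, is continuous. -/
theorem IsC0Semigroup.continuous_uncurry [CompleteSpace E] (hS : IsC0Semigroup S) :
    Continuous (fun z : ℝ × E => S (max z.1 0) z.2) := by
  rw [continuous_iff_continuousAt]
  rintro ⟨t₀, x₀⟩
  obtain ⟨M, hM0, hM⟩ := hS.exists_bound (max t₀ 0 + 1)
  set a := max t₀ 0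
  have ha : 0 ≤ a := le_max_right _ _
  -- `S b x₀ - S a x₀ = ± S (min a b) (S |b - a| x₀ - x₀)`
  have key : ∀ b ∈ Icc 0 (a + 1), ‖S b x₀ - S a x₀‖ ≤ M * ‖S |b - a| x₀ - x₀‖ := by
    intro b hb
    rcases le_total b a with h | h
    · have : S a x₀ = S b (S |b - a| x₀) := by
        rw [← ContinuousLinearMap.comp_apply, ← hS.add _ _ hb.1 (abs_nonneg _),
          abs_of_nonpos (by linarith)]
        congr 2; ring
      rw [this, ← map_sub, ← norm_neg, ← map_neg, neg_sub]
      exact (S b).le_of_opNorm_le (hM b hb) _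
    · have : S b x₀ = S a (S |b - a| x₀) := by
        rw [← ContinuousLinearMap.comp_apply, ← hS.add _ _ ha (abs_nonneg _),
          abs_of_nonneg (by linarith)]
        congr 2; ring
      rw [this, ← map_sub]
      exact (S a).le_of_opNorm_le (hM a ⟨ha, by linarith⟩) _
  have hb : Tendsto (fun z : ℝ × E => max z.1 0) (𝓝 (t₀, x₀)) (𝓝 a) :=
    (by fun_prop : Continuous (fun z : ℝ × E => max z.1 0)).tendsto (t₀, x₀)
  have habs : Tendsto (fun z : ℝ × E => |max z.1 0 - a|) (𝓝 (t₀, x₀)) (𝓝[≥] 0) := by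
    refine tendsto_nhdsWithin_iff.2 ⟨?_, Eventually.of_forall fun z => mem_Ici.2 (abs_nonneg _)⟩
    simpa using (hb.sub_const a).abs
  have h1 : Tendsto (fun z : ℝ × E => M * ‖z.2 - x₀‖ + M * ‖S |max z.1 0 - a| x₀ - x₀‖)
      (𝓝 (t₀, x₀)) (𝓝 0) := by
    have e1 : Tendsto (fun z : ℝ × E => M * ‖z.2 - x₀‖) (𝓝 (t₀, x₀)) (𝓝 0) := by
      have : Continuous (fun z : ℝ × E => M * ‖z.2 - x₀‖) := by fun_prop
      simpa using this.tendsto (t₀, x₀)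
    have e2 := (((hS.tendsto_zero x₀).comp habs).sub_const x₀).norm.const_mul M
    simpa using e1.add e2
  rw [ContinuousAt, tendsto_iff_norm_sub_tendsto_zero]
  refine squeeze_zero' (Eventually.of_forall fun z => norm_nonneg _) ?_ h1
  have hev : ∀ᶠ z : ℝ × E in 𝓝 (t₀, x₀), max z.1 0 < a + 1 :=
    hb.eventually (gt_mem_nhds (by linarith))
  filter_upwards [hev] with z hz
  have hz' : max z.1 0 ∈ Icc 0 (a + 1) := ⟨le_max_right _ _, hz.le⟩
  calc ‖S (max z.1 0) z.2 - S a x₀‖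
      = ‖S (max z.1 0) (z.2 - x₀) + (S (max z.1 0) x₀ - S a x₀)‖ := by rw [map_sub]; congr 1; abel
    _ ≤ ‖S (max z.1 0) (z.2 - x₀)‖ + ‖S (max z.1 0) x₀ - S a x₀‖ := norm_add_le _ _
    _ ≤ _ := add_le_add ((S _).le_of_opNorm_le (hM _ hz') _) (key _ hz')

/-- On the domain of the generator the orbits are differentiable from the right. -/
theorem IsC0Semigroup.hasDerivWithinAt (hS : IsC0Semigroup S) {u f : E}
    (hu : Tendsto (fun h : ℝ => h⁻¹ • (S h u - u)) (𝓝[>] 0) (𝓝 f)) {t : ℝ} (ht : 0 ≤ t) :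
    HasDerivWithinAt (fun s => S s u) (S t f) (Ici t) t := by
  rw [hasDerivWithinAt_iff_tendsto_slope, Ici_sdiff_left]
  have h1 : Tendsto (fun s => (s - t)⁻¹ • (S (s - t) u - u)) (𝓝[>] t) (𝓝 f) := by
    refine hu.comp (tendsto_nhdsWithin_iff.2 ⟨?_, ?_⟩)
    · have h : Tendsto (fun s : ℝ => s - t) (𝓝 t) (𝓝 0) := by
        simpa using (by fun_prop : Continuous (fun s : ℝ => s - t)).tendsto t
      exact h.mono_left nhdsWithin_le_nhds
    · filter_upwards [self_mem_nhdsWithin] with s hs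
      simpa using hs
  refine ((S t).continuous.tendsto f |>.comp h1).congr' ?_
  filter_upwards [self_mem_nhdsWithin] with s hs
  have hs' : 0 ≤ s - t := sub_nonneg.2 (le_of_lt hs)
  have : S s u = S t (S (s - t) u) := by
    rw [← ContinuousLinearMap.comp_apply, ← hS.add _ _ ht hs']; congr 2; ring
  simp [slope_def_module, this]

/-- The domain of the generator is invariant under the semigroup. -/
theorem IsC0Semigroup.tendsto_generator (hS : IsC0Semigroup S) {u f : E}
    (hu : Tendsto (fun h : ℝ => h⁻¹ • (S h u - u)) (𝓝[>] 0) (𝓝 f)) {t : ℝ} (ht : 0 ≤ t) :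
    Tendsto (fun h : ℝ => h⁻¹ • (S h (S t u) - S t u)) (𝓝[>] 0) (𝓝 (S t f)) := by
  refine ((S t).continuous.tendsto f |>.comp hu).congr' ?_
  filter_upwards [self_mem_nhdsWithin] with s hs
  have : S s (S t u) = S t (S s u) := by
    rw [← ContinuousLinearMap.comp_apply, ← ContinuousLinearMap.comp_apply,
      ← hS.add _ _ ht (le_of_lt hs), ← hS.add _ _ (le_of_lt hs) ht, add_comm]
  simp [this]

/-- The generator of a strongly continuous semigroup is densely defined: the averages
`h⁻¹ ∫₀ʰ S s x ds` belong to its domain. -/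
theorem IsC0Semigroup.dense_domain [CompleteSpace E] (hS : IsC0Semigroup S) :
    Dense {u : E | ∃ f, Tendsto (fun h : ℝ => h⁻¹ • (S h u - u)) (𝓝[>] 0) (𝓝 f)} := by
  intro x
  have hc : Continuous (fun s : ℝ => S (max s 0) x) :=
    hS.continuous_uncurry.comp (by fun_prop : Continuous (fun s : ℝ => (s, x)))
  set F : ℝ → E := fun h => ∫ s in (0 : ℝ)..h, S (max s 0) x with hF
  have hFd : ∀ h, HasDerivAt F (S (max h 0) x) h := fun h =>
    intervalIntegral.integral_hasDerivAt_right (hc.intervalIntegrable _ _)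
      (hc.stronglyMeasurableAtFilter _ _) hc.continuousAt
  have hF0 : F 0 = 0 := by simp [F]
  have hslope : ∀ a, 0 ≤ a → Tendsto (fun k : ℝ => k⁻¹ • (F (a + k) - F a)) (𝓝[>] 0) (𝓝 (S a x)) := by
    intro a ha
    have := (hFd a).tendsto_slope_zero
    rw [max_eq_left ha] at this
    exact this.mono_left (nhdsWithin_mono _ fun y hy => ne_of_gt hy)
  refine mem_closure_of_tendsto (f := fun h : ℝ => h⁻¹ • F h) (b := 𝓝[>] 0) ?_ ?_
  · have := hslope 0 le_rfl
    simpa [hF0, hS.zero] using this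
  · filter_upwards [self_mem_nhdsWithin] with h hh
    have hh0 : (0 : ℝ) ≤ h := le_of_lt hh
    have hshift : ∀ k : ℝ, 0 < k → S k (F h) = F (h + k) - F k := by
      intro k hk
      rw [hF, ← ContinuousLinearMap.intervalIntegral_comp_comm _ (hc.intervalIntegrable _ _)]
      rw [intervalIntegral.integral_interval_sub_left (hc.intervalIntegrable _ _)
        (hc.intervalIntegrable _ _)]
      have h1 := intervalIntegral.integral_comp_add_right (fun s => S (max s 0) x) k (a := 0) (b := h)
      rw [zero_add] at h1
      rw [← h1]
      refine intervalIntegral.integral_congr fun s hs => ?_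
      rw [uIcc_of_le hh0] at hs
      have hs0 : 0 ≤ s + k := by linarith [hs.1]
      simp only [max_eq_left hs.1, max_eq_left hs0]
      rw [← ContinuousLinearMap.comp_apply, ← hS.add _ _ hk.le hs.1, add_comm]
    refine ⟨h⁻¹ • (S h x - x), ?_⟩
    have h2 := ((hslope h hh0).sub (hslope 0 le_rfl)).const_smul h⁻¹
    rw [hS.zero] at h2
    refine h2.congr' ?_
    filter_upwards [self_mem_nhdsWithin] with k hk
    rw [map_smul, hshift k hk, zero_add, hF0]
    module

end Semigroup

/-! ### Decay of the semigroup on the eigenspaces -/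

theorem eq_zero_of_mem_eigSp_zero {u : H} (hu : u ∈ eigSp 0) : u = 0 := by
  obtain ⟨p, hp, rfl⟩ := hu
  have hpc : p = MvPolynomial.C (p.coeff 0) := by
    rw [← MvPolynomial.totalDegree_eq_zero_iff_eq_C]
    exact (MvPolynomial.totalDegree_zero_iff_isHomogeneous _).2 hp.1
  have : angC p = 0 := by
    ext x i
    rw [hpc]
    simp [angVec_apply]
  ext1
  change ContinuousMap.toLp (E := E3) 2 surf ℝ (angC p) = 0
  rw [this, map_zero]

/-- The factor by which the Coriolis operator acts on the potentials of degree `n`. -/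
def coriolisFactor (Om : ℝ) (n : ℕ) : ℝ := -(2 * Om) / ((n : ℝ) * (n + 1))

theorem isCoriolis_of_isHarm (Om : ℝ) {n : ℕ} {p : Poly} (hp : IsHarm n p) :
    IsCoriolis Om (angH p) (coriolisFactor Om n • angH (ang 2 p)) := by
  rcases Nat.eq_zero_or_pos n with rfl | hn
  · rw [eq_zero_of_mem_eigSp_zero (angH_mem_eigSp hp),
      eq_zero_of_mem_eigSp_zero (angH_mem_eigSp (hp.ang 2)), smul_zero]
    have := isCoriolis_angH Om one_ne_zero (p := 0) (harmSpace 1).zero_mem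
    simpa using this
  · exact isCoriolis_angH Om hn.ne' hp

theorem exists_isCoriolis (Om : ℝ) {n : ℕ} {z : H} (hz : z ∈ eigSp n) :
    ∃ d ∈ eigSp n, IsCoriolis Om z d := by
  obtain ⟨p, hp, rfl⟩ := hz
  exact ⟨_, (eigSp n).smul_mem _ (angH_mem_eigSp (hp.ang 2)), isCoriolis_of_isHarm Om hp⟩

theorem IsStokes.inner_eigSp {u f : H} (h : IsStokes u f) {n : ℕ} {z : H} (hz : z ∈ eigSp n) :
    ⟪f, z⟫_ℝ = stokesEv n * ⟪u, z⟫_ℝ := by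
  obtain ⟨p, hp, rfl⟩ := hz
  exact h.inner_angH hp

/-- The energy identity for `Â` in an eigenspace: the Coriolis operator does not contribute. -/
theorem IsAhat.inner_eigProj {nu Om : ℝ} {u g : X} (h : IsAhat nu Om u g) (n : ℕ) :
    ⟪eigProj n (toH g), eigProj n (toH u)⟫_ℝ = nu * stokesEv n * ‖eigProj n (toH u)‖ ^ 2 := by
  obtain ⟨a, c, ha, hc, hg⟩ := h
  set z := eigProj n (toH u) with hz
  have hzm : z ∈ eigSp n := eigProj_mem n _
  obtain ⟨d, hd, hzd⟩ := exists_isCoriolis Om hzm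
  have h1 : ⟪a, z⟫_ℝ = stokesEv n * ‖z‖ ^ 2 := by
    rw [ha.inner_eigSp hzm, ← inner_eigProj_of_mem _ hzm, ← hz, real_inner_self_eq_norm_sq]
  have h2 : ⟪c, z⟫_ℝ = 0 := by
    rw [hc.inner_eq_neg hzd, ← inner_eigProj_of_mem _ hd, ← hz]
    have := hzd.inner_eq_neg hzd
    rw [real_inner_comm] at this
    linarith
  rw [inner_eigProj_of_mem _ hzm, hg, inner_add_left, inner_smul_H, h1, h2]
  ring

/-- A curve whose velocity satisfies `⟪y', y⟫ = -m ‖y‖²` has norm `exp (-m t) ‖y 0‖`. -/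
theorem norm_eq_exp_mul {F : Type*} [NormedAddCommGroup F] [InnerProductSpace ℝ F] {y y' : ℝ → F}
    {m t : ℝ} (ht : 0 ≤ t) (hc : ContinuousOn y (Icc 0 t))
    (hd : ∀ s ∈ Ico 0 t, HasDerivWithinAt y (y' s) (Ici s) s)
    (hE : ∀ s ∈ Ico 0 t, ⟪y' s, y s⟫_ℝ = -(m * ‖y s‖ ^ 2)) :
    ‖y t‖ = Real.exp (-(m * t)) * ‖y 0‖ := by
  let ψ : ℝ → ℝ := fun s => Real.exp (2 * m * s) * ⟪y s, y s⟫_ℝ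
  have hψd : ∀ s ∈ Ico 0 t, HasDerivWithinAt ψ 0 (Ici s) s := by
    intro s hs
    have hin := (hd s hs).inner ℝ (hd s hs)
    have he : HasDerivWithinAt (fun s => Real.exp (2 * m * s)) (Real.exp (2 * m * s) * (2 * m))
        (Ici s) s := by
      have := ((hasDerivAt_id s).const_mul (2 * m)).exp
      simpa using this.hasDerivWithinAt
    refine (he.mul hin).congr_deriv ?_
    rw [real_inner_comm (y' s) (y s), hE s hs, real_inner_self_eq_norm_sq]
    ring
  have hψc : ContinuousOn ψ (Icc 0 t) := ContinuousOn.mul (by fun_prop) (hc.inner hc)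
  have hconst := constant_of_has_deriv_right_zero hψc hψd t ⟨ht, le_rfl⟩
  simp only [ψ, mul_zero, Real.exp_zero, one_mul, real_inner_self_eq_norm_sq] at hconst
  refine (sq_eq_sq₀ (norm_nonneg _) (by positivity)).1 ?_
  rw [mul_pow, ← hconst, ← Real.exp_nat_mul, ← mul_assoc, ← Real.exp_add]
  have : ((2 : ℕ) : ℝ) * -(m * t) + 2 * m * t = 0 := by push_cast; ring
  rw [this, Real.exp_zero, one_mul]

/-- If a bounded operator `L` into an inner product space turns the generator into one with
`⟪L f, L u⟫ = -m ‖L u‖²`, the semigroup decays in the seminorm `‖L ·‖` exactly like `exp (-m t)`. -/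
theorem IsC0Semigroup.norm_comp_eq_exp {E F : Type*} [NormedAddCommGroup E] [NormedSpace ℝ E]
    [CompleteSpace E] [NormedAddCommGroup F] [InnerProductSpace ℝ F] {S : ℝ → E →L[ℝ] E}
    (hS : IsC0Semigroup S) (L : E →L[ℝ] F) {m : ℝ}
    (hL : ∀ u f : E, Tendsto (fun h : ℝ => h⁻¹ • (S h u - u)) (𝓝[>] 0) (𝓝 f) →
      ⟪L f, L u⟫_ℝ = -(m * ‖L u‖ ^ 2)) (x : E) {t : ℝ} (ht : 0 ≤ t) :
    ‖L (S t x)‖ = Real.exp (-(m * t)) * ‖L x‖ := by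
  have hcl : IsClosed {x : E | ‖L (S t x)‖ = Real.exp (-(m * t)) * ‖L x‖} :=
    isClosed_eq (L.continuous.comp (S t).continuous).norm (continuous_const.mul L.continuous.norm)
  refine (hcl.closure_subset_iff.2 ?_) (hS.dense_domain x)
  rintro u ⟨f, hf⟩
  have hc : Continuous (fun s : ℝ => L (S (max s 0) u)) :=
    L.continuous.comp (hS.continuous_uncurry.comp (by fun_prop : Continuous (fun s : ℝ => (s, u))))
  have key := norm_eq_exp_mul (y := fun s => L (S s u)) (y' := fun s => L (S s f))
    (m := m) ht
    (hc.continuousOn.congr fun s hs => by simp only [max_eq_left hs.1])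
    (fun s hs => L.hasFDerivAt.comp_hasDerivWithinAt s (hS.hasDerivWithinAt hf hs.1))
    (fun s hs => hL _ _ (hS.tendsto_generator hf hs.1))
  simp only [hS.zero, ContinuousLinearMap.id_apply] at key
  exact key

/-- The semigroup acts on the `n`-th eigenspace as `exp (-ν μₙ t)` times an isometry. -/
theorem norm_eigProj_semigroup {nu Om : ℝ} {S : ℝ → X →L[ℝ] X}
    (hS : IsStokesCoriolisSemigroup nu Om S) (n : ℕ) (x : X) {t : ℝ} (ht : 0 ≤ t) :
    ‖eigProj n (toH (S t x))‖ = Real.exp (-(nu * stokesEv n * t)) * ‖eigProj n (toH x)‖ := by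
  refine hS.1.norm_comp_eq_exp ((eigProj n).comp toHL) (fun u f hf => ?_) x ht
  have hA : IsAhat nu Om u (-f) := (hS.2 u f).2 hf
  have hE : ⟪-(eigProj n (toH f)), eigProj n (toH u)⟫_ℝ
      = nu * stokesEv n * ‖eigProj n (toH u)‖ ^ 2 := by
    rw [← hA.inner_eigProj n, ← map_neg]; rfl
  rw [inner_neg_left] at hE
  change ⟪eigProj n (toH f), eigProj n (toH u)⟫_ℝ = -(nu * stokesEv n * ‖eigProj n (toH u)‖ ^ 2)
  rw [← hE, neg_neg]

/-! ### Closedness of the operators -/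

theorem IsStokes.of_hasSum {u f : ℕ → H} {u₀ f₀ : H} (h : ∀ n, IsStokes (u n) (f n))
    (hu : HasSum u u₀) (hf : HasSum f f₀) : IsStokes u₀ f₀ := by
  intro V hV hVs
  have hVc : Continuous (fun x : S2 => V x) := hV.continuous.comp continuous_subtype_val
  have hVi : ∀ i, ContDiff ℝ ∞ (fun y => V y i) := fun i =>
    (EuclideanSpace.proj (𝕜 := ℝ) i).contDiff.comp hV
  have hvor : ContDiff ℝ ∞ (vorticity V) := by
    have : vorticity V = fun x => ∑ i, lop i (fun y => V y i) x :=
      funext fun x => vorticity_eq x (hV.differentiable (by simp) x)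
    rw [this]
    exact ContDiff.sum fun i _ => contDiff_lop i (hVi i)
  have hWc : Continuous (fun x : S2 => laplaceDeRham V x + (2 : ℝ) • V x) := by
    have h2 : Continuous (fun x : S2 => (2 : ℝ) • V x) := hVc.const_smul (2 : ℝ)
    suffices h1 : Continuous (fun x : S2 => laplaceDeRham V x) from h1.add h2
    have : (fun x : S2 => laplaceDeRham V x)
        = fun x : S2 => WithLp.toLp 2 (fun i => lop i (vorticity V) x) := by
      funext x; ext i; rw [laplaceDeRham, cross_gradient]
    rw [this]
    refine (PiLp.continuous_toLp 2 _).comp (continuous_pi fun i => ?_)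
    exact (contDiff_lop i hvor).continuous.comp continuous_subtype_val
  have hpair : ∀ {W : S2 → E3} (hW : Continuous W) (w : H),
      ∫ x, ⟪(w : Lp E3 2 surf) x, W x⟫_ℝ ∂surf
        = ⟪(w : Lp E3 2 surf), ContinuousMap.toLp (E := E3) 2 surf ℝ ⟨W, hW⟩⟫_ℝ := fun hW w => by
    rw [L2.inner_def]
    refine integral_congr_ae ?_
    filter_upwards [ContinuousMap.coeFn_toLp (p := 2) surf (𝕜 := ℝ) (⟨_, hW⟩ : C(S2, E3))] with x hx
    rw [hx]; rfl
  have hsum : ∀ {W : S2 → E3} (hW : Continuous W) {w : ℕ → H} {w₀ : H}, HasSum w w₀ →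
      HasSum (fun n => ∫ x, ⟪(w n : Lp E3 2 surf) x, W x⟫_ℝ ∂surf)
        (∫ x, ⟪(w₀ : Lp E3 2 surf) x, W x⟫_ℝ ∂surf) := fun hW w w₀ hw => by
    simp_rw [hpair hW]
    have h1 : HasSum (fun n => (w n : Lp E3 2 surf)) (w₀ : Lp E3 2 surf) :=
      hw.mapL H.subtypeL
    have h2 := h1.mapL (innerSL ℝ (ContinuousMap.toLp (E := E3) 2 surf ℝ ⟨_, hW⟩))
    simpa only [innerSL_apply_apply, real_inner_comm] using h2
  refine (hsum hVc hf).unique ?_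
  simp_rw [fun n => h n V hV hVs]
  exact (hsum hWc hu).neg

theorem memLp_coriolisForce (Om : ℝ) (v : H) :
    MemLp (coriolisForce Om (v : Lp E3 2 surf)) 2 surf := by
  have hcont : Continuous (fun z : E3 × E3 => (2 * Om * z.1 2) • cross z.1 z.2) := by
    have hc1 : Continuous (fun z : E3 × E3 => 2 * Om * z.1 2) := by fun_prop
    suffices hc2 : Continuous (fun z : E3 × E3 => cross z.1 z.2) from hc1.smul hc2
    refine (PiLp.continuous_toLp 2 _).comp (continuous_pi fun i => ?_)
    fin_cases i
    · exact (by fun_prop : Continuous fun z : E3 × E3 => z.1 1 * z.2 2 - z.1 2 * z.2 1)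
    · exact (by fun_prop : Continuous fun z : E3 × E3 => z.1 2 * z.2 0 - z.1 0 * z.2 2)
    · exact (by fun_prop : Continuous fun z : E3 × E3 => z.1 0 * z.2 1 - z.1 1 * z.2 0)
  refine MemLp.of_le_mul (Lp.memLp (v : Lp E3 2 surf)) (c := 2 * |Om|) ?_
    (Eventually.of_forall fun x => norm_coriolisForce_le Om _ x)
  have h1 : AEStronglyMeasurable (fun x : S2 => ((x : E3), (v : Lp E3 2 surf) x)) surf :=
    continuous_subtype_val.aestronglyMeasurable.prodMk (Lp.aestronglyMeasurable _)
  exact hcont.comp_aestronglyMeasurable h1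

theorem IsCoriolis.of_hasSum {Om : ℝ} {u f : ℕ → H} {u₀ f₀ : H} (h : ∀ n, IsCoriolis Om (u n) (f n))
    (hu : HasSum u u₀) (hf : HasSum f f₀) : IsCoriolis Om u₀ f₀ := by
  intro v
  have hpair : ∀ w : H, ∫ x, ⟪coriolisForce Om (w : Lp E3 2 surf) x, (v : Lp E3 2 surf) x⟫_ℝ ∂surf
      = - ⟪(memLp_coriolisForce Om v).toLp, (w : Lp E3 2 surf)⟫_ℝ := fun w => by
    rw [L2.inner_def, ← integral_neg]
    refine integral_congr_ae ?_
    filter_upwards [(memLp_coriolisForce Om v).coeFn_toLp] with x hx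
    rw [hx]
    simp only [coriolisForce, real_inner_smul_left]
    rw [inner_cross_comm]
    ring
  have h1 : HasSum (fun n => ⟪f n, v⟫_ℝ) ⟪f₀, v⟫_ℝ := by
    simpa only [innerSL_apply_apply, real_inner_comm] using hf.mapL (innerSL ℝ v)
  have h2 : HasSum (fun n => - ⟪(memLp_coriolisForce Om v).toLp, (u n : Lp E3 2 surf)⟫_ℝ)
      (- ⟪(memLp_coriolisForce Om v).toLp, (u₀ : Lp E3 2 surf)⟫_ℝ) :=
    ((hu.mapL H.subtypeL).mapL (innerSL ℝ (memLp_coriolisForce Om v).toLp)).neg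
  rw [← inner_H, hpair]
  refine h1.unique ?_
  have h3 : ∀ n, ⟪f n, v⟫_ℝ = - ⟪(memLp_coriolisForce Om v).toLp, (u n : Lp E3 2 surf)⟫_ℝ :=
    fun n => by rw [inner_H, h n v, hpair]
  simp_rw [h3]
  exact h2

/-! ### Expansion in eigenfields -/

theorem norm_sum_eigSp_sq {v : ℕ → H} (hv : ∀ n, v n ∈ eigSp n) (s : Finset ℕ) :
    ‖∑ n ∈ s, v n‖ ^ 2 = ∑ n ∈ s, ‖v n‖ ^ 2 := by
  induction s using Finset.induction_on with
  | empty => simp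
  | insert m s hm ih =>
    rw [Finset.sum_insert hm, Finset.sum_insert hm, ← ih, norm_add_sq_real, inner_sum]
    rw [Finset.sum_eq_zero fun n hn => inner_eigSp (ne_of_mem_of_not_mem hn hm).symm (hv m) (hv n)]
    ring

theorem sum_norm_eigProj_sq_le (u : H) (N : ℕ) :
    ∑ n ∈ Finset.range N, ‖eigProj n u‖ ^ 2 ≤ ‖u‖ ^ 2 := by
  have h1 := norm_sum_eigSp_sq (fun n => eigProj_mem n u) (Finset.range N)
  set z := ∑ n ∈ Finset.range N, eigProj n u with hz
  have h2 : ⟪u, z⟫_ℝ = ‖z‖ ^ 2 := by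
    rw [h1, hz, inner_sum]
    refine Finset.sum_congr rfl fun n _ => ?_
    rw [← inner_eigProj_of_mem _ (eigProj_mem n u), real_inner_self_eq_norm_sq]
  rw [← h1]
  have h3 := real_inner_le_norm u z
  rw [h2] at h3
  nlinarith [norm_nonneg u, norm_nonneg z, sq_nonneg (‖u‖ - ‖z‖)]

theorem summable_of_mem_eigSp {v : ℕ → H} (hv : ∀ n, v n ∈ eigSp n) {Q : ℝ}
    (hQ : ∀ N, ∑ n ∈ Finset.range N, ‖v n‖ ^ 2 ≤ Q) : Summable v := by
  have h := summable_of_sum_range_le (fun n => sq_nonneg ‖v n‖) hQ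
  rw [summable_iff_vanishing_norm] at h ⊢
  intro ε hε
  obtain ⟨s, hs⟩ := h (ε ^ 2) (by positivity)
  refine ⟨s, fun t ht => ?_⟩
  have h1 := (le_abs_self _).trans_lt (hs t ht)
  rw [← norm_sum_eigSp_sq hv] at h1
  exact lt_of_pow_lt_pow_left₀ 2 hε.le h1

theorem eigProj_tsum {v : ℕ → H} (hv : ∀ n, v n ∈ eigSp n) (hs : Summable v) (m : ℕ) :
    eigProj m (∑' n, v n) = v m := by
  rw [(eigProj m).map_tsum hs, tsum_eq_single m fun n hn => eigProj_of_mem_of_ne hn.symm (hv n),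
    eigProj_of_mem (hv m)]

/-- Square summable families of eigenfields are the expansions of elements of `H`. -/
theorem exists_eigProj_eq {v : ℕ → H} (hv : ∀ n, v n ∈ eigSp n) {R : ℝ} (hR : 0 ≤ R)
    (hQ : ∀ N, ∑ n ∈ Finset.range N, ‖v n‖ ^ 2 ≤ R ^ 2) :
    ∃ w : H, (∀ n, eigProj n w = v n) ∧ ‖w‖ ≤ R := by
  have hs := summable_of_mem_eigSp hv hQ
  refine ⟨∑' n, v n, eigProj_tsum hv hs, ?_⟩
  refine le_of_tendsto hs.hasSum.tendsto_sum_nat.norm (Eventually.of_forall fun N => ?_)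
  refine (sq_le_sq₀ (norm_nonneg _) hR).1 ?_
  rw [norm_sum_eigSp_sq hv]
  exact hQ N

theorem hasSum_eigProj (u : H) : HasSum (fun n => eigProj n u) u := by
  have hs := summable_of_mem_eigSp (fun n => eigProj_mem n u) (sum_norm_eigProj_sq_le u)
  have h : u = ∑' n, eigProj n u :=
    eq_of_eigProj_eq fun m => (eigProj_tsum (fun n => eigProj_mem n u) hs m).symm
  have h' := hs.hasSum
  rwa [← h] at h'

/-! ### Series of eigenfields in `X` -/

theorem norm_angX_le {n : ℕ} {p : Poly} (hp : IsHarm n p) :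
    ‖angX p‖ ≤ (supConst + 2) * (((n : ℝ) + 1) * ‖angH p‖) := by
  have h1 := norm_angX_snd_le (fun x => norm_angVec_le hp.1 x)
  have h2 : ‖angX p‖ = ‖angH p‖ + ‖((angX p : X) : WithLp 1 (H × Lp E3 4 surf)).snd‖ :=
    norm_eq (angX p)
  have hs := supConst_pos
  have hh := norm_nonneg (angH p)
  have hn : (0 : ℝ) ≤ n := Nat.cast_nonneg n
  have h3 : Real.sqrt (supConst * (n + 1) * ‖angH p‖ * ‖angH p‖)
      ≤ (supConst * (n + 1) + 1) * ‖angH p‖ := by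
    refine Real.sqrt_le_iff.2 ⟨by positivity, ?_⟩
    have : supConst * (n + 1) ≤ (supConst * (n + 1) + 1) ^ 2 := by
      nlinarith [mul_pos hs (by positivity : (0 : ℝ) < n + 1)]
    calc _ = supConst * (n + 1) * ‖angH p‖ ^ 2 := by ring
      _ ≤ (supConst * (n + 1) + 1) ^ 2 * ‖angH p‖ ^ 2 := by gcongr
      _ = _ := by ring
  rw [h2]
  nlinarith [mul_nonneg hn hh]

theorem summable_angX {p : ℕ → Poly} (hp : ∀ n, IsHarm n (p n))
    (hs : Summable fun n : ℕ => ((n : ℝ) + 1) * ‖angH (p n)‖) : Summable fun n => angX (p n) :=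
  Summable.of_norm_bounded (hs.mul_left (supConst + 2)) fun n => norm_angX_le (hp n)

theorem angVec_sum (s : Finset ℕ) (p : ℕ → Poly) (x : E3) :
    angVec (∑ n ∈ s, p n) x = ∑ n ∈ s, angVec (p n) x := by
  ext i
  rw [angVec_apply, map_sum, ev_sum, WithLp.ofLp_sum, Finset.sum_apply]
  rfl

theorem norm_angX (p : Poly) :
    ‖angX p‖ = ‖angH p‖ + ‖((angX p : X) : WithLp 1 (H × Lp E3 4 surf)).snd‖ :=
  norm_eq (angX p)

/-- The `X`-norm of a sum of eigenfields, by interpolation of `L⁴` between `L²` and the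
supremum. -/
theorem norm_angX_sum_le {p : ℕ → Poly} (hp : ∀ n, IsHarm n (p n)) {R B : ℝ} (hR : 0 ≤ R) (N : ℕ)
    (h2 : ∑ n ∈ Finset.range N, ‖angH (p n)‖ ^ 2 ≤ R ^ 2)
    (hB : ∑ n ∈ Finset.range N, ((n : ℝ) + 1) * ‖angH (p n)‖ ≤ B) :
    ‖angX (∑ n ∈ Finset.range N, p n)‖ ≤ R + Real.sqrt (supConst * B * R) := by
  set q := ∑ n ∈ Finset.range N, p n with hq
  have hH : ‖angH q‖ ≤ R := by
    refine (sq_le_sq₀ (norm_nonneg _) hR).1 ?_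
    rw [hq, map_sum, norm_sum_eigSp_sq fun n => angH_mem_eigSp (hp n)]
    exact h2
  have hsup : ∀ x : S2, ‖angVec q x‖ ≤ supConst * B := by
    intro x
    rw [hq, angVec_sum]
    refine (norm_sum_le _ _).trans ((Finset.sum_le_sum fun n _ => norm_angVec_le (hp n).1 x).trans ?_)
    simp_rw [mul_assoc]
    rw [← Finset.mul_sum]
    exact mul_le_mul_of_nonneg_left hB supConst_pos.le
  rw [norm_angX]
  refine add_le_add hH ((norm_angX_snd_le hsup).trans (Real.sqrt_le_sqrt ?_))
  refine mul_le_mul_of_nonneg_left hH ?_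
  exact (norm_nonneg _).trans (hsup ⟨EuclideanSpace.single 0 1, by simp⟩)

/-! ### Smoothing of the semigroup -/

theorem stokesEv_ge {n : ℕ} (hn : 2 ≤ n) : 4 / 9 * ((n : ℝ) + 1) ^ 2 ≤ stokesEv n := by
  have h : (2 : ℝ) ≤ n := by exact_mod_cast hn
  unfold stokesEv
  nlinarith

theorem four_le_stokesEv {n : ℕ} (hn : 2 ≤ n) : 4 ≤ stokesEv n := by
  have h : (2 : ℝ) ≤ n := by exact_mod_cast hn
  unfold stokesEv
  nlinarith

theorem rpow_mul_exp_neg_le {s : ℝ} (hs : 0 < s) : s ^ (11 / 4 : ℝ) * Real.exp (-s) ≤ 7 := by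
  have h3 : s ^ 3 ≤ 6 * Real.exp s := by
    have := Real.pow_div_factorial_le_exp s hs.le 3
    norm_num [Nat.factorial] at this
    linarith
  have h1 : 1 ≤ Real.exp s := Real.one_le_exp hs.le
  have h : s ^ (11 / 4 : ℝ) ≤ 7 * Real.exp s := by
    rcases le_total s 1 with h | h
    · have := Real.rpow_le_one hs.le h (by norm_num : (0 : ℝ) ≤ 11 / 4)
      linarith
    · have := Real.rpow_le_rpow_of_exponent_le h (by norm_num : (11 / 4 : ℝ) ≤ (3 : ℕ))
      rw [Real.rpow_natCast] at this
      have := Real.exp_pos s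
      linarith
  calc _ ≤ 7 * Real.exp s * Real.exp (-s) := by gcongr
    _ = 7 := by rw [mul_assoc, ← Real.exp_add]; simp

theorem mul_exp_neg_le_one (s : ℝ) : s * Real.exp (-s) ≤ 1 := by
  have h := Real.add_one_le_exp s
  calc s * Real.exp (-s) ≤ Real.exp s * Real.exp (-s) := by
        refine mul_le_mul_of_nonneg_right (by linarith) (Real.exp_pos _).le
    _ = 1 := by rw [← Real.exp_add]; simp

theorem summable_succ_rpow : Summable fun n : ℕ => ((n : ℝ) + 1) ^ (-(3 / 2) : ℝ) := by
  have := (summable_nat_add_iff 1).2 (Real.summable_nat_rpow.2 (by norm_num : (-(3 / 2) : ℝ) < -1))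
  simpa using this

/-- The two elementary bounds behind the smoothing estimate, for the sequence
`bₙ = μₙ exp (-ν μₙ τ) aₙ` and `Q = ∑ μₙ aₙ²`. -/
theorem exists_heat_bounds {nu : ℝ} (hnu : 0 < nu) : ∃ C : ℝ, 0 < C ∧ ∀ (a : ℕ → ℝ) (Q τ : ℝ),
    0 < τ → (∀ n, 0 ≤ a n) → a 0 = 0 → a 1 = 0 →
    (∀ N, ∑ n ∈ Finset.range N, stokesEv n * a n ^ 2 ≤ Q) → ∀ N,
    ∑ n ∈ Finset.range N, (stokesEv n * (Real.exp (-(nu * stokesEv n * τ)) * a n)) ^ 2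
        ≤ (C * Real.exp (-(2 * nu * τ)) * τ ^ (-(1 / 2) : ℝ) * √Q) ^ 2 ∧
      ∑ n ∈ Finset.range N, ((n : ℝ) + 1) * (stokesEv n * (Real.exp (-(nu * stokesEv n * τ)) * a n))
        ≤ C * Real.exp (-(2 * nu * τ)) * τ ^ (-(11 / 8) : ℝ) * √Q := by
  set Z : ℝ := ∑' n : ℕ, ((n : ℝ) + 1) ^ (-(3 / 2) : ℝ) with hZ
  have hZ0 : 0 ≤ Z := tsum_nonneg fun n => by positivity
  set D : ℝ := 9 / 4 * (7 * nu ^ (-(11 / 4) : ℝ) * (4 / 9 : ℝ) ^ (-(3 / 4) : ℝ)) * Z with hD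
  have hD0 : 0 ≤ D := by positivity
  refine ⟨√nu⁻¹ + √D, by positivity, fun a Q τ hτ ha h0 h1 hQ N => ?_⟩
  have hQ0 : 0 ≤ Q := by simpa using hQ 0
  have hcase : ∀ n, n = 0 ∨ n = 1 ∨ 2 ≤ n := fun n => by omega
  have hexp : ∀ n, 2 ≤ n → Real.exp (-(nu * stokesEv n * τ)) ≤ Real.exp (-(4 * nu * τ)) := by
    intro n hn
    refine Real.exp_le_exp.2 (neg_le_neg ?_)
    have := mul_le_mul_of_nonneg_left (four_le_stokesEv hn) (mul_pos hnu hτ).le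
    linarith
  have hsq : ∀ n, Real.exp (-(nu * stokesEv n * τ)) ^ 2
      = Real.exp (-(nu * stokesEv n * τ)) * Real.exp (-(nu * stokesEv n * τ)) := fun n => sq _
  have he2 : Real.exp (-(2 * nu * τ)) ^ 2 = Real.exp (-(4 * nu * τ)) := by
    rw [← Real.exp_nat_mul]; congr 1; push_cast; ring
  constructor
  · have hterm : ∀ n, (stokesEv n * (Real.exp (-(nu * stokesEv n * τ)) * a n)) ^ 2
        ≤ (nu * τ)⁻¹ * Real.exp (-(4 * nu * τ)) * (stokesEv n * a n ^ 2) := by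
      intro n
      rcases hcase n with rfl | rfl | hn
      · simp [h0]
      · simp [h1]
      have hm := four_le_stokesEv hn
      have hb : stokesEv n * Real.exp (-(nu * stokesEv n * τ)) ≤ (nu * τ)⁻¹ := by
        rw [le_inv_comm₀ (by positivity) (by positivity), le_inv_comm₀ (by positivity) (by positivity)]
        have := mul_exp_neg_le_one (nu * stokesEv n * τ)
        rw [← one_div, le_div_iff₀ (by positivity)]
        linarith
      calc _ = (stokesEv n * Real.exp (-(nu * stokesEv n * τ))) * Real.exp (-(nu * stokesEv n * τ))
            * (stokesEv n * a n ^ 2) := by ring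
        _ ≤ _ := by
          have := hexp n hn
          gcongr
    refine (Finset.sum_le_sum fun n _ => hterm n).trans ?_
    rw [← Finset.mul_sum, mul_pow, mul_pow, mul_pow, he2, Real.sq_sqrt hQ0, ← Real.rpow_natCast (τ ^ _),
      ← Real.rpow_mul hτ.le]
    have e1 : (-(1 / 2) : ℝ) * (2 : ℕ) = -1 := by norm_num
    rw [e1, Real.rpow_neg_one, mul_inv]
    have hC : nu⁻¹ ≤ (√nu⁻¹ + √D) ^ 2 := by
      have h1 := Real.sq_sqrt (inv_nonneg.2 hnu.le)
      nlinarith [Real.sqrt_nonneg nu⁻¹, Real.sqrt_nonneg D]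
    calc _ ≤ nu⁻¹ * τ⁻¹ * Real.exp (-(4 * nu * τ)) * Q := by gcongr; exact hQ N
      _ ≤ (√nu⁻¹ + √D) ^ 2 * τ⁻¹ * Real.exp (-(4 * nu * τ)) * Q := by gcongr
      _ = _ := by ring
  · -- the terms `n ≤ 1` are dropped before the Cauchy–Schwarz inequality
    set g : ℕ → ℝ := fun n => if 2 ≤ n then
      ((n : ℝ) + 1) * (√(stokesEv n) * Real.exp (-(nu * stokesEv n * τ))) else 0 with hg
    have hterm : ∀ n : ℕ, ((n : ℝ) + 1) * (stokesEv n * (Real.exp (-(nu * stokesEv n * τ)) * a n))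
        = g n * (√(stokesEv n) * a n) := by
      intro n
      rcases hcase n with rfl | rfl | hn
      · simp [h0]
      · simp [h1]
      have hm := four_le_stokesEv hn
      simp only [hg, if_pos hn]
      have : stokesEv n = √(stokesEv n) * √(stokesEv n) := (Real.mul_self_sqrt (by linarith)).symm
      nth_rewrite 1 [this]
      ring
    have hg2 : ∀ n : ℕ, g n ^ 2 ≤ (9 / 4 * (7 * nu ^ (-(11 / 4) : ℝ) * (4 / 9 : ℝ) ^ (-(3 / 4) : ℝ)))
        * (Real.exp (-(4 * nu * τ)) * τ ^ (-(11 / 4) : ℝ)) * ((n : ℝ) + 1) ^ (-(3 / 2) : ℝ) := by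
      intro n
      by_cases hn : 2 ≤ n
      swap
      · simp only [hg, if_neg hn]
        rw [zero_pow two_ne_zero]
        positivity
      have hm := four_le_stokesEv hn
      have hm0 : 0 < stokesEv n := by linarith
      simp only [hg, if_pos hn, mul_pow, Real.sq_sqrt hm0.le, hsq]
      have h2 : ((n : ℝ) + 1) ^ 2 ≤ 9 / 4 * stokesEv n := by have := stokesEv_ge hn; linarith
      have h3 : Real.exp (-(nu * stokesEv n * τ))
          ≤ 7 * (nu ^ (-(11 / 4) : ℝ) * stokesEv n ^ (-(11 / 4) : ℝ) * τ ^ (-(11 / 4) : ℝ)) := by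
        have h := rpow_mul_exp_neg_le (s := nu * stokesEv n * τ) (by positivity)
        rw [← Real.mul_rpow hnu.le hm0.le, ← Real.mul_rpow (by positivity) hτ.le,
          Real.rpow_neg (by positivity), ← div_eq_mul_inv, le_div_iff₀ (by positivity)]
        linarith
      have h4 : stokesEv n * stokesEv n * stokesEv n ^ (-(11 / 4) : ℝ)
          ≤ (4 / 9 : ℝ) ^ (-(3 / 4) : ℝ) * ((n : ℝ) + 1) ^ (-(3 / 2) : ℝ) := by
        have e1 : stokesEv n * stokesEv n * stokesEv n ^ (-(11 / 4) : ℝ)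
            = stokesEv n ^ (-(3 / 4) : ℝ) := by
          rw [← sq, ← Real.rpow_natCast, ← Real.rpow_add hm0]; norm_num
        have e2 : ((n : ℝ) + 1) ^ (-(3 / 2) : ℝ) = (((n : ℝ) + 1) ^ 2) ^ (-(3 / 4) : ℝ) := by
          rw [← Real.rpow_natCast, ← Real.rpow_mul (by positivity)]; norm_num
        rw [e1, e2, ← Real.mul_rpow (by norm_num) (by positivity)]
        exact Real.rpow_le_rpow_of_nonpos (by positivity) (stokesEv_ge hn) (by norm_num)
      calc _ ≤ (9 / 4 * stokesEv n) * (stokesEv n * ((7 * (nu ^ (-(11 / 4) : ℝ)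
              * stokesEv n ^ (-(11 / 4) : ℝ) * τ ^ (-(11 / 4) : ℝ))) * Real.exp (-(4 * nu * τ)))) := by
            have := hexp n hn
            gcongr
        _ = 9 / 4 * 7 * nu ^ (-(11 / 4) : ℝ) * τ ^ (-(11 / 4) : ℝ) * Real.exp (-(4 * nu * τ)) *
            (stokesEv n * stokesEv n * stokesEv n ^ (-(11 / 4) : ℝ)) := by ring
        _ ≤ 9 / 4 * 7 * nu ^ (-(11 / 4) : ℝ) * τ ^ (-(11 / 4) : ℝ) * Real.exp (-(4 * nu * τ)) *
            ((4 / 9 : ℝ) ^ (-(3 / 4) : ℝ) * ((n : ℝ) + 1) ^ (-(3 / 2) : ℝ)) := by gcongr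
        _ = _ := by ring
    have hgs : ∑ n ∈ Finset.range N, g n ^ 2
        ≤ D * (Real.exp (-(4 * nu * τ)) * τ ^ (-(11 / 4) : ℝ)) := by
      refine (Finset.sum_le_sum fun n _ => hg2 n).trans ?_
      rw [← Finset.mul_sum]
      have : ∑ n ∈ Finset.range N, ((n : ℝ) + 1) ^ (-(3 / 2) : ℝ) ≤ Z :=
        summable_succ_rpow.sum_le_tsum _ fun n _ => by positivity
      calc _ ≤ (9 / 4 * (7 * nu ^ (-(11 / 4) : ℝ) * (4 / 9 : ℝ) ^ (-(3 / 4) : ℝ)))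
          * (Real.exp (-(4 * nu * τ)) * τ ^ (-(11 / 4) : ℝ)) * Z := by gcongr
        _ = _ := by rw [hD]; ring
    have has : ∑ n ∈ Finset.range N, (√(stokesEv n) * a n) ^ 2 ≤ Q := by
      refine le_trans (Finset.sum_le_sum fun n _ => ?_) (hQ N)
      rcases hcase n with rfl | rfl | hn
      · simp [h0]
      · simp [h1]
      have hm := four_le_stokesEv hn
      rw [mul_pow, Real.sq_sqrt (by linarith)]
    simp_rw [hterm]
    refine (Real.sum_mul_le_sqrt_mul_sqrt _ _ _).trans ?_
    have hs1 : √(D * (Real.exp (-(4 * nu * τ)) * τ ^ (-(11 / 4) : ℝ)))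
        = √D * Real.exp (-(2 * nu * τ)) * τ ^ (-(11 / 8) : ℝ) := by
      rw [Real.sqrt_eq_iff_mul_self_eq (by positivity) (by positivity)]
      have e : τ ^ (-(11 / 4) : ℝ) = τ ^ (-(11 / 8) : ℝ) * τ ^ (-(11 / 8) : ℝ) := by
        rw [← Real.rpow_add hτ]; norm_num
      rw [e, ← he2]
      have := Real.mul_self_sqrt hD0
      linear_combination (-1) * (Real.exp (-(2 * nu * τ)) ^ 2 * (τ ^ (-(11 / 8) : ℝ)) ^ 2) * this
    calc _ ≤ √(D * (Real.exp (-(4 * nu * τ)) * τ ^ (-(11 / 4) : ℝ))) * √Q := by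
          gcongr
      _ ≤ _ := by
          rw [hs1]
          have : √D ≤ √nu⁻¹ + √D := by have := Real.sqrt_nonneg nu⁻¹; linarith
          gcongr

theorem norm_coriolis_stokes_le {nu Om : ℝ} (hnu : 0 < nu) {n : ℕ} (hn : 2 ≤ n) {y c : H}
    (hc : IsCoriolis Om y c) : ‖(nu * stokesEv n) • y + c‖ ≤ (nu + |Om|) * (stokesEv n * ‖y‖) := by
  have hm := four_le_stokesEv hn
  have h1 : ‖(nu * stokesEv n) • y‖ = nu * stokesEv n * ‖y‖ := by
    rw [norm_smul, Real.norm_of_nonneg (by nlinarith)]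
  have h2 := hc.norm_le
  have h3 : 2 * |Om| * ‖y‖ ≤ |Om| * (stokesEv n * ‖y‖) := by
    have := mul_nonneg (abs_nonneg Om) (norm_nonneg y)
    nlinarith
  refine (norm_add_le _ _).trans ?_
  rw [h1]
  linarith

/-- The potential of the field `Â (angH p)`, for `p` harmonic of degree `n`. -/
def ahatPoly (nu Om : ℝ) (n : ℕ) (p : Poly) : Poly :=
  (nu * stokesEv n) • p + coriolisFactor Om n • ang 2 p

theorem IsHarm.ahatPoly {n : ℕ} {p : Poly} (hp : IsHarm n p) (nu Om : ℝ) :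
    IsHarm n (ahatPoly nu Om n p) :=
  (harmSpace n).add_mem ((harmSpace n).smul_mem _ hp) ((harmSpace n).smul_mem _ (hp.ang 2))

theorem angH_ahatPoly (nu Om : ℝ) (n : ℕ) (p : Poly) : angH (ahatPoly nu Om n p)
    = (nu * stokesEv n) • angH p + coriolisFactor Om n • angH (ang 2 p) := by
  rw [ahatPoly, map_add, map_smul, map_smul]

/-- A sequence of harmonic potentials, one of each degree, without fields of degree one. -/
structure IsHarmSeq (p : ℕ → Poly) : Prop where
  harm : ∀ n, IsHarm n (p n)
  one : angH (p 1) = 0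

theorem IsHarmSeq.cases {p : ℕ → Poly} (hp : IsHarmSeq p) (n : ℕ) : angH (p n) = 0 ∨ 2 ≤ n := by
  rcases n with _ | _ | n
  · exact Or.inl (eq_zero_of_mem_eigSp_zero (angH_mem_eigSp (hp.harm 0)))
  · exact Or.inl hp.one
  · exact Or.inr (by omega)

theorem IsHarmSeq.nonneg {p : ℕ → Poly} (hp : IsHarmSeq p) (n : ℕ) :
    0 ≤ stokesEv n * ‖angH (p n)‖ := by
  rcases hp.cases n with h | h
  · simp [h]
  · have := four_le_stokesEv h; positivity

theorem IsHarmSeq.le_succ_mul {p : ℕ → Poly} (hp : IsHarmSeq p) (n : ℕ) :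
    stokesEv n * ‖angH (p n)‖ ≤ ((n : ℝ) + 1) * (stokesEv n * ‖angH (p n)‖) := by
  have := mul_nonneg (Nat.cast_nonneg n : (0 : ℝ) ≤ n) (hp.nonneg n)
  linarith

theorem IsHarmSeq.norm_ahatPoly_le {p : ℕ → Poly} (hp : IsHarmSeq p) {nu : ℝ} (hnu : 0 < nu) (Om : ℝ)
    (n : ℕ) : ‖angH (ahatPoly nu Om n (p n))‖ ≤ (nu + |Om|) * (stokesEv n * ‖angH (p n)‖) := by
  rw [angH_ahatPoly]
  have hc := isCoriolis_of_isHarm Om (hp.harm n)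
  rcases hp.cases n with h | h
  · have h0 := hc.norm_le
    rw [h, norm_zero, mul_zero] at h0
    rw [norm_le_zero_iff.1 h0, h]; simp
  · exact norm_coriolis_stokes_le hnu h hc

theorem IsHarmSeq.summable_ahatPoly {p : ℕ → Poly} (hp : IsHarmSeq p) {nu : ℝ} (hnu : 0 < nu) (Om : ℝ)
    (hs : Summable fun n : ℕ => ((n : ℝ) + 1) * (stokesEv n * ‖angH (p n)‖)) :
    Summable fun n => angX (ahatPoly nu Om n (p n)) := by
  refine summable_angX (fun n => (hp.harm n).ahatPoly nu Om) ?_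
  refine Summable.of_nonneg_of_le (fun n => by positivity) (fun n => ?_) (hs.mul_left (nu + |Om|))
  calc _ ≤ ((n : ℝ) + 1) * ((nu + |Om|) * (stokesEv n * ‖angH (p n)‖)) := by
        gcongr; exact hp.norm_ahatPoly_le hnu Om n
    _ = _ := by ring

theorem IsHarmSeq.isAhat {p : ℕ → Poly} (hp : IsHarmSeq p) {nu : ℝ} (hnu : 0 < nu) (Om : ℝ)
    (hs : Summable fun n : ℕ => ((n : ℝ) + 1) * (stokesEv n * ‖angH (p n)‖)) {u : X}
    (hu : ∀ n, eigProj n (toH u) = angH (p n)) :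
    IsAhat nu Om u (∑' n, angX (ahatPoly nu Om n (p n))) := by
  have hsa : Summable fun n => stokesEv n • angH (p n) := by
    refine Summable.of_norm_bounded hs fun n => ?_
    rcases hp.cases n with h | h
    · simp [h]
    · have := four_le_stokesEv h
      rw [norm_smul, Real.norm_of_nonneg (by linarith)]
      exact hp.le_succ_mul n
  have hsyn : Summable fun n => ‖angH (p n)‖ := by
    refine Summable.of_nonneg_of_le (fun n => norm_nonneg _) (fun n => ?_) hs
    rcases hp.cases n with h | h
    · simp [h]
    · have := four_le_stokesEv h
      have := norm_nonneg (angH (p n))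
      have := hp.le_succ_mul n
      nlinarith
  have hsc : Summable fun n => coriolisFactor Om n • angH (ang 2 (p n)) :=
    Summable.of_norm_bounded (hsyn.mul_left (2 * |Om|)) fun n =>
      (isCoriolis_of_isHarm Om (hp.harm n)).norm_le
  have hy : HasSum (fun n => angH (p n)) (toH u) := by simpa only [hu] using hasSum_eigProj (toH u)
  have hA := IsStokes.of_hasSum (fun n => isStokes_angH (hp.harm n)) hy hsa.hasSum
  have hC := IsCoriolis.of_hasSum (fun n => isCoriolis_of_isHarm Om (hp.harm n)) hy hsc.hasSum
  have h1 : HasSum (fun n => angH (ahatPoly nu Om n (p n)))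
      (toH (∑' n, angX (ahatPoly nu Om n (p n)))) :=
    (hp.summable_ahatPoly hnu Om hs).hasSum.mapL toHL
  have h2 := (hsa.hasSum.const_smul nu).add hsc.hasSum
  simp only [smul_smul, ← angH_ahatPoly] at h2
  exact ⟨_, _, hA, hC, h1.unique h2⟩

theorem IsHarmSeq.norm_tsum_le {p : ℕ → Poly} (hp : IsHarmSeq p) {nu : ℝ} (hnu : 0 < nu) (Om : ℝ)
    {R B : ℝ} (hR : 0 ≤ R)
    (h2 : ∀ N, ∑ n ∈ Finset.range N, (stokesEv n * ‖angH (p n)‖) ^ 2 ≤ R ^ 2)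
    (hB : ∀ N, ∑ n ∈ Finset.range N, ((n : ℝ) + 1) * (stokesEv n * ‖angH (p n)‖) ≤ B) :
    ‖∑' n, angX (ahatPoly nu Om n (p n))‖ ≤ (nu + |Om|) * (R + √(supConst * B * R)) := by
  have hK : 0 ≤ nu + |Om| := by positivity
  have hs : Summable fun n : ℕ => ((n : ℝ) + 1) * (stokesEv n * ‖angH (p n)‖) :=
    summable_of_sum_range_le (fun n => mul_nonneg (by positivity) (hp.nonneg n)) hB
  refine le_of_tendsto (hp.summable_ahatPoly hnu Om hs).hasSum.tendsto_sum_nat.norm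
    (Eventually.of_forall fun N => ?_)
  rw [← map_sum]
  refine (norm_angX_sum_le (R := (nu + |Om|) * R) (B := (nu + |Om|) * B)
    (fun n => (hp.harm n).ahatPoly nu Om) (mul_nonneg hK hR) N ?_ ?_).trans (le_of_eq ?_)
  · rw [mul_pow]
    refine le_trans (Finset.sum_le_sum fun n _ => ?_)
      ((Finset.mul_sum _ _ _).symm.le.trans (mul_le_mul_of_nonneg_left (h2 N) (sq_nonneg _)))
    rw [← mul_pow]
    exact pow_le_pow_left₀ (norm_nonneg _) (hp.norm_ahatPoly_le hnu Om n) 2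
  · refine le_trans (Finset.sum_le_sum fun n _ => ?_)
      ((Finset.mul_sum _ _ _).symm.le.trans (mul_le_mul_of_nonneg_left (hB N) hK))
    rw [mul_left_comm]
    exact mul_le_mul_of_nonneg_left (hp.norm_ahatPoly_le hnu Om n) (by positivity)
  · have : supConst * ((nu + |Om|) * B) * ((nu + |Om|) * R)
        = (nu + |Om|) ^ 2 * (supConst * B * R) := by ring
    rw [this, Real.sqrt_mul (sq_nonneg _), Real.sqrt_sq hK]
    ring

/-- Interpolation of the two elementary bounds of `exists_heat_bounds`. -/
theorem add_sqrt_mul_le {s C E τ q : ℝ} (hs : 0 < s) (hC : 0 < C) (hE : 0 < E) (hτ : 0 < τ)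
    (hq : 0 ≤ q) : C * E * τ ^ (-(1 / 2) : ℝ) * q
      + √(s * (C * E * τ ^ (-(11 / 8) : ℝ) * q) * (C * E * τ ^ (-(1 / 2) : ℝ) * q))
      ≤ C * (1 + √s) * (E * (τ ^ (-(1 / 2) : ℝ) + τ ^ (-(15 / 16) : ℝ))) * q := by
  have h1 : √(s * (C * E * τ ^ (-(11 / 8) : ℝ) * q) * (C * E * τ ^ (-(1 / 2) : ℝ) * q))
      = √s * (C * E * τ ^ (-(15 / 16) : ℝ) * q) := by
    have e : τ ^ (-(15 / 16) : ℝ) * τ ^ (-(15 / 16) : ℝ) = τ ^ (-(11 / 8) : ℝ) * τ ^ (-(1 / 2) : ℝ) := by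
      rw [← Real.rpow_add hτ, ← Real.rpow_add hτ]; norm_num
    have e2 : s * (C * E * τ ^ (-(11 / 8) : ℝ) * q) * (C * E * τ ^ (-(1 / 2) : ℝ) * q)
        = s * (C * E * τ ^ (-(15 / 16) : ℝ) * q) ^ 2 := by
      linear_combination (-1) * s * (C * E * q) ^ 2 * e
    rw [e2, Real.sqrt_mul hs.le, Real.sqrt_sq (by positivity)]
  have hA : 0 ≤ √s * (C * E * τ ^ (-(1 / 2) : ℝ) * q) := by positivity
  have hB : 0 ≤ C * E * τ ^ (-(15 / 16) : ℝ) * q := by positivity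
  rw [h1]
  linarith

/-- The smoothing estimate: for `τ > 0` the semigroup maps the fields `x` with
`Q = ∑ μₙ ‖Pₙ x‖² < ∞` and no component of degree one into the domain of `Â` in `X`, with a norm
that decays exponentially and has an integrable singularity at `τ = 0`. -/
theorem exists_isAhat_semigroup {nu : ℝ} (hnu : 0 < nu) (Om : ℝ) : ∃ C : ℝ, 0 < C ∧
    ∀ S, IsStokesCoriolisSemigroup nu Om S → ∀ (x : X) (Q : ℝ), eigProj 1 (toH x) = 0 →
      (∀ N, ∑ n ∈ Finset.range N, stokesEv n * ‖eigProj n (toH x)‖ ^ 2 ≤ Q) → ∀ τ, 0 < τ →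
      ∃ f, IsAhat nu Om (S τ x) f ∧ ‖f‖ ≤ C * (Real.exp (-(2 * nu * τ)) *
        (τ ^ (-(1 / 2) : ℝ) + τ ^ (-(15 / 16) : ℝ))) * √Q := by
  obtain ⟨C, hC, hheat⟩ := exists_heat_bounds hnu
  have hsc := supConst_pos
  have hK : 0 < nu + |Om| := by positivity
  refine ⟨(nu + |Om|) * (C * (1 + √supConst)), by positivity, fun S hS x Q hx1 hQ τ hτ => ?_⟩
  choose p hp hpy using fun n => exists_of_mem_eigSp (eigProj_mem n (toH (S τ x)))
  have hn : ∀ n, ‖angH (p n)‖ = Real.exp (-(nu * stokesEv n * τ)) * ‖eigProj n (toH x)‖ := fun n => by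
    rw [hpy]; exact norm_eigProj_semigroup hS n x hτ.le
  have hseq : IsHarmSeq p := ⟨hp, norm_eq_zero.1 (by rw [hn, hx1, norm_zero, mul_zero])⟩
  have hb := hheat (fun n => ‖eigProj n (toH x)‖) Q τ hτ (fun n => norm_nonneg _)
    (by rw [eq_zero_of_mem_eigSp_zero (eigProj_mem 0 _), norm_zero]) (by rw [hx1, norm_zero]) hQ
  simp only [← hn] at hb
  have hs : Summable fun n : ℕ => ((n : ℝ) + 1) * (stokesEv n * ‖angH (p n)‖) :=
    summable_of_sum_range_le (fun n => mul_nonneg (by positivity) (hseq.nonneg n)) fun N => (hb N).2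
  have hA := hseq.isAhat hnu Om hs (u := S τ x) fun n => (hpy n).symm
  have hle := hseq.norm_tsum_le hnu Om (by positivity) (fun N => (hb N).1) fun N => (hb N).2
  have har := mul_le_mul_of_nonneg_left
    (add_sqrt_mul_le hsc hC (Real.exp_pos (-(2 * nu * τ))) hτ (Real.sqrt_nonneg Q)) hK.le
  refine ⟨_, hA, hle.trans (har.trans (le_of_eq ?_))⟩
  ring

/-! ### Stokes eigenbases -/

theorem eigProj_basis_of_ne {e : HilbertBasis ℕ ℝ H} {lam : ℕ → ℝ}
    (heig : ∀ l, IsStokes (e l) (lam l • e l)) {l n : ℕ} (h : lam l ≠ stokesEv n) :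
    eigProj n (e l) = 0 := by
  set z := eigProj n (e l) with hz
  have hzm : z ∈ eigSp n := eigProj_mem n _
  have h1 := (heig l).inner_eigSp hzm
  rw [inner_smul_H] at h1
  have h2 : ⟪e l, z⟫_ℝ = 0 := by
    have : (lam l - stokesEv n) * ⟪e l, z⟫_ℝ = 0 := by linarith
    exact (mul_eq_zero.1 this).resolve_left (sub_ne_zero.2 h)
  rw [← inner_eigProj_of_mem _ hzm, ← hz] at h2
  exact inner_self_eq_zero.1 h2

theorem eigProj_basis_of_eq {e : HilbertBasis ℕ ℝ H} {lam : ℕ → ℝ}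
    (heig : ∀ l, IsStokes (e l) (lam l • e l)) {l n : ℕ} (h : lam l = stokesEv n) :
    eigProj n (e l) = e l := by
  refine eq_of_eigProj_eq fun m => ?_
  rcases eq_or_ne m n with rfl | hm
  · exact eigProj_of_mem (eigProj_mem _ _)
  · rw [eigProj_of_mem_of_ne hm (eigProj_mem n _), eigProj_basis_of_ne heig]
    rw [h]
    exact fun h' => hm (stokesEv_injective h').symm

theorem inner_eigProj_basis {e : HilbertBasis ℕ ℝ H} {lam : ℕ → ℝ}
    (heig : ∀ l, IsStokes (e l) (lam l • e l)) (u : H) (n l : ℕ) :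
    ⟪eigProj n u, e l⟫_ℝ = if lam l = stokesEv n then ⟪u, e l⟫_ℝ else 0 := by
  rw [inner_eigProj_left]
  split_ifs with h
  · rw [eigProj_basis_of_eq heig h]
  · rw [eigProj_basis_of_ne heig h, inner_zero_right]

theorem eq_zero_of_inner_basis {e : HilbertBasis ℕ ℝ H} {u : H} (h : ∀ l, ⟪u, e l⟫_ℝ = 0) :
    u = 0 := by
  have := e.tsum_inner_mul_inner u u
  simp only [h, zero_mul, tsum_zero] at this
  exact inner_self_eq_zero.1 this.symm

theorem eigProj_one_eq_zero {e : HilbertBasis ℕ ℝ H} {lam : ℕ → ℝ}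
    (heig : ∀ l, IsStokes (e l) (lam l • e l)) {u : H} (hpos : ∀ l, ⟪u, e l⟫_ℝ ≠ 0 → 0 < lam l) :
    eigProj 1 u = 0 := by
  refine eq_zero_of_inner_basis (e := e) fun l => ?_
  rw [inner_eigProj_basis heig]
  split_ifs with h
  · by_contra h'
    have := hpos l h'
    rw [h] at this
    norm_num [stokesEv] at this
  · rfl

/-- The quadratic form of the Stokes operator in terms of its eigenspaces is bounded by its
expression in an eigenbasis. -/
theorem sum_stokesEv_le_tsum {e : HilbertBasis ℕ ℝ H} {lam : ℕ → ℝ}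
    (heig : ∀ l, IsStokes (e l) (lam l • e l)) {u : H} (hpos : ∀ l, ⟪u, e l⟫_ℝ ≠ 0 → 0 < lam l)
    (hs : Summable fun l => lam l * ⟪u, e l⟫_ℝ ^ 2) (N : ℕ) :
    ∑ n ∈ Finset.range N, stokesEv n * ‖eigProj n u‖ ^ 2 ≤ ∑' l, lam l * ⟪u, e l⟫_ℝ ^ 2 := by
  have hnn : ∀ l, 0 ≤ lam l * ⟪u, e l⟫_ℝ ^ 2 := fun l => by
    by_cases h : ⟪u, e l⟫_ℝ = 0
    · simp [h]
    · have := hpos l h; positivity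
  have h1 : ∀ n, HasSum (fun l => stokesEv n * ⟪eigProj n u, e l⟫_ℝ ^ 2)
      (stokesEv n * ‖eigProj n u‖ ^ 2) := fun n => by
    have := e.hasSum_inner_mul_inner (eigProj n u) (eigProj n u)
    rw [real_inner_self_eq_norm_sq] at this
    have h2 := this.mul_left (stokesEv n)
    simp only [real_inner_comm (eigProj n u), ← sq] at h2
    exact h2
  refine hasSum_le (fun l => ?_) (hasSum_sum fun n (_ : n ∈ Finset.range N) => h1 n) hs.hasSum
  have h2 : ∀ n, stokesEv n * ⟪eigProj n u, e l⟫_ℝ ^ 2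
      = if lam l = stokesEv n then lam l * ⟪u, e l⟫_ℝ ^ 2 else 0 := fun n => by
    rw [inner_eigProj_basis heig]
    split_ifs with h
    · rw [h]
    · simp
  simp_rw [h2]
  by_cases hm : ∃ m, lam l = stokesEv m
  · obtain ⟨m, hm⟩ := hm
    have h3 : ∀ n, (if lam l = stokesEv n then lam l * ⟪u, e l⟫_ℝ ^ 2 else 0)
        = if m = n then lam l * ⟪u, e l⟫_ℝ ^ 2 else 0 := fun n => by
      rw [hm]
      simp only [stokesEv_injective.eq_iff]
    simp_rw [h3, Finset.sum_ite_eq]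
    split_ifs
    · exact le_rfl
    · exact hnn l
  · push Not at hm
    simp only [hm, if_false, Finset.sum_const_zero]
    exact hnn l

/-! ### Measurability of càdlàg paths -/

theorem IsCadlagPath.stronglyMeasurable {E : Type*} [NormedAddCommGroup E] {f : ℝ → E}
    (hf : IsCadlagPath f) : StronglyMeasurable f := by
  have hm : ∀ n : ℕ, StronglyMeasurable fun r : ℝ =>
      f (((⌊((n : ℝ) + 1) * r⌋ : ℤ) + 1) / ((n : ℝ) + 1)) := fun n =>
    (StronglyMeasurable.of_discrete (f := fun k : ℤ => f (((k : ℝ) + 1) / ((n : ℝ) + 1)))).comp_measurable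
      (by fun_prop : Measurable fun r : ℝ => ⌊((n : ℝ) + 1) * r⌋)
  refine stronglyMeasurable_of_tendsto atTop hm (tendsto_pi_nhds.2 fun r => ?_)
  refine Tendsto.comp (hf r).1 (tendsto_nhdsWithin_iff.2 ⟨?_, Eventually.of_forall fun n => ?_⟩)
  · have h0 : Tendsto (fun n : ℕ => r + 1 / ((n : ℝ) + 1)) atTop (𝓝 r) := by
      simpa using tendsto_one_div_add_atTop_nhds_zero_nat.const_add r
    refine tendsto_of_tendsto_of_tendsto_of_le_of_le tendsto_const_nhds h0 (fun n => ?_) fun n => ?_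
    · have hn : (0 : ℝ) < n + 1 := by positivity
      change r ≤ _
      rw [le_div_iff₀ hn]
      have := Int.lt_floor_add_one (((n : ℝ) + 1) * r)
      linarith
    · have hn : (0 : ℝ) < n + 1 := by positivity
      change _ ≤ r + 1 / ((n : ℝ) + 1)
      have e1 : (r + 1 / ((n : ℝ) + 1)) * ((n : ℝ) + 1) = ((n : ℝ) + 1) * r + 1 := by
        field_simp
      rw [div_le_iff₀ hn, e1]
      have := Int.floor_le (((n : ℝ) + 1) * r)
      linarith
  · have hn : (0 : ℝ) < n + 1 := by positivity
    change r ≤ _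
    rw [le_div_iff₀ hn]
    have := Int.lt_floor_add_one (((n : ℝ) + 1) * r)
    linarith

/-! ### The Ornstein–Uhlenbeck integral of a path of moderate growth -/

/-- The deterministic property of a path that makes the Ornstein–Uhlenbeck integral converge: the
components along the kernel of the Stokes operator vanish, and the quadratic form of the Stokes
operator grows at most polynomially along the path. -/
def HasModerateGrowth (e : HilbertBasis ℕ ℝ H) (lam : ℕ → ℝ) (w : PathSpace) : Prop :=
  (∀ l t, coord e l t w ≠ 0 → 0 < lam l) ∧ ∃ K : ℝ, ∀ t : ℝ,
    Summable (fun l => lam l * coord e l t w ^ 2) ∧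
      ∑' l, lam l * coord e l t w ^ 2 ≤ K * (1 + |t|) ^ 5

/-- The increments of a path of moderate growth. -/
theorem HasModerateGrowth.sub {e : HilbertBasis ℕ ℝ H} {lam : ℕ → ℝ}
    (heig : ∀ l, IsStokes (e l) (lam l • e l)) {w : PathSpace} (hw : HasModerateGrowth e lam w) :
    ∃ K : ℝ, 0 ≤ K ∧ ∀ t r : ℝ, eigProj 1 (toH (w.1 t - w.1 r)) = 0 ∧
      ∀ N, ∑ n ∈ Finset.range N, stokesEv n * ‖eigProj n (toH (w.1 t - w.1 r))‖ ^ 2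
        ≤ K * (1 + |t|) ^ 5 * (1 + |t - r|) ^ 5 := by
  obtain ⟨hpos, K, hK⟩ := hw
  have hnn : ∀ l t, 0 ≤ lam l * coord e l t w ^ 2 := fun l t => by
    by_cases h : coord e l t w = 0
    · simp [h]
    · have := hpos l t h; positivity
  have hK0 : 0 ≤ K := by
    have h1 := (hK 0).2
    have h2 : 0 ≤ ∑' l, lam l * coord e l 0 w ^ 2 := tsum_nonneg fun l => hnn l 0
    rw [abs_zero, add_zero, one_pow, mul_one] at h1
    exact h2.trans h1
  refine ⟨4 * K, by positivity, fun t r => ?_⟩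
  have hc : ∀ l, ⟪toH (w.1 t - w.1 r), e l⟫_ℝ = coord e l t w - coord e l r w := fun l =>
    inner_sub_left (toH (w.1 t)) (toH (w.1 r)) (e l)
  have hp : ∀ l, ⟪toH (w.1 t - w.1 r), e l⟫_ℝ ≠ 0 → 0 < lam l := fun l h => by
    rw [hc] at h
    by_cases h' : coord e l t w = 0
    · refine hpos l r fun h'' => h ?_
      rw [h', h'', sub_zero]
    · exact hpos l t h'
  have hle : ∀ l, lam l * ⟪toH (w.1 t - w.1 r), e l⟫_ℝ ^ 2
      ≤ 2 * (lam l * coord e l t w ^ 2) + 2 * (lam l * coord e l r w ^ 2) := fun l => by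
    by_cases h : ⟪toH (w.1 t - w.1 r), e l⟫_ℝ = 0
    · have := hnn l t
      have := hnn l r
      rw [h]
      linarith
    · have h0 := hp l h
      rw [hc]
      nlinarith [mul_nonneg h0.le (sq_nonneg (coord e l t w + coord e l r w))]
  have hnn' : ∀ l, 0 ≤ lam l * ⟪toH (w.1 t - w.1 r), e l⟫_ℝ ^ 2 := fun l => by
    by_cases h : ⟪toH (w.1 t - w.1 r), e l⟫_ℝ = 0
    · rw [h]; simp
    · have := hp l h; positivity
  have hS := ((hK t).1.mul_left 2).add ((hK r).1.mul_left 2)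
  have hs := Summable.of_nonneg_of_le hnn' hle hS
  refine ⟨eigProj_one_eq_zero heig hp, fun N => (sum_stokesEv_le_tsum heig hp hs N).trans ?_⟩
  refine (hs.tsum_le_tsum hle hS).trans ?_
  rw [((hK t).1.mul_left 2).tsum_add ((hK r).1.mul_left 2), tsum_mul_left, tsum_mul_left]
  have h1 := (hK t).2
  have h2 := (hK r).2
  have h3 : (1 : ℝ) ≤ 1 + |t - r| := by linarith [abs_nonneg (t - r)]
  have h4 : (1 + |r|) ^ 5 ≤ ((1 + |t|) * (1 + |t - r|)) ^ 5 := by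
    refine pow_le_pow_left₀ (by positivity) ?_ 5
    have : |r| ≤ |t| + |t - r| := by
      have := abs_sub_abs_le_abs_sub r t
      rw [abs_sub_comm] at this
      linarith
    nlinarith [mul_nonneg (abs_nonneg t) (abs_nonneg (t - r))]
  have h5 : (1 + |t|) ^ 5 ≤ (1 + |t|) ^ 5 * (1 + |t - r|) ^ 5 :=
    le_mul_of_one_le_right (by positivity) (one_le_pow₀ h3)
  rw [mul_pow] at h4
  have h6 := mul_le_mul_of_nonneg_left h4 hK0
  have h7 := mul_le_mul_of_nonneg_left h5 hK0
  linarith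

theorem integrableOn_exp_mul_rpow {a b : ℝ} (hb : 0 < b) (ha : -1 < a) (t : ℝ) :
    IntegrableOn (fun r : ℝ => Real.exp (-(b * (t - r))) * (t - r) ^ a) (Iio t) := by
  have h := integrableOn_rpow_mul_exp_neg_mul_rpow ha one_pos hb
  have hmp := (volume : Measure ℝ).measurePreserving_sub_left t
  rw [← hmp.integrableOn_comp_preimage (MeasurableEquiv.subLeft t).measurableEmbedding] at h
  have hpre : (fun r : ℝ => t - r) ⁻¹' Ioi 0 = Iio t := by ext r; simp
  rw [hpre] at h
  refine h.congr_fun (fun r hr => ?_) measurableSet_Iio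
  simp only [Function.comp_apply, Real.rpow_one]
  rw [mul_comm, neg_mul]

theorem one_add_pow_le_exp {nu : ℝ} (hnu : 0 < nu) : ∃ D : ℝ, 0 < D ∧ ∀ τ, 0 ≤ τ →
    √((1 + τ) ^ 5) ≤ D * Real.exp (nu * τ) := by
  refine ⟨√(120 * Real.exp (2 * nu) / (2 * nu) ^ 5), by positivity, fun τ hτ => ?_⟩
  have h := Real.pow_div_factorial_le_exp (2 * nu * (1 + τ)) (by positivity) 5
  have h2 : (1 + τ) ^ 5 ≤ 120 * Real.exp (2 * nu) / (2 * nu) ^ 5 * Real.exp (nu * τ) ^ 2 := by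
    have e1 : Real.exp (2 * nu * (1 + τ)) = Real.exp (2 * nu) * Real.exp (nu * τ) ^ 2 := by
      rw [← Real.exp_nat_mul, ← Real.exp_add]; congr 1; push_cast; ring
    rw [e1] at h
    norm_num [Nat.factorial] at h
    rw [div_mul_eq_mul_div, le_div_iff₀ (by positivity)]
    rw [mul_pow] at h
    linarith
  refine (Real.sqrt_le_sqrt h2).trans ?_
  rw [Real.sqrt_mul (by positivity), Real.sqrt_sq (Real.exp_pos _).le]

/-- The generator of a semigroup applied along a measurable path is measurable, being a limit of
difference quotients. -/
theorem IsC0Semigroup.aestronglyMeasurable_generator {E : Type*} [NormedAddCommGroup E]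
    [NormedSpace ℝ E] [CompleteSpace E] {S : ℝ → E →L[ℝ] E} (hS : IsC0Semigroup S) {w G : ℝ → E}
    (hw : StronglyMeasurable w) {t : ℝ}
    (hG : ∀ r < t, Tendsto (fun h : ℝ => h⁻¹ • (S h (S (t - r) (w t - w r)) - S (t - r) (w t - w r)))
      (𝓝[>] 0) (𝓝 (-G r))) :
    AEStronglyMeasurable G (volume.restrict (Iio t)) := by
  have hmx : StronglyMeasurable fun r => S (max (t - r) 0) (w t - w r) :=
    hS.continuous_uncurry.comp_stronglyMeasurable
      ((by fun_prop : Measurable fun r : ℝ => t - r).stronglyMeasurable.prodMk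
        (stronglyMeasurable_const.sub hw))
  set h : ℕ → ℝ := fun k => 1 / ((k : ℝ) + 1) with hh
  have hlim : Tendsto h atTop (𝓝[>] 0) := tendsto_nhdsWithin_iff.2
    ⟨tendsto_one_div_add_atTop_nhds_zero_nat, Eventually.of_forall fun k => by
      change 0 < 1 / ((k : ℝ) + 1); positivity⟩
  refine aestronglyMeasurable_of_tendsto_ae (u := atTop) (f := fun (k : ℕ) r =>
    -((h k)⁻¹ • (S (h k) (S (max (t - r) 0) (w t - w r)) - S (max (t - r) 0) (w t - w r))))
    (fun k => ?_) ?_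
  · exact ((((S (h k)).continuous.comp_stronglyMeasurable hmx).sub hmx).const_smul
      (h k)⁻¹).neg.aestronglyMeasurable
  · filter_upwards [self_mem_ae_restrict measurableSet_Iio] with r hr
    rw [max_eq_left (sub_pos.2 hr).le]
    simpa using ((hG r hr).comp hlim).neg

theorem integrableOn_iic_of_bound {E : Type*} [NormedAddCommGroup E] {nu t c : ℝ} (hnu : 0 < nu)
    {G : ℝ → E} (hm : AEStronglyMeasurable G (volume.restrict (Iio t)))
    (hG : ∀ r < t, ‖G r‖ ≤ c * (Real.exp (-(nu * (t - r))) *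
      ((t - r) ^ (-(1 / 2) : ℝ) + (t - r) ^ (-(15 / 16) : ℝ)))) : IntegrableOn G (Iic t) := by
  rw [IntegrableOn, ← restrict_Iio_eq_restrict_Iic]
  have hg : IntegrableOn (fun r : ℝ => c *
      (Real.exp (-(nu * (t - r))) * (t - r) ^ (-(1 / 2) : ℝ)
        + Real.exp (-(nu * (t - r))) * (t - r) ^ (-(15 / 16) : ℝ))) (Iio t) :=
    ((integrableOn_exp_mul_rpow hnu (by norm_num) t).add
      (integrableOn_exp_mul_rpow hnu (by norm_num) t)).const_mul _
  refine hg.mono' hm ?_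
  filter_upwards [self_mem_ae_restrict measurableSet_Iio] with r hr
  exact (hG r hr).trans (le_of_eq (by ring))

/-- The polynomial growth of a path is absorbed by the exponential decay of the semigroup. -/
theorem decay_mul_growth_le {nu C D K T τ g : ℝ} (hC : 0 < C) (hτ : 0 ≤ τ) (hg : 0 ≤ g)
    (hK : 0 ≤ K) (hD : √((1 + τ) ^ 5) ≤ D * Real.exp (nu * τ)) :
    C * (Real.exp (-(2 * nu * τ)) * g) * √(K * (1 + |T|) ^ 5 * (1 + |τ|) ^ 5)
      ≤ C * √(K * (1 + |T|) ^ 5) * D * (Real.exp (-(nu * τ)) * g) := by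
  rw [Real.sqrt_mul (by positivity), abs_of_nonneg hτ]
  have h2 : Real.exp (-(2 * nu * τ)) * Real.exp (nu * τ) = Real.exp (-(nu * τ)) := by
    rw [← Real.exp_add]; congr 1; ring
  calc _ ≤ C * (Real.exp (-(2 * nu * τ)) * g) * (√(K * (1 + |T|) ^ 5) * (D * Real.exp (nu * τ))) := by
        gcongr
    _ = C * √(K * (1 + |T|) ^ 5) * D * ((Real.exp (-(2 * nu * τ)) * Real.exp (nu * τ)) * g) := by
        ring
    _ = _ := by rw [h2]

set_option maxHeartbeats 1000000 in
/-- Along a path of moderate growth the integrand of the Ornstein–Uhlenbeck functional exists and has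
an integrable bound: part of the exponential decay pays for the growth of the increments. -/
theorem HasModerateGrowth.exists_isAhat {nu Om : ℝ} (hnu : 0 < nu) {e : HilbertBasis ℕ ℝ H}
    {lam : ℕ → ℝ} (heig : ∀ l, IsStokes (e l) (lam l • e l)) {w : PathSpace}
    (hw : HasModerateGrowth e lam w) {S : ℝ → X →L[ℝ] X} (hS : IsStokesCoriolisSemigroup nu Om S)
    (t : ℝ) : ∃ c : ℝ, ∀ r < t, ∃ f, IsAhat nu Om (S (t - r) (w.1 t - w.1 r)) f ∧
      ‖f‖ ≤ c * (Real.exp (-(nu * (t - r))) *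
        ((t - r) ^ (-(1 / 2) : ℝ) + (t - r) ^ (-(15 / 16) : ℝ))) := by
  obtain ⟨C, hC, hsm⟩ := exists_isAhat_semigroup hnu Om
  obtain ⟨K, hK, hinc⟩ := hw.sub heig
  obtain ⟨D, hD, hexp⟩ := one_add_pow_le_exp hnu
  refine ⟨C * √(K * (1 + |t|) ^ 5) * D, fun r hr => ?_⟩
  have hτ : 0 < t - r := sub_pos.2 hr
  obtain ⟨f, hf, hle⟩ := hsm _ hS (w.1 t - w.1 r) _ (hinc t r).1 (hinc t r).2 (t - r) hτ
  exact ⟨f, hf, hle.trans (decay_mul_growth_le hC hτ.le (by positivity) hK (hexp _ hτ.le))⟩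

set_option maxHeartbeats 1000000 in
/-- For a path of moderate growth the Ornstein–Uhlenbeck integral converges absolutely. -/
theorem HasModerateGrowth.ouWellDefined {nu Om : ℝ} (hnu : 0 < nu) {e : HilbertBasis ℕ ℝ H}
    {lam : ℕ → ℝ} (heig : ∀ l, IsStokes (e l) (lam l • e l)) {w : PathSpace}
    (hw : HasModerateGrowth e lam w) (hS : IsStokesCoriolisSemigroup nu Om (expNegAhat nu Om))
    (t : ℝ) : OUWellDefined nu Om w t := by
  obtain ⟨c, hc⟩ := hw.exists_isAhat hnu heig hS t
  choose! f hf hfc using hc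
  have hfeq : ∀ r < t, ouIntegrand nu Om w t r = f r := fun r hr => (hf r hr).ahat_eq
  refine ⟨fun r hr => ⟨f r, hf r hr⟩, integrableOn_iic_of_bound (c := c) hnu ?_ fun r hr => ?_⟩
  · refine hS.1.aestronglyMeasurable_generator w.2.stronglyMeasurable fun r hr => ?_
    refine (hS.2 _ _).1 ?_
    have h := hf r hr
    rw [← hfeq r hr, ← neg_neg (ouIntegrand nu Om w t r)] at h
    exact h
  · rw [hfeq r hr]
    exact hfc r hr

/-! ### The shift -/

theorem shift_sub_shift (w : PathSpace) (s t r : ℝ) :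
    (shift s w).1 t - (shift s w).1 r = w.1 (t + s) - w.1 (r + s) :=
  sub_sub_sub_cancel_right (w.1 (t + s)) (w.1 (r + s)) (w.1 s)

theorem semigroup_shift (S : ℝ → X →L[ℝ] X) (w : PathSpace) (s t r : ℝ) :
    S (t - r) ((shift s w).1 t - (shift s w).1 r)
      = S (t + s - (r + s)) (w.1 (t + s) - w.1 (r + s)) :=
  (congrArg (S (t - r)) (shift_sub_shift w s t r)).trans
    (congrArg (fun τ => S τ (w.1 (t + s) - w.1 (r + s))) (add_sub_add_right_eq_sub t r s).symm)

theorem ouIntegrand_shift (nu Om : ℝ) (w : PathSpace) (s t r : ℝ) :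
    ouIntegrand nu Om (shift s w) t r = ouIntegrand nu Om w (t + s) (r + s) :=
  congrArg (Ahat nu Om) (semigroup_shift (expNegAhat nu Om) w s t r)

theorem integrableOn_comp_add_right_Iic {E : Type*} [NormedAddCommGroup E] {F : ℝ → E} {s t : ℝ}
    (h : IntegrableOn F (Iic (t + s))) : IntegrableOn (fun r => F (r + s)) (Iic t) := by
  have hmp := measurePreserving_add_right (volume : Measure ℝ) s
  have h3 := (hmp.integrableOn_comp_preimage (MeasurableEquiv.addRight s).measurableEmbedding).2 h
  have hpre : (fun r : ℝ => r + s) ⁻¹' Iic (t + s) = Iic t := by ext r; simp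
  rwa [hpre] at h3

theorem setIntegral_comp_add_right_Iic {E : Type*} [NormedAddCommGroup E] [NormedSpace ℝ E]
    (F : ℝ → E) (s t : ℝ) : ∫ r in Iic t, F (r + s) = ∫ r in Iic (t + s), F r := by
  have hmp := measurePreserving_add_right (volume : Measure ℝ) s
  have h := hmp.setIntegral_preimage_emb (MeasurableEquiv.addRight s).measurableEmbedding
    F (Iic (t + s))
  have hpre : (fun r : ℝ => r + s) ⁻¹' Iic (t + s) = Iic t := by ext r; simp
  rwa [hpre] at h

theorem OUWellDefined.shift {nu Om : ℝ} {w : PathSpace} {s t : ℝ}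
    (h : OUWellDefined nu Om w (t + s)) : OUWellDefined nu Om (shift s w) t := by
  refine ⟨fun r hr => ?_, ?_⟩
  · have h1 := h.1 (r + s) (by linarith)
    rw [← semigroup_shift (expNegAhat nu Om) w s t r] at h1
    exact h1
  · have h3 := integrableOn_comp_add_right_Iic h.2
    have h4 : (fun r => ouIntegrand nu Om w (t + s) (r + s))
        = ouIntegrand nu Om (RotatingSphere.shift s w) t :=
      funext fun r => (ouIntegrand_shift nu Om w s t r).symm
    exact h4 ▸ h3

/-- The shift identity, which holds for every path: with the junk value `0` of a divergent integral,
both sides vanish together. -/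
theorem ouFunctional_shift (nu Om : ℝ) (w : PathSpace) (s t : ℝ) :
    ouFunctional nu Om (shift s w) t = ouFunctional nu Om w (t + s) := by
  have h4 : ouIntegrand nu Om (shift s w) t = fun r => ouIntegrand nu Om w (t + s) (r + s) :=
    funext fun r => ouIntegrand_shift nu Om w s t r
  rw [ouFunctional, ouFunctional, ← setIntegral_comp_add_right_Iic, h4]

/-! ### The maximal inequality for processes with independent increments -/

theorem measurable_finset_sum_of {W : Type*} (mW : MeasurableSpace W) {Z : ℕ → W → ℝ}
    (s : Finset ℕ) (h : ∀ i ∈ s, Measurable (Z i)) : Measurable fun w => ∑ i ∈ s, Z i w :=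
  Finset.measurable_sum s h

theorem measurableSet_first_passage {W : Type*} (mW : MeasurableSpace W) {S : ℕ → W → ℝ} {k : ℕ}
    (h : ∀ j ≤ k, Measurable (S j)) (a : ℝ) :
    MeasurableSet {w | a < |S k w| ∧ ∀ j < k, |S j w| ≤ a} := by
  have he : {w | a < |S k w| ∧ ∀ j < k, |S j w| ≤ a}
      = {w | a < |S k w|} ∩ ⋂ j, ⋂ (_ : j < k), {w | |S j w| ≤ a} := by
    ext w; simp
  rw [he]
  exact (measurableSet_lt measurable_const (h k le_rfl).abs).inter <| MeasurableSet.iInter fun j =>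
    MeasurableSet.iInter fun hj => measurableSet_le (h j hj.le).abs measurable_const

/-- Ottaviani's maximal inequality. -/
theorem measure_exists_sum_gt_le {W : Type*} [MeasurableSpace W] {P : Measure W}
    [IsProbabilityMeasure P] {Z : ℕ → W → ℝ} (hm : ∀ i, Measurable (Z i)) (hZ : iIndepFun Z P)
    {a : ℝ} {m : ℕ}
    (hsmall : ∀ k ≤ m, P {w | a < |∑ i ∈ Finset.Ico k m, Z i w|} ≤ 2⁻¹) :
    P {w | ∃ k ≤ m, 2 * a < |∑ i ∈ Finset.range k, Z i w|}
      ≤ 2 * P {w | a < |∑ i ∈ Finset.range m, Z i w|} := by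
  set S : ℕ → W → ℝ := fun k w => ∑ i ∈ Finset.range k, Z i w with hS
  -- `k` is the first index at which the partial sums exceed `2 a`
  set A : ℕ → Set W := fun k => {w | 2 * a < |S k w| ∧ ∀ j < k, |S j w| ≤ 2 * a} with hA
  set B : ℕ → Set W := fun k => {w | |∑ i ∈ Finset.Ico k m, Z i w| ≤ a} with hB
  have hSm : ∀ k, Measurable (S k) := fun k => Finset.measurable_sum _ fun i _ => hm i
  have hAm : ∀ k, MeasurableSet (A k) := fun k =>
    measurableSet_first_passage _ (fun j _ => hSm j) (2 * a)
  have hBm : ∀ k, MeasurableSet (B k) := fun k =>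
    measurableSet_le (Finset.measurable_sum _ fun i _ => hm i).abs measurable_const
  have hindep : ∀ k, P (A k ∩ B k) = P (A k) * P (B k) := fun k => by
    have hI := indep_iSup_of_disjoint (fun i => (hm i).comap_le) hZ
      (S := {i | i < k}) (T := {i | k ≤ i})
      (Set.disjoint_left.2 fun i (h1 : i < k) (h2 : k ≤ i) => absurd h1 (not_lt.2 h2))
    refine Indep_iff _ _ _ |>.1 hI _ _ ?_ ?_
    · have hS' : ∀ j ≤ k, Measurable[⨆ i ∈ {i | i < k}, MeasurableSpace.comap (Z i) inferInstance]
          (S j) := fun j hj => by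
        refine measurable_finset_sum_of _ _ fun i hi => ?_
        have hik : i ∈ {i | i < k} := lt_of_lt_of_le (Finset.mem_range.1 hi) hj
        exact Measurable.mono (comap_measurable (Z i))
          (le_iSup₂_of_le (f := fun i (_ : i ∈ {i | i < k}) =>
            MeasurableSpace.comap (Z i) inferInstance) i hik le_rfl) le_rfl
      exact measurableSet_first_passage _ hS' (2 * a)
    · have hT : Measurable[⨆ i ∈ {i | k ≤ i}, MeasurableSpace.comap (Z i) inferInstance]
          (fun w => ∑ i ∈ Finset.Ico k m, Z i w) := by
        refine measurable_finset_sum_of _ _ fun i hi => ?_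
        have hik : i ∈ {i | k ≤ i} := (Finset.mem_Ico.1 hi).1
        exact Measurable.mono (comap_measurable (Z i))
          (le_iSup₂_of_le (f := fun i (_ : i ∈ {i | k ≤ i}) =>
            MeasurableSpace.comap (Z i) inferInstance) i hik le_rfl) le_rfl
      exact hT (measurableSet_le measurable_id.abs measurable_const :
        MeasurableSet {x : ℝ | |x| ≤ a})
  have hdisj : Pairwise (fun i j => Disjoint (A i) (A j)) := by
    have h : ∀ i j, i < j → Disjoint (A i) (A j) := fun i j hij =>
      Set.disjoint_left.2 fun w hi hj => absurd hi.1 (not_lt.2 (hj.2 i hij))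
    intro i j hij
    rcases lt_or_gt_of_ne hij with h1 | h1
    · exact h i j h1
    · exact (h j i h1).symm
  have hsub : {w | ∃ k ≤ m, 2 * a < |S k w|} ⊆ ⋃ k ∈ Finset.range (m + 1), A k := by
    rintro w ⟨k, hk, hw⟩
    classical
    have hex : ∃ k, 2 * a < |S k w| := ⟨k, hw⟩
    refine mem_iUnion₂.2 ⟨Nat.find hex, Finset.mem_range.2 ?_, Nat.find_spec hex, fun j hj => ?_⟩
    · exact Nat.lt_succ_of_le ((Nat.find_min' hex hw).trans hk)
    · exact not_lt.1 (Nat.find_min hex hj)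
  have hhalf : ∀ k ∈ Finset.range (m + 1), P (A k) ≤ 2 * P (A k ∩ B k) := fun k hk => by
    have hc : (B k)ᶜ = {w | a < |∑ i ∈ Finset.Ico k m, Z i w|} := by ext w; simp [hB]
    have h1 : P (B k)ᶜ ≤ 2⁻¹ := hc ▸ hsmall k (Nat.lt_succ_iff.1 (Finset.mem_range.1 hk))
    have h2 : 2⁻¹ ≤ P (B k) := by
      have := prob_add_prob_compl (μ := P) (hBm k)
      by_contra h
      push Not at h
      have h3 := ENNReal.add_lt_add_of_lt_of_le (ne_top_of_le_ne_top (by simp) h1) h h1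
      rw [this, ENNReal.inv_two_add_inv_two] at h3
      exact lt_irrefl _ h3
    calc P (A k) = 2 * (P (A k) * 2⁻¹) := by
          rw [mul_comm (P (A k)), ← mul_assoc, ENNReal.mul_inv_cancel (by simp) (by simp), one_mul]
      _ ≤ 2 * P (A k ∩ B k) := by rw [hindep]; gcongr
  calc _ ≤ P (⋃ k ∈ Finset.range (m + 1), A k) := measure_mono hsub
    _ ≤ ∑ k ∈ Finset.range (m + 1), P (A k) := measure_biUnion_finset_le _ _
    _ ≤ ∑ k ∈ Finset.range (m + 1), 2 * P (A k ∩ B k) := Finset.sum_le_sum hhalf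
    _ = 2 * P (⋃ k ∈ Finset.range (m + 1), A k ∩ B k) := by
        rw [← Finset.mul_sum, measure_biUnion_finset]
        · exact fun i _ j _ hij => (hdisj hij).mono inter_subset_left inter_subset_left
        · exact fun k _ => (hAm k).inter (hBm k)
    _ ≤ _ := by
        gcongr
        refine iUnion₂_subset fun k hk w hw => ?_
        have h1 : S m w = S k w + ∑ i ∈ Finset.Ico k m, Z i w :=
          (Finset.sum_range_add_sum_Ico _ (Nat.lt_succ_iff.1 (Finset.mem_range.1 hk))).symm
        have h2 := hw.1.1
        have h3 : |∑ i ∈ Finset.Ico k m, Z i w| ≤ a := hw.2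
        have h4 : |S k w| ≤ |S m w| + |∑ i ∈ Finset.Ico k m, Z i w| := by
          have : S k w = S m w - ∑ i ∈ Finset.Ico k m, Z i w := by rw [h1]; ring
          rw [this]
          exact abs_sub _ _
        change a < |S m w|
        linarith

/-! ### Tails of stable processes -/

/-- The tail of an increment of a stable process, from the behavior of its characteristic function
near the origin. -/
theorem IsTwoSidedStable.measure_increment_gt_le {W : Type*} [MeasurableSpace W] {P : Measure W}
    [IsProbabilityMeasure P] {beta c : ℝ} {Y : ℝ → W → ℝ} (hY : IsTwoSidedStable beta c Y P)
    (hc : 0 ≤ c) (hb1 : 0 < beta) (hb2 : beta < 2) (hm : ∀ t, Measurable (Y t)) {s t a : ℝ}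
    (hst : s ≤ t) (ha : 0 < a) :
    P {w | a < |Y t w - Y s w|} ≤ ENNReal.ofReal (4 * (t - s) * c ^ beta * a ^ (-beta)) := by
  have hmeas : Measurable fun w => Y t w - Y s w := (hm t).sub (hm s)
  have : IsProbabilityMeasure (P.map fun w => Y t w - Y s w) :=
    Measure.isProbabilityMeasure_map hmeas.aemeasurable
  have h1 := measureReal_abs_gt_le_integral_charFun (μ := P.map fun w => Y t w - Y s w) ha
  have hcb : 0 ≤ c ^ beta := Real.rpow_nonneg hc _
  have h2 : ‖∫ θ in (-2 * a⁻¹)..(2 * a⁻¹), 1 - charFun (P.map fun w => Y t w - Y s w) θ‖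
      ≤ ((t - s) * c ^ beta * (2 * a⁻¹) ^ beta / 2) * |2 * a⁻¹ - -2 * a⁻¹| := by
    refine intervalIntegral.norm_integral_le_of_norm_le_const fun θ hθ => ?_
    have ha' : 0 < a⁻¹ := inv_pos.2 ha
    rw [uIoc_of_le (by linarith)] at hθ
    have hθ' : |θ| ≤ 2 * a⁻¹ := abs_le.2 ⟨by linarith [hθ.1], hθ.2⟩
    rw [hY.charFun_increment s t hst, ← Complex.ofReal_one, ← Complex.ofReal_sub,
      Complex.norm_real, Real.norm_eq_abs]
    have hx : 0 ≤ (t - s) * c ^ beta * |θ| ^ beta / 2 := by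
      have := sub_nonneg.2 hst
      positivity
    have hle : (t - s) * c ^ beta * |θ| ^ beta / 2 ≤ (t - s) * c ^ beta * (2 * a⁻¹) ^ beta / 2 := by
      have := sub_nonneg.2 hst
      gcongr
    have he1 := Real.add_one_le_exp (-((t - s) * c ^ beta * |θ| ^ beta / 2))
    have he2 := Real.exp_le_one_iff.2 (neg_nonpos.2 hx)
    rw [abs_of_nonneg (by linarith)]
    linarith
  have h3 : P {w | a < |Y t w - Y s w|}
      = ENNReal.ofReal ((P.map fun w => Y t w - Y s w).real {x | a < |x|}) := by
    have hset : MeasurableSet {x : ℝ | a < |x|} := measurableSet_lt measurable_const measurable_id.abs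
    rw [ofReal_measureReal, Measure.map_apply hmeas hset]
    rfl
  rw [h3]
  refine ENNReal.ofReal_le_ofReal (h1.trans ?_)
  have h4 : |2 * a⁻¹ - -2 * a⁻¹| = 4 * a⁻¹ := by rw [abs_of_nonneg (by ring_nf; positivity)]; ring
  have h5 : (2 * a⁻¹) ^ beta = 2 ^ beta * a ^ (-beta) := by
    rw [Real.mul_rpow (by norm_num) (by positivity), Real.inv_rpow ha.le, Real.rpow_neg ha.le]
  have h6 : (2 : ℝ) ^ beta ≤ 4 := by
    have := Real.rpow_le_rpow_of_exponent_le (by norm_num : (1 : ℝ) ≤ 2) hb2.le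
    norm_num at this
    exact this
  rw [h4, h5] at h2
  have h0 := sub_nonneg.2 hst
  calc _ ≤ 2⁻¹ * a * ((t - s) * c ^ beta * (2 ^ beta * a ^ (-beta)) / 2 * (4 * a⁻¹)) := by gcongr
    _ = 2 ^ beta * ((t - s) * c ^ beta * a ^ (-beta)) := by field_simp; ring
    _ ≤ 4 * ((t - s) * c ^ beta * a ^ (-beta)) := by gcongr
    _ = _ := by ring

/-- The `i`-th point of the dyadic grid of level `k` in `[u, u + T]`. -/
def gridPt (u T : ℝ) (k i : ℕ) : ℝ := u + i * (T / 2 ^ k)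

/-- The supremum of the distance of a process from its initial value over the dyadic points of
`[u, u + T]`. -/
def gridSup {W : Type*} (Y : ℝ → W → ℝ) (u T : ℝ) (w : W) : ℝ≥0∞ :=
  ⨆ (k : ℕ) (i : ℕ) (_ : i ≤ 2 ^ k), ENNReal.ofReal |Y (gridPt u T k i) w - Y u w|

theorem measurable_gridSup {W : Type*} [MeasurableSpace W] {Y : ℝ → W → ℝ}
    (hm : ∀ t, Measurable (Y t)) (u T : ℝ) : Measurable (gridSup Y u T) :=
  Measurable.iSup fun _ => Measurable.iSup fun _ => Measurable.iSup fun _ =>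
    ((hm _).sub (hm u)).abs.ennreal_ofReal

/-- For a right-continuous path the dyadic points determine the supremum. -/
theorem le_gridSup {W : Type*} {Y : ℝ → W → ℝ} {u T t : ℝ} {w : W} (hT : 0 < T)
    (hY : ∀ t, ContinuousWithinAt (fun t => Y t w) (Ici t) t) (ht : t ∈ Icc u (u + T)) :
    ENNReal.ofReal |Y t w - Y u w| ≤ gridSup Y u T w := by
  have hgrid : ∀ k i : ℕ, i ≤ 2 ^ k →
      ENNReal.ofReal |Y (gridPt u T k i) w - Y u w| ≤ gridSup Y u T w := fun k i hi =>
    le_iSup_of_le k (le_iSup₂_of_le (f := fun (i : ℕ) (_ : i ≤ 2 ^ k) =>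
      ENNReal.ofReal |Y (gridPt u T k i) w - Y u w|) i hi le_rfl)
  rcases eq_or_lt_of_le ht.2 with rfl | hlt
  · have := hgrid 0 1 (by norm_num)
    simpa [gridPt] using this
  set j : ℕ → ℕ := fun k => ⌊(t - u) * 2 ^ k / T⌋₊ + 1 with hj
  have h0 : 0 ≤ t - u := sub_nonneg.2 ht.1
  have hjle : ∀ k, j k ≤ 2 ^ k := fun k => by
    refine Nat.succ_le_of_lt ((Nat.floor_lt (by positivity)).2 ?_)
    push_cast
    rw [div_lt_iff₀ hT, mul_comm]
    exact mul_lt_mul_of_pos_left (by linarith) (by positivity)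
  have hlow : ∀ k, t ≤ gridPt u T k (j k) := fun k => by
    have h1 := Nat.lt_floor_add_one ((t - u) * 2 ^ k / T)
    rw [div_lt_iff₀ hT] at h1
    simp only [gridPt, hj]
    push_cast
    rw [← sub_le_iff_le_add', mul_div_assoc', le_div_iff₀ (by positivity)]
    exact h1.le
  have hup : ∀ k, gridPt u T k (j k) ≤ t + T * (1 / 2) ^ k := fun k => by
    have h1 := Nat.floor_le (by positivity : 0 ≤ (t - u) * 2 ^ k / T)
    rw [le_div_iff₀ hT] at h1
    simp only [gridPt, hj]
    push_cast
    have h2 : ((⌊(t - u) * 2 ^ k / T⌋₊ : ℝ) + 1) * (T / 2 ^ k)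
        = ((⌊(t - u) * 2 ^ k / T⌋₊ : ℝ) * T) / 2 ^ k + T * (1 / 2) ^ k := by
      rw [one_div, inv_pow]; field_simp
    have h3 : ((⌊(t - u) * 2 ^ k / T⌋₊ : ℝ) * T) / 2 ^ k ≤ t - u := by
      rwa [div_le_iff₀ (by positivity)]
    linarith
  have hlim : Tendsto (fun k => gridPt u T k (j k)) atTop (𝓝[≥] t) := by
    refine tendsto_nhdsWithin_iff.2 ⟨?_, Eventually.of_forall hlow⟩
    refine tendsto_of_tendsto_of_tendsto_of_le_of_le tendsto_const_nhds ?_ hlow hup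
    have := (tendsto_pow_atTop_nhds_zero_of_lt_one (by norm_num : (0 : ℝ) ≤ 1 / 2)
      (by norm_num)).const_mul T |>.const_add t
    simpa using this
  refine le_of_tendsto (f := fun k => ENNReal.ofReal |Y (gridPt u T k (j k)) w - Y u w|)
    (x := atTop) ?_ (Eventually.of_forall fun k => hgrid k _ (hjle k))
  exact (ENNReal.continuous_ofReal.tendsto _).comp
    ((((hY t).tendsto.comp hlim).sub_const (Y u w)).abs)

theorem gridPt_mono {u T : ℝ} (hT : 0 ≤ T) (k : ℕ) : Monotone (gridPt u T k) := fun i j h => by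
  unfold gridPt
  have : (i : ℝ) ≤ j := by exact_mod_cast h
  gcongr

/-- The tail of the running supremum of a stable process has the order of the tail of its
increments. -/
theorem IsTwoSidedStable.measure_gridSup_gt_le {W : Type*} [MeasurableSpace W] {P : Measure W}
    [IsProbabilityMeasure P] {beta c : ℝ} {Y : ℝ → W → ℝ} (hY : IsTwoSidedStable beta c Y P)
    (hc : 0 ≤ c) (hb1 : 0 < beta) (hb2 : beta < 2) (hm : ∀ t, Measurable (Y t)) (u : ℝ) {T a : ℝ}
    (hT : 0 ≤ T) (ha : 0 < a) :
    P {w | ENNReal.ofReal (2 * a) < gridSup Y u T w}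
      ≤ 2 * ENNReal.ofReal (4 * T * c ^ beta * a ^ (-beta)) := by
  set δ := ENNReal.ofReal (4 * T * c ^ beta * a ^ (-beta)) with hδ
  rcases lt_or_ge 2⁻¹ δ with hbig | hsmall
  · calc _ ≤ (1 : ℝ≥0∞) := prob_le_one
      _ = 2 * 2⁻¹ := (ENNReal.mul_inv_cancel (by simp) (by simp)).symm
      _ ≤ 2 * δ := by gcongr
  set E : ℕ → Set W := fun k => {w | ∃ i ≤ 2 ^ k, 2 * a < |Y (gridPt u T k i) w - Y u w|} with hE
  have hsub : {w | ENNReal.ofReal (2 * a) < gridSup Y u T w} ⊆ ⋃ k, E k := by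
    intro w hw
    simp only [gridSup, mem_ofPred_eq, lt_iSup_iff] at hw
    obtain ⟨k, i, hi, h⟩ := hw
    exact mem_iUnion.2 ⟨k, i, hi, (ENNReal.ofReal_lt_ofReal_iff_of_nonneg (by positivity)).1 h⟩
  have hmono : Monotone E := monotone_nat_of_le_succ fun k w ⟨i, hi, h⟩ => by
    refine ⟨2 * i, by rw [pow_succ]; omega, ?_⟩
    have : gridPt u T (k + 1) (2 * i) = gridPt u T k i := by
      unfold gridPt; push_cast; rw [pow_succ]; field_simp
    rw [this]
    exact h
  have hk : ∀ k, P (E k) ≤ 2 * δ := fun k => by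
    have hind := hY.indep.nat (gridPt_mono (u := u) hT k)
    have htel : ∀ p q, p ≤ q → ∀ w, ∑ i ∈ Finset.Ico p q,
        (Y (gridPt u T k (i + 1)) w - Y (gridPt u T k i) w)
        = Y (gridPt u T k q) w - Y (gridPt u T k p) w := fun p q hpq w =>
      Finset.sum_Ico_sub (fun i => Y (gridPt u T k i) w) hpq
    have htel0 : ∀ q w, ∑ i ∈ Finset.range q,
        (Y (gridPt u T k (i + 1)) w - Y (gridPt u T k i) w)
        = Y (gridPt u T k q) w - Y u w := fun q w => by
      rw [Finset.sum_range_sub (fun i => Y (gridPt u T k i) w)]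
      simp [gridPt]
    have hinc : ∀ p ≤ 2 ^ k, P {w | a < |Y (gridPt u T k (2 ^ k)) w - Y (gridPt u T k p) w|} ≤ δ := by
      intro p hp
      refine (hY.measure_increment_gt_le hc hb1 hb2 hm (gridPt_mono hT k hp) ha).trans
        (ENNReal.ofReal_le_ofReal ?_)
      have hcb : 0 ≤ c ^ beta := Real.rpow_nonneg hc _
      have hle : gridPt u T k (2 ^ k) - gridPt u T k p ≤ T := by
        have : gridPt u T k (2 ^ k) = u + T := by unfold gridPt; push_cast; field_simp
        rw [this]
        have : 0 ≤ (p : ℝ) * (T / 2 ^ k) := by positivity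
        unfold gridPt
        linarith
      gcongr
    have hott := measure_exists_sum_gt_le
      (Z := fun i w => Y (gridPt u T k (i + 1)) w - Y (gridPt u T k i) w) (fun i => (hm _).sub (hm _)) hind (a := a) (m := 2 ^ k)
      (fun p hp => by
        have h1 := (hinc p hp).trans hsmall
        have h2 : {w | a < |∑ i ∈ Finset.Ico p (2 ^ k),
            (Y (gridPt u T k (i + 1)) w - Y (gridPt u T k i) w)|}
            = {w | a < |Y (gridPt u T k (2 ^ k)) w - Y (gridPt u T k p) w|} := by
          ext w; simp only [mem_ofPred_eq, htel p _ hp]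
        exact h2 ▸ h1)
    simp only [htel0] at hott
    refine hott.trans ?_
    have := hinc 0 (Nat.zero_le _)
    have h0 : gridPt u T k 0 = u := by simp [gridPt]
    rw [h0] at this
    gcongr
  calc _ ≤ P (⋃ k, E k) := measure_mono hsub
    _ = ⨆ k, P (E k) := hmono.measure_iUnion
    _ ≤ 2 * δ := iSup_le hk

/-! ### Sums of squares of variables with heavy tails -/

/-- A variable with tails of order `a ^ (-β)`, `β < 2`, has a truncated second moment of the order of
the constant in front of the tail. -/
theorem lintegral_min_sq_le {W : Type*} [MeasurableSpace W] {P : Measure W} {beta : ℝ}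
    (hb : beta < 2) {ξ : W → ℝ≥0∞} (hm : Measurable ξ) {κ : ℝ≥0∞}
    (ht : ∀ a : ℝ, 0 < a → P {w | ENNReal.ofReal a < ξ w} ≤ κ * ENNReal.ofReal (a ^ (-beta))) :
    ∫⁻ w, min (ξ w) 1 ^ 2 ∂P ≤ ENNReal.ofReal (2 / (2 - beta)) * κ := by
  set f : W → ℝ := fun w => (min (ξ w) 1).toReal with hf
  have hne : ∀ w, min (ξ w) 1 ≠ ⊤ := fun w => ne_top_of_le_ne_top ENNReal.one_ne_top (min_le_right _ _)
  have hfm : Measurable f := (hm.min measurable_const).ennreal_toReal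
  have h1 := lintegral_rpow_eq_lintegral_meas_lt_mul P (f := f)
    (Eventually.of_forall fun w => ENNReal.toReal_nonneg) hfm.aemeasurable (p := 2) two_pos
  have h2 : ∀ w, ENNReal.ofReal (f w ^ (2 : ℝ)) = min (ξ w) 1 ^ 2 := fun w => by
    rw [← ENNReal.ofReal_rpow_of_nonneg ENNReal.toReal_nonneg two_pos.le,
      ENNReal.ofReal_toReal (hne w), ENNReal.rpow_ofNat]
  simp only [h2] at h1
  rw [h1]
  have h3 : ∀ t ∈ Ioi (0 : ℝ), P {w | t < f w} * ENNReal.ofReal (t ^ ((2 : ℝ) - 1))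
      ≤ (Ioc (0 : ℝ) 1).indicator (fun t => κ * ENNReal.ofReal (t ^ (1 - beta))) t := by
    intro t (ht0 : 0 < t)
    by_cases ht1 : t < 1
    · rw [indicator_of_mem (show t ∈ Ioc (0 : ℝ) 1 from ⟨ht0, ht1.le⟩)]
      have hsub : {w | t < f w} ⊆ {w | ENNReal.ofReal t < ξ w} := fun w hw =>
        ((ENNReal.ofReal_lt_iff_lt_toReal ht0.le (hne w)).2 hw).trans_le (min_le_left _ _)
      calc _ ≤ κ * ENNReal.ofReal (t ^ (-beta)) * ENNReal.ofReal (t ^ ((2 : ℝ) - 1)) := by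
            gcongr
            exact (measure_mono hsub).trans (ht t ht0)
        _ = κ * ENNReal.ofReal (t ^ (1 - beta)) := by
            rw [mul_assoc, ← ENNReal.ofReal_mul (by positivity), ← Real.rpow_add ht0]
            ring_nf
    · have : {w | t < f w} = ∅ := by
        refine eq_empty_of_forall_notMem fun w (hw : t < f w) => ht1 (hw.trans_le ?_)
        exact ENNReal.toReal_le_of_le_ofReal zero_le_one (by simp)
      rw [this, measure_empty, zero_mul]
      exact zero_le
  calc _ ≤ ENNReal.ofReal 2 * ∫⁻ t in Ioi 0,
        (Ioc (0 : ℝ) 1).indicator (fun t => κ * ENNReal.ofReal (t ^ (1 - beta))) t := by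
        gcongr ENNReal.ofReal 2 * ?_
        exact setLIntegral_mono' measurableSet_Ioi h3
    _ ≤ ENNReal.ofReal 2 * ∫⁻ t in Ioc (0 : ℝ) 1, κ * ENNReal.ofReal (t ^ (1 - beta)) := by
        gcongr ENNReal.ofReal 2 * ?_
        rw [← lintegral_indicator measurableSet_Ioc]
        exact setLIntegral_le_lintegral _ _
    _ = ENNReal.ofReal 2 * (κ * ENNReal.ofReal (1 / (2 - beta))) := by
        rw [lintegral_const_mul _ (by fun_prop)]
        congr 2
        have hint : IntervalIntegrable (fun t : ℝ => t ^ (1 - beta)) volume 0 1 :=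
          intervalIntegral.intervalIntegrable_rpow' (by linarith)
        rw [← ofReal_integral_eq_lintegral_ofReal
          ((intervalIntegrable_iff_integrableOn_Ioc_of_le zero_le_one).1 hint) ?_,
          ← intervalIntegral.integral_of_le zero_le_one, integral_rpow (Or.inl (by linarith))]
        · rw [Real.one_rpow, Real.zero_rpow (by linarith)]
          congr 1
          ring
        · filter_upwards [self_mem_ae_restrict measurableSet_Ioc] with t ht'
          exact Real.rpow_nonneg ht'.1.le _
    _ = _ := by
        rw [mul_left_comm, ← ENNReal.ofReal_mul zero_le_two, mul_comm κ]
        congr 2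
        ring

/-- Without any independence, the sum of the squares of variables with tails `κₗ a ^ (-β)`, `β < 2`,
is large only with a probability of order `∑ κₗ`. -/
theorem measure_tsum_sq_gt_le {W : Type*} [MeasurableSpace W] {P : Measure W} {beta : ℝ}
    (hb : beta < 2) {ξ : ℕ → W → ℝ≥0∞} (hm : ∀ l, Measurable (ξ l)) {κ : ℕ → ℝ≥0∞}
    (ht : ∀ l, ∀ a : ℝ, 0 < a →
      P {w | ENNReal.ofReal a < ξ l w} ≤ κ l * ENNReal.ofReal (a ^ (-beta))) :
    P {w | 1 < ∑' l, ξ l w ^ 2} ≤ (1 + ENNReal.ofReal (2 / (2 - beta))) * ∑' l, κ l := by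
  have hsub : {w | 1 < ∑' l, ξ l w ^ 2}
      ⊆ (⋃ l, {w | 1 < ξ l w}) ∪ {w | 1 ≤ ∑' l, min (ξ l w) 1 ^ 2} := by
    intro w (hw : 1 < ∑' l, ξ l w ^ 2)
    by_cases h : ∃ l, 1 < ξ l w
    · exact Or.inl (mem_iUnion.2 h)
    · push Not at h
      refine Or.inr ?_
      simp only [mem_ofPred_eq, min_eq_left (h _)]
      exact hw.le
  have h1 : P (⋃ l, {w | 1 < ξ l w}) ≤ ∑' l, κ l := by
    refine (measure_iUnion_le _).trans (ENNReal.tsum_le_tsum fun l => ?_)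
    simpa using ht l 1 one_pos
  have h2 : P {w | 1 ≤ ∑' l, min (ξ l w) 1 ^ 2} ≤ ENNReal.ofReal (2 / (2 - beta)) * ∑' l, κ l := by
    have hmin : ∀ l, Measurable fun w => min (ξ l w) 1 ^ 2 := fun l =>
      ((hm l).min measurable_const).pow_const 2
    have hsm : Measurable fun w => ∑' l, min (ξ l w) 1 ^ 2 := Measurable.tsum hmin
    have := mul_meas_ge_le_lintegral (μ := P) hsm 1
    rw [one_mul] at this
    refine this.trans ?_
    rw [lintegral_tsum fun l => (hmin l).aemeasurable, ← ENNReal.tsum_mul_left]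
    exact ENNReal.tsum_le_tsum fun l => lintegral_min_sq_le hb (hm l) (ht l)
  calc _ ≤ P (⋃ l, {w | 1 < ξ l w}) + P {w | 1 ≤ ∑' l, min (ξ l w) 1 ^ 2} :=
        (measure_mono hsub).trans (measure_union_le _ _)
    _ ≤ _ := by rw [add_mul, one_mul]; exact add_le_add h1 h2

/-! ### Growth of the sample paths -/

theorem measurable_borel_of_continuous {E : Type*} [TopologicalSpace E] {f : E → ℝ}
    (hf : Continuous f) : Measurable[borel E] f := by
  borelize E
  exact hf.measurable

theorem measurable_coord (e : HilbertBasis ℕ ℝ H) (l : ℕ) (t : ℝ) : Measurable (coord e l t) := by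
  have h1 : Measurable[_, borel X] fun w : PathSpace => w.1 t := by
    refine Measurable.of_comap_le ?_
    exact le_iSup (fun t : ℝ => (borel X).comap (fun w : PathSpace => w.1 t)) t
  have h2 : Measurable[borel X] fun x : X => ⟪toH x, e l⟫_ℝ := by
    have hc : Continuous fun x : X => ⟪toH x, e l⟫_ℝ := toHL.continuous.inner continuous_const
    exact measurable_borel_of_continuous hc
  exact @Measurable.comp _ _ _ _ (borel X) _ _ _ h2 h1

theorem continuousWithinAt_coord (e : HilbertBasis ℕ ℝ H) (l : ℕ) (w : PathSpace) (t : ℝ) :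
    ContinuousWithinAt (fun t => coord e l t w) (Ici t) t :=
  ((toHL.continuous.inner continuous_const :
    Continuous fun x : X => ⟪toHL x, e l⟫_ℝ).continuousAt).comp_continuousWithinAt (w.2 t).1

/-- The weighted running supremum of the `l`-th coordinate over `[-n, n]`, divided by `n²`. -/
def scaledSup (e : HilbertBasis ℕ ℝ H) (lam : ℕ → ℝ) (n l : ℕ) (w : PathSpace) : ℝ≥0∞ :=
  ENNReal.ofReal (√(lam l) / n ^ 2) * gridSup (coord e l) (-n) (2 * n) w

theorem measure_scaledSup_gt_le {beta : ℝ} (hb1 : 0 < beta) (hb2 : beta < 2)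
    {e : HilbertBasis ℕ ℝ H} {lam sigma : ℕ → ℝ} {P : Measure PathSpace} [IsProbabilityMeasure P]
    {l : ℕ} (hst : IsTwoSidedStable beta |sigma l| (coord e l) P) {n : ℕ} (hn : 0 < n) {a : ℝ}
    (ha : 0 < a) :
    P {w | ENNReal.ofReal a < scaledSup e lam n l w}
      ≤ ENNReal.ofReal (64 * n ^ (1 - 2 * beta) * (|sigma l| ^ beta * lam l ^ (beta / 2)))
        * ENNReal.ofReal (a ^ (-beta)) := by
  have hn' : (0 : ℝ) < n := by exact_mod_cast hn
  rcases le_or_gt (lam l) 0 with hl | hl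
  · have : {w | ENNReal.ofReal a < scaledSup e lam n l w} = ∅ := by
      refine eq_empty_of_forall_notMem fun w hw => ?_
      simp [scaledSup, Real.sqrt_eq_zero_of_nonpos hl] at hw
    rw [this, measure_empty]
    exact zero_le
  have hs : 0 < √(lam l) := Real.sqrt_pos.2 hl
  set b := a * n ^ 2 / √(lam l) with hb
  have hb0 : 0 < b := by positivity
  have hset : {w | ENNReal.ofReal a < scaledSup e lam n l w}
      ⊆ {w | ENNReal.ofReal (2 * (b / 2)) < gridSup (coord e l) (-n) (2 * n) w} := by
    intro w (hw : ENNReal.ofReal a < scaledSup e lam n l w)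
    by_contra h
    have e1 : 2 * (b / 2) = b := by ring
    rw [mem_ofPred_eq, not_lt, e1] at h
    refine not_lt.2 ?_ hw
    calc scaledSup e lam n l w ≤ ENNReal.ofReal (√(lam l) / n ^ 2) * ENNReal.ofReal b := by
          unfold scaledSup; gcongr
      _ = ENNReal.ofReal a := by
          rw [← ENNReal.ofReal_mul (by positivity)]
          congr 1
          rw [hb]; field_simp
  refine (measure_mono hset).trans ((hst.measure_gridSup_gt_le (abs_nonneg _) hb1 hb2
    (measurable_coord e l) (-n) (by positivity) (by positivity)).trans ?_)
  have hsb : 0 ≤ |sigma l| ^ beta := Real.rpow_nonneg (abs_nonneg _) _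
  have h2 : (2 : ℝ≥0∞) = ENNReal.ofReal 2 := by simp
  rw [h2, ← ENNReal.ofReal_mul zero_le_two, ← ENNReal.ofReal_mul (by positivity)]
  refine ENNReal.ofReal_le_ofReal ?_
  have h3 : (b / 2) ^ (-beta) = 2 ^ beta * (a ^ (-beta) * (n : ℝ) ^ (-(2 * beta)) * lam l ^ (beta / 2)) := by
    have e1 : b / 2 = 2⁻¹ * (a * ((n : ℝ) ^ (2 : ℝ)) * lam l ^ (-(1 / 2) : ℝ)) := by
      rw [hb, Real.sqrt_eq_rpow, Real.rpow_neg hl.le, Real.rpow_two]; ring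
    rw [e1, Real.mul_rpow (by norm_num) (by positivity), Real.mul_rpow (by positivity) (by positivity),
      Real.mul_rpow ha.le (by positivity), ← Real.rpow_mul hn'.le, ← Real.rpow_mul hl.le,
      Real.inv_rpow zero_le_two, Real.rpow_neg zero_le_two, inv_inv]
    ring_nf
  have h4 : (2 : ℝ) ^ beta ≤ 4 := by
    have := Real.rpow_le_rpow_of_exponent_le (by norm_num : (1 : ℝ) ≤ 2) hb2.le
    norm_num at this
    exact this
  have h5 : (n : ℝ) ^ (1 - 2 * beta) = n * (n : ℝ) ^ (-(2 * beta)) := by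
    rw [sub_eq_add_neg, Real.rpow_add hn', Real.rpow_one]
  rw [h3, h5]
  have h6 : 0 ≤ n * (n : ℝ) ^ (-(2 * beta)) * (|sigma l| ^ beta * lam l ^ (beta / 2)) * a ^ (-beta) := by
    positivity
  calc _ = 16 * 2 ^ beta * (n * (n : ℝ) ^ (-(2 * beta)) * (|sigma l| ^ beta * lam l ^ (beta / 2))
        * a ^ (-beta)) := by ring
    _ ≤ 16 * 4 * (n * (n : ℝ) ^ (-(2 * beta)) * (|sigma l| ^ beta * lam l ^ (beta / 2))
        * a ^ (-beta)) := by gcongr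
    _ = _ := by ring

/-- Almost surely the weighted squares of the running suprema over `[-n, n]` have a sum of at most
`n⁴` for all large `n`. -/
theorem ae_eventually_tsum_scaledSup_le {beta : ℝ} (hb1 : 1 < beta) (hb2 : beta < 2)
    {e : HilbertBasis ℕ ℝ H} {lam sigma : ℕ → ℝ} (hpos : ∀ l, sigma l ≠ 0 → 0 < lam l)
    (hsum : Summable (fun l => |sigma l| ^ beta * lam l ^ (beta / 2)))
    {P : Measure PathSpace} [IsProbabilityMeasure P] (hP : IsNoiseLaw beta e sigma P) :
    ∀ᵐ w ∂P, ∀ᶠ n : ℕ in atTop, ∑' l, scaledSup e lam n l w ^ 2 ≤ 1 := by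
  have hnn : ∀ l, 0 ≤ |sigma l| ^ beta * lam l ^ (beta / 2) := fun l => by
    by_cases h : sigma l = 0
    · rw [h, abs_zero, Real.zero_rpow (by linarith), zero_mul]
    · have := hpos l h; positivity
  set B := ∑' l, |sigma l| ^ beta * lam l ^ (beta / 2) with hB
  set C := (1 + ENNReal.ofReal (2 / (2 - beta))) with hC
  have hbound : ∀ n : ℕ, P {w | 1 < ∑' l, scaledSup e lam (n + 1) l w ^ 2}
      ≤ C * ENNReal.ofReal (64 * B * ((n + 1 : ℕ) : ℝ) ^ (1 - 2 * beta)) := fun n => by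
    refine (measure_tsum_sq_gt_le hb2 (fun l => (measurable_gridSup (measurable_coord e l) _ _).const_mul _)
      fun l a ha => measure_scaledSup_gt_le (by linarith) hb2 (hP.stable l) n.succ_pos ha).trans ?_
    gcongr
    rw [← ENNReal.ofReal_tsum_of_nonneg (fun l => mul_nonneg (by positivity) (hnn l))
      (hsum.mul_left _), tsum_mul_left]
    refine ENNReal.ofReal_le_ofReal (le_of_eq ?_)
    rw [← hB]; ring
  have hS : Summable fun n : ℕ => 64 * B * ((n + 1 : ℕ) : ℝ) ^ (1 - 2 * beta) :=
    ((summable_nat_add_iff 1).2 (Real.summable_nat_rpow.2 (by linarith : 1 - 2 * beta < -1))).mul_left _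
  have hfin : ∑' n : ℕ, P {w | 1 < ∑' l, scaledSup e lam (n + 1) l w ^ 2} ≠ ⊤ := by
    refine ne_top_of_le_ne_top ?_ (ENNReal.tsum_le_tsum hbound)
    rw [ENNReal.tsum_mul_left]
    exact ENNReal.mul_ne_top (by simp [hC]) hS.tsum_ofReal_ne_top
  filter_upwards [ae_eventually_notMem hfin] with w hw
  rw [← map_add_atTop_eq_nat 1, eventually_map]
  filter_upwards [hw] with n hn
  exact not_lt.1 hn

/-- A coordinate with `σₗ = 0` vanishes identically. -/
theorem ae_coord_eq_zero {beta : ℝ} (hb1 : 1 < beta) (hb2 : beta < 2) {e : HilbertBasis ℕ ℝ H}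
    {sigma : ℕ → ℝ} {P : Measure PathSpace} [IsProbabilityMeasure P] {l : ℕ}
    (hst : IsTwoSidedStable beta |sigma l| (coord e l) P) (hl : sigma l = 0) :
    ∀ᵐ w ∂P, ∀ t, coord e l t w = 0 := by
  have h0 : ∀ᵐ w ∂P, ∀ n k : ℕ,
      ¬ ENNReal.ofReal (2 * (1 / ((k : ℝ) + 1))) < gridSup (coord e l) (-n) (2 * n) w := by
    refine ae_all_iff.2 fun n => ae_all_iff.2 fun k => measure_mono_null (t := _) ?_
      (le_antisymm ((hst.measure_gridSup_gt_le (abs_nonneg _) (by linarith) hb2 (measurable_coord e l)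
        (-n) (T := 2 * n) (a := 1 / ((k : ℝ) + 1)) (by positivity) (by positivity)).trans
        (le_of_eq ?_)) zero_le)
    · intro w hw
      simpa using hw
    · rw [hl, abs_zero, Real.zero_rpow (by linarith)]
      simp
  filter_upwards [h0, hst.zero] with w hw hw0 t
  have hz : ∀ n : ℕ, gridSup (coord e l) (-n) (2 * n) w = 0 := fun n => by
    have hlim : Tendsto (fun k : ℕ => ENNReal.ofReal (2 * (1 / ((k : ℝ) + 1)))) atTop (𝓝 0) := by
      have := (ENNReal.continuous_ofReal.tendsto _).comp
        ((tendsto_one_div_add_atTop_nhds_zero_nat (𝕜 := ℝ)).const_mul 2)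
      simpa [Function.comp_def] using this
    exact le_antisymm (ge_of_tendsto hlim (Eventually.of_forall fun k => not_lt.1 (hw n k))) zero_le
  obtain ⟨n, hn⟩ := exists_nat_gt |t|
  have hn0 : (0 : ℝ) < n := (abs_nonneg t).trans_lt hn
  have key : ∀ s ∈ Icc (-(n : ℝ)) n, coord e l s w = coord e l (-n) w := fun s hs => by
    have := le_gridSup (T := 2 * n) (by positivity) (continuousWithinAt_coord e l w)
      (t := s) (u := -n) ⟨hs.1, by linarith [hs.2]⟩
    rw [hz, nonpos_iff_eq_zero, ENNReal.ofReal_eq_zero] at this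
    exact sub_eq_zero.1 (abs_nonpos_iff.1 this)
  rw [key t (abs_le.1 hn.le), ← key 0 ⟨by linarith, hn0.le⟩, hw0]

/-- The coordinates over `[-n, n]` are controlled by the running suprema. -/
theorem coord_sq_le {e : HilbertBasis ℕ ℝ H} {lam : ℕ → ℝ} {w : PathSpace} {l n : ℕ} (hn : 0 < n)
    (hw0 : coord e l 0 w = 0) {t : ℝ} (ht : |t| ≤ n) :
    ENNReal.ofReal (lam l * coord e l t w ^ 2)
      ≤ ENNReal.ofReal (4 * n ^ 4) * scaledSup e lam n l w ^ 2 := by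
  have hn' : (0 : ℝ) < n := by exact_mod_cast hn
  rcases le_or_gt (lam l) 0 with hl | hl
  · rw [ENNReal.ofReal_of_nonpos (mul_nonpos_of_nonpos_of_nonneg hl (sq_nonneg _))]
    exact zero_le
  have key : ∀ s ∈ Icc (-(n : ℝ)) n, ENNReal.ofReal |coord e l s w - coord e l (-n) w|
      ≤ gridSup (coord e l) (-n) (2 * n) w := fun s hs =>
    le_gridSup (T := 2 * n) (by positivity) (continuousWithinAt_coord e l w)
      (t := s) (u := -n) ⟨hs.1, by linarith [hs.2]⟩
  have h1 := key t (abs_le.1 ht)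
  have h2 := key 0 ⟨by linarith, hn'.le⟩
  have h3 : |coord e l t w| ≤ |coord e l t w - coord e l (-n) w| + |coord e l 0 w - coord e l (-n) w| := by
    have : coord e l t w = (coord e l t w - coord e l (-n) w) - (coord e l 0 w - coord e l (-n) w) := by
      rw [hw0]; ring
    calc _ = |(coord e l t w - coord e l (-n) w) - (coord e l 0 w - coord e l (-n) w)| := by rw [← this]
      _ ≤ _ := abs_sub _ _
  have h4 : ENNReal.ofReal |coord e l t w| ≤ 2 * gridSup (coord e l) (-n) (2 * n) w := by
    refine (ENNReal.ofReal_le_ofReal h3).trans (ENNReal.ofReal_add_le.trans ?_)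
    rw [two_mul]
    exact add_le_add h1 h2
  have h5 : lam l * coord e l t w ^ 2 = n ^ 4 * (√(lam l) / n ^ 2 * |coord e l t w|) ^ 2 := by
    rw [mul_pow, div_pow, Real.sq_sqrt hl.le, sq_abs]; field_simp
  have h6 : (4 : ℝ≥0∞) = ENNReal.ofReal 4 := by simp
  rw [h5, ENNReal.ofReal_mul (by positivity), ENNReal.ofReal_pow (p := √(lam l) / _ * _) (by positivity),
    ENNReal.ofReal_mul (by positivity), ENNReal.ofReal_mul (by norm_num : (0 : ℝ) ≤ 4), ← h6]
  calc _ ≤ ENNReal.ofReal (n ^ 4) * (ENNReal.ofReal (√(lam l) / n ^ 2)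
        * (2 * gridSup (coord e l) (-n) (2 * n) w)) ^ 2 := by gcongr
    _ = _ := by unfold scaledSup; ring

/-- Almost every path of the noise has moderate growth: for large `n` the weighted sum of squares over
`[-n, n]` is at most `4 n⁴`. -/
theorem ae_hasModerateGrowth {beta : ℝ} (hb1 : 1 < beta) (hb2 : beta < 2)
    {e : HilbertBasis ℕ ℝ H} {lam sigma : ℕ → ℝ} (hpos : ∀ l, sigma l ≠ 0 → 0 < lam l)
    (hsum : Summable (fun l => |sigma l| ^ beta * lam l ^ (beta / 2)))
    {P : Measure PathSpace} [IsProbabilityMeasure P] (hP : IsNoiseLaw beta e sigma P) :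
    ∀ᵐ w ∂P, HasModerateGrowth e lam w := by
  have h1 : ∀ᵐ w ∂P, ∀ l, sigma l = 0 → ∀ t, coord e l t w = 0 := ae_all_iff.2 fun l => by
    by_cases hl : sigma l = 0
    · filter_upwards [ae_coord_eq_zero hb1 hb2 (hP.stable l) hl] with w hw _
      exact hw
    · exact Eventually.of_forall fun w h => absurd h hl
  have h2 : ∀ᵐ w ∂P, ∀ l, coord e l 0 w = 0 := ae_all_iff.2 fun l => (hP.stable l).zero
  filter_upwards [h1, h2, ae_eventually_tsum_scaledSup_le hb1 hb2 hpos hsum hP] with w hw1 hw2 hw3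
  have hp : ∀ l t, coord e l t w ≠ 0 → 0 < lam l := fun l t h =>
    hpos l fun h' => h (hw1 l h' t)
  have hnn : ∀ l t, 0 ≤ lam l * coord e l t w ^ 2 := fun l t => by
    by_cases h : coord e l t w = 0
    · simp [h]
    · have := hp l t h; positivity
  obtain ⟨N, hN⟩ := eventually_atTop.1 hw3
  refine ⟨hp, 4 * ((N : ℝ) + 2) ^ 4, fun t => ?_⟩
  -- an integer `n ≥ N` with `|t| ≤ n ≤ (N + 2) (1 + |t|)`
  set n := N + 1 + ⌈|t|⌉₊ with hn
  have hn1 : |t| ≤ n := by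
    have := Nat.le_ceil |t|
    rw [hn]; push_cast
    have : (0 : ℝ) ≤ N := Nat.cast_nonneg N
    linarith
  have hn2 : (n : ℝ) ≤ (N + 2) * (1 + |t|) := by
    have := (Nat.ceil_lt_add_one (abs_nonneg t)).le
    rw [hn]; push_cast
    nlinarith [mul_nonneg (Nat.cast_nonneg N : (0 : ℝ) ≤ N) (abs_nonneg t), abs_nonneg t]
  have hle : ∑' l, ENNReal.ofReal (lam l * coord e l t w ^ 2) ≤ ENNReal.ofReal (4 * n ^ 4) := by
    refine (ENNReal.tsum_le_tsum fun l => coord_sq_le (by omega) (hw2 l) hn1).trans ?_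
    rw [ENNReal.tsum_mul_left]
    exact mul_le_of_le_one_right' (hN n (by omega))
  have hs : Summable fun l => lam l * coord e l t w ^ 2 := by
    have := ENNReal.summable_toReal (ne_top_of_le_ne_top ENNReal.ofReal_ne_top hle)
    simpa only [ENNReal.toReal_ofReal (hnn _ t)] using this
  refine ⟨hs, ?_⟩
  rw [← ENNReal.ofReal_tsum_of_nonneg (fun l => hnn l t) hs,
    ENNReal.ofReal_le_ofReal_iff (by positivity)] at hle
  refine hle.trans ?_
  have h3 : (1 : ℝ) ≤ 1 + |t| := by linarith [abs_nonneg t]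
  calc 4 * (n : ℝ) ^ 4 ≤ 4 * ((N + 2) * (1 + |t|)) ^ 4 := by gcongr
    _ = 4 * ((N : ℝ) + 2) ^ 4 * (1 + |t|) ^ 4 := by ring
    _ ≤ 4 * ((N : ℝ) + 2) ^ 4 * (1 + |t|) ^ 5 := by
        gcongr 4 * ((N : ℝ) + 2) ^ 4 * ?_
        exact pow_le_pow_right₀ h3 (by norm_num)

/-! ### The heat flow on polynomial fields -/

theorem integral_ang (i : Fin 3) (p : Poly) : ∫ x : S2, ev (ang i p) x ∂surf = 0 := by
  rw [← integral_lop i (contDiff_ev p)]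
  simp_rw [lop_ev]

theorem integrable_ev (p : Poly) : Integrable (fun x : S2 => ev p x) surf :=
  integrable_of_continuous ((continuous_ev p).comp continuous_subtype_val)

theorem integral_mul_ang (i : Fin 3) (p q : Poly) :
    ∫ x : S2, ev p x * ev (ang i q) x ∂surf = - ∫ x : S2, ev (ang i p) x * ev q x ∂surf := by
  have := integral_mul_lop i (contDiff_ev p) (contDiff_ev q)
  simpa only [lop_ev] using this

theorem IsHarm.integral_mul_casimir {n : ℕ} {p : Poly} (hp : IsHarm n p) (q : Poly) :
    ∑ i, ∫ x : S2, ev (AngularMomentum.ang i q) x * ev (AngularMomentum.ang i p) x ∂surf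
      = (n : ℝ) * (n + 1) * ∫ x : S2, ev q x * ev p x ∂surf := by
  have h : ∀ i, ∫ x : S2, ev (AngularMomentum.ang i q) x * ev (AngularMomentum.ang i p) x ∂surf
      = - ∫ x : S2, ev (q * AngularMomentum.ang i (AngularMomentum.ang i p)) x ∂surf := fun i => by
    simp_rw [ev_mul]
    rw [integral_mul_ang i q, neg_neg]
  simp_rw [h]
  rw [Finset.sum_neg_distrib, ← integral_finsetSum _ fun i _ => integrable_ev _]
  simp_rw [← ev_sum]
  rw [← Finset.mul_sum, hp.casimir]
  simp_rw [ev_mul, ev_smul, mul_left_comm _ (-((n : ℝ) * (n + 1)))]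
  rw [integral_const_mul]
  ring

theorem IsHarm.integral_mul_eq_zero {n m : ℕ} (h : n ≠ m) {p q : Poly} (hp : IsHarm n p)
    (hq : IsHarm m q) : ∫ x : S2, ev p x * ev q x ∂surf = 0 := by
  have h1 := hp.integral_mul_casimir q
  have h2 := hq.integral_mul_casimir p
  simp_rw [mul_comm (ev _ _) (ev _ _)] at h1
  rw [h1] at h2
  have h3 : (stokesEv n - stokesEv m) * ∫ x : S2, ev p x * ev q x ∂surf = 0 := by
    unfold stokesEv
    linear_combination h2
  exact (mul_eq_zero.1 h3).resolve_left (sub_ne_zero.2 fun h' => h (stokesEv_injective h'))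

/-- Finite sums of harmonic polynomials. -/
abbrev HarmSum : Type := DirectSum ℕ fun n => harmSpace n

/-- The heat flow of a sum of harmonic polynomials, as a polynomial: on the sphere, the
Laplace–Beltrami operator acts on the summand of degree `n` as `-n (n + 1)`. -/
def heatPoly (t : ℝ) : HarmSum →ₗ[ℝ] Poly :=
  DirectSum.toModule ℝ ℕ Poly fun n =>
    Real.exp (-((n : ℝ) * (n + 1) * t)) • (harmSpace n).subtype

theorem heatPoly_of (t : ℝ) (n : ℕ) (p : harmSpace n) :
    heatPoly t (DirectSum.of (fun n => harmSpace n) n p)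
      = Real.exp (-((n : ℝ) * (n + 1) * t)) • (p : Poly) := by
  rw [heatPoly, ← DirectSum.lof_eq_of ℝ, DirectSum.toModule_lof]
  rfl

theorem continuous_ev_heatPoly (a : HarmSum) :
    Continuous (fun z : ℝ × S2 => ev (heatPoly z.1 a) z.2) := by
  induction a using DirectSum.induction_on with
  | zero => simpa using continuous_const
  | of n p =>
    simp only [heatPoly_of, ev_smul]
    have := (continuous_ev (p : Poly)).comp (continuous_subtype_val.comp continuous_snd :
      Continuous fun z : ℝ × S2 => (z.2 : E3))
    exact (by fun_prop : Continuous fun z : ℝ × S2 => Real.exp (-((n : ℝ) * (n + 1) * z.1))).mul this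
  | add a b ha hb => simpa only [map_add, ev_add] using ha.fun_add hb

/-- Adding up the squares of the components of the angular momentum operator. -/
def casimirSum : Poly →ₗ[ℝ] Poly :=
  ∑ i, ((ang i : Poly →ₗ[ℝ] Poly).comp (ang i : Poly →ₗ[ℝ] Poly))

theorem casimirSum_apply (p : Poly) : casimirSum p = ∑ i, ang i (ang i p) := by
  simp [casimirSum]

theorem continuous_ev_casimirSum_heatPoly (a : HarmSum) :
    Continuous (fun z : ℝ × S2 => ev (casimirSum (heatPoly z.1 a)) z.2) := by
  induction a using DirectSum.induction_on with
  | zero => simpa using continuous_const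
  | of n p =>
    simp only [heatPoly_of, map_smul, ev_smul]
    have := (continuous_ev (casimirSum (p : Poly))).comp
      (continuous_subtype_val.comp continuous_snd : Continuous fun z : ℝ × S2 => (z.2 : E3))
    exact (by fun_prop : Continuous fun z : ℝ × S2 => Real.exp (-((n : ℝ) * (n + 1) * z.1))).mul this
  | add a b ha hb => simpa only [map_add, ev_add] using ha.fun_add hb

theorem hasDerivAt_heatPoly (a : HarmSum) (x : E3) (t : ℝ) :
    HasDerivAt (fun t => ev (heatPoly t a) x) (ev (casimirSum (heatPoly t a)) x) t := by
  induction a using DirectSum.induction_on with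
  | zero => simpa using hasDerivAt_const t (0 : ℝ)
  | of n p =>
    simp only [heatPoly_of, map_smul, ev_smul]
    have h := (((hasDerivAt_id t).const_mul ((n : ℝ) * (n + 1))).fun_neg.exp).mul_const (ev (p : Poly) x)
    refine h.congr_deriv ?_
    rw [casimirSum_apply, IsHarm.casimir p.2, ev_smul]
    simp only [id]
    ring
  | add a b ha hb => simpa only [map_add, ev_add] using ha.fun_add hb

theorem ang_sum_mul_self (i : Fin 3) (u : Fin 3 → Poly) :
    ang i (∑ j, u j * u j) = 2 * ∑ j, u j * ang i (u j) := by
  rw [map_sum, Finset.mul_sum]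
  refine Finset.sum_congr rfl fun j _ => ?_
  rw [Derivation.leibniz, smul_eq_mul]
  ring

theorem ang_ang_sum_mul_self (i : Fin 3) (u : Fin 3 → Poly) :
    ang i (ang i (∑ j, u j * u j))
      = 2 * (∑ j, ang i (u j) * ang i (u j) + ∑ j, u j * ang i (ang i (u j))) := by
  rw [ang_sum_mul_self, two_mul, map_add, ← two_mul, map_sum, ← Finset.sum_add_distrib]
  congr 1
  refine Finset.sum_congr rfl fun j _ => ?_
  rw [Derivation.leibniz, smul_eq_mul, smul_eq_mul]
  ring

/-- The identity `2 s ∑ⱼ uⱼ Lᵢ² uⱼ = Lᵢ (s Lᵢ s) - (Lᵢ s)² - 2 s ∑ⱼ (Lᵢ uⱼ)²`, where `Lᵢ` is the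
`i`-th component of the angular momentum operator and `s = ∑ⱼ uⱼ²`. -/
theorem two_mul_normSq_mul_ang_ang (i : Fin 3) (u : Fin 3 → Poly) :
    2 * ((∑ j, u j * u j) * ∑ j, u j * ang i (ang i (u j)))
      = ang i ((∑ j, u j * u j) * ang i (∑ j, u j * u j))
        - (ang i (∑ j, u j * u j) * ang i (∑ j, u j * u j)
          + 2 * ((∑ j, u j * u j) * ∑ j, ang i (u j) * ang i (u j))) := by
  rw [Derivation.leibniz, ang_ang_sum_mul_self, smul_eq_mul, smul_eq_mul]
  ring

theorem integral_normSq_mul_ang_ang_nonpos (i : Fin 3) (u : Fin 3 → Poly) :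
    ∫ x : S2, ev ((∑ j, u j * u j) * ∑ j, u j * ang i (ang i (u j))) x ∂surf ≤ 0 := by
  have h := two_mul_normSq_mul_ang_ang i u
  set s : Poly := ∑ j, u j * u j with hs
  set d : Poly := ang i s * ang i s + 2 * (s * ∑ j, ang i (u j) * ang i (u j)) with hd
  have ev2 : ∀ x : S2, ev (2 : Poly) x = 2 := fun x => by simp [ev]
  have h2 : ∫ x : S2, ev (2 * (s * ∑ j, u j * ang i (ang i (u j)))) x ∂surf
      = - ∫ x : S2, ev d x ∂surf := by
    rw [h]
    simp_rw [ev_sub]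
    rw [integral_sub (integrable_ev _) (integrable_ev _), integral_ang, zero_sub]
  simp_rw [fun x : S2 => ev_mul 2 (s * ∑ j, u j * ang i (ang i (u j))) x, ev2] at h2
  rw [integral_const_mul] at h2
  have h3 : 0 ≤ ∫ x : S2, ev d x ∂surf := by
    refine integral_nonneg fun x => ?_
    have e1 : 0 ≤ ev s x := by
      rw [hs, ev_sum]
      exact Finset.sum_nonneg fun j _ => by rw [ev_mul]; exact mul_self_nonneg _
    have e2 : 0 ≤ ev (∑ j, ang i (u j) * ang i (u j)) x := by
      rw [ev_sum]
      exact Finset.sum_nonneg fun j _ => by rw [ev_mul]; exact mul_self_nonneg _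
    have e3 := mul_self_nonneg (ev (ang i s) x)
    rw [hd, ev_add, ev_mul, ev_mul, ev_mul, ev2]
    exact add_nonneg e3 (mul_nonneg two_pos.le (mul_nonneg e1 e2))
  linarith

/-- The Laplace–Beltrami operator is dissipative in `L⁴`, for vector valued functions. -/
theorem integral_normSq_mul_casimirSum_nonpos (u : Fin 3 → Poly) :
    ∫ x : S2, ev ((∑ j, u j * u j) * ∑ j, u j * casimirSum (u j)) x ∂surf ≤ 0 := by
  have h : (∑ j, u j * u j) * ∑ j, u j * casimirSum (u j)
      = ∑ i, (∑ j, u j * u j) * ∑ j, u j * ang i (ang i (u j)) := by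
    have h0 : ∀ j, u j * casimirSum (u j) = ∑ i, u j * ang i (ang i (u j)) := fun j => by
      rw [casimirSum_apply, Finset.mul_sum]
    simp_rw [h0]
    rw [Finset.sum_comm, Finset.mul_sum]
  rw [h]
  have h1 := fun x : S2 => ev_sum Finset.univ
    (fun i => (∑ j, u j * u j) * ∑ j, u j * ang i (ang i (u j))) x
  simp_rw [h1]
  rw [integral_finsetSum _ fun i _ => integrable_ev _]
  exact Finset.sum_nonpos fun i _ => integral_normSq_mul_ang_ang_nonpos i u

theorem integral_heatPoly_sq_sq_le (a : Fin 3 → HarmSum) {t : ℝ} (ht : 0 ≤ t) :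
    ∫ x : S2, (∑ j, ev (heatPoly t (a j)) x ^ 2) ^ 2 ∂surf
      ≤ ∫ x : S2, (∑ j, ev (heatPoly 0 (a j)) x ^ 2) ^ 2 ∂surf := by
  let F' : ℝ → S2 → ℝ := fun t x => 4 * ((∑ j, ev (heatPoly t (a j)) x ^ 2) *
    ∑ j, ev (heatPoly t (a j)) x * ev (casimirSum (heatPoly t (a j))) x)
  have hd := hasDerivAt_integral_sphere (F := fun t x => (∑ j, ev (heatPoly t (a j)) x ^ 2) ^ 2)
    (F' := F') (fun t => by
      have := fun j => (continuous_ev (heatPoly t (a j))).comp continuous_subtype_val (X := S2)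
      exact (continuous_finsetSum _ fun j _ => (this j).pow 2).pow 2)
    (by
      have h1 := fun j => continuous_ev_heatPoly (a j)
      have h2 := fun j => continuous_ev_casimirSum_heatPoly (a j)
      exact continuous_const.mul ((continuous_finsetSum _ fun j _ => (h1 j).pow 2).mul
        (continuous_finsetSum _ fun j _ => (h1 j).mul (h2 j))))
    (fun x t => by
      have := (HasDerivAt.fun_sum (u := Finset.univ) fun j _ =>
        (hasDerivAt_heatPoly (a j) x t).fun_pow 2).fun_pow 2
      refine this.congr_deriv ?_
      simp only [F', Fin.sum_univ_three]
      push_cast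
      ring)
  refine antitone_of_deriv_nonpos (fun t => (hd t).differentiableAt) (fun t => ?_) ht
  rw [(hd t).deriv]
  simp only [F']
  rw [integral_const_mul]
  have h := integral_normSq_mul_casimirSum_nonpos fun j => heatPoly t (a j)
  simp only [ev_mul, ev_sum] at h
  simp only [pow_two]
  linarith

/-! ### The heat flow in `L⁴` -/

theorem exists_heatPoly_zero_of_isHomogeneous (n : ℕ) : ∀ p : Poly, p.IsHomogeneous n →
    ∃ a : HarmSum, ∀ x : S2, ev p x = ev (heatPoly 0 a) x := by
  have hharm : ∀ n p, IsHarm n p → ∃ a : HarmSum, ∀ x : S2, ev p x = ev (heatPoly 0 a) x :=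
    fun n p hp => ⟨DirectSum.of (fun n => harmSpace n) n ⟨p, hp⟩, fun x => by
      rw [heatPoly_of, mul_zero, neg_zero, Real.exp_zero, one_smul]⟩
  induction n using Nat.strong_induction_on with
  | _ n ih =>
    intro p hp
    rcases Nat.lt_or_ge n 2 with hn | hn
    · exact hharm n p ⟨hp, lap_eq_zero_of_lt hn hp⟩
    · obtain ⟨q, hq, hl, hh⟩ := fischer hp hn
      obtain ⟨a, ha⟩ := hharm n _ ⟨hh, hl⟩
      obtain ⟨b, hb⟩ := ih (n - 2) (by omega) q hq
      refine ⟨a + b, fun x => ?_⟩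
      rw [map_add, ev_add, ← ha, ← hb, ev_sub, ev_mul, ev_rsq]
      ring

theorem exists_heatPoly_zero (p : Poly) :
    ∃ a : HarmSum, ∀ x : S2, ev p x = ev (heatPoly 0 a) x := by
  choose a ha using fun i => exists_heatPoly_zero_of_isHomogeneous i _
    (MvPolynomial.homogeneousComponent_isHomogeneous i p)
  refine ⟨∑ i ∈ Finset.range (p.totalDegree + 1), a i, fun x => ?_⟩
  conv_lhs => rw [← MvPolynomial.sum_homogeneousComponent p]
  rw [map_sum, ev_sum, ev_sum]
  exact Finset.sum_congr rfl fun i _ => ha i x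

/-- Triples of finite sums of harmonic polynomials: the components of polynomial vector fields. -/
def HarmField : Type := Fin 3 → HarmSum

instance : AddCommGroup HarmField := inferInstanceAs (AddCommGroup (Fin 3 → HarmSum))

instance : Module ℝ HarmField := inferInstanceAs (Module ℝ (Fin 3 → HarmSum))

theorem HarmField.add_apply (a b : HarmField) (j : Fin 3) : (a + b) j = a j + b j := rfl

theorem HarmField.smul_apply (c : ℝ) (a : HarmField) (j : Fin 3) : (c • a) j = c • a j := rfl

/-- The vector field with only one component. -/
def HarmField.single (j : Fin 3) (a : HarmSum) : HarmField := (Pi.single j a : Fin 3 → HarmSum)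

theorem HarmField.single_apply (i j : Fin 3) (a : HarmSum) :
    HarmField.single j a i = if i = j then a else 0 := Pi.single_apply j a i

/-- The heat flow, applied to the three components of a polynomial vector field. -/
def heatField (t : ℝ) : HarmField →ₗ[ℝ] C(S2, E3) where
  toFun a := ⟨fun x => WithLp.toLp 2 (fun j => ev (heatPoly t (a j)) x),
    (PiLp.continuous_toLp 2 _).comp (continuous_pi fun j =>
      (continuous_ev _).comp continuous_subtype_val)⟩
  map_add' a b := by ext x j; simp [HarmField.add_apply]
  map_smul' c a := by ext x j; simp [HarmField.smul_apply]

theorem heatField_apply (t : ℝ) (a : HarmField) (x : S2) (j : Fin 3) :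
    heatField t a x j = ev (heatPoly t (a j)) x := rfl

/-- The polynomial vector field `heatField t a` as an element of `Lʳ`. -/
def heatLp (r : ℝ≥0∞) [Fact (1 ≤ r)] (t : ℝ) : HarmField →ₗ[ℝ] Lp E3 r surf :=
  (ContinuousMap.toLp (E := E3) r surf ℝ : C(S2, E3) →ₗ[ℝ] Lp E3 r surf).comp (heatField t)

theorem heatLp_ae (r : ℝ≥0∞) [Fact (1 ≤ r)] (t : ℝ) (a : HarmField) :
    (heatLp r t a : S2 → E3) =ᵐ[surf] heatField t a :=
  ContinuousMap.coeFn_toLp surf (𝕜 := ℝ) _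

theorem denseRange_heatLp (r : ℝ≥0∞) [Fact (1 ≤ r)] (hr : r ≠ ⊤) : DenseRange (heatLp r 0) := by
  refine fun u => mem_of_forall_polynomial_mem r hr
    (R := (LinearMap.range (heatLp r 0)).topologicalClosure)
    (Submodule.isClosed_topologicalClosure _) (fun j p V hV => ?_) u
  obtain ⟨a, ha⟩ := exists_heatPoly_zero p
  refine Submodule.le_topologicalClosure _ ⟨HarmField.single j a, ?_⟩
  change ContinuousMap.toLp (E := E3) r surf ℝ _ = ContinuousMap.toLp (E := E3) r surf ℝ _
  congr 1
  ext x i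
  rw [heatField_apply, HarmField.single_apply, hV, ha]
  rcases eq_or_ne i j with rfl | h
  · simp
  · simp [h]

/-- The heat flow is a contraction in `L⁴`. -/
theorem norm_heatLp_le {t : ℝ} (ht : 0 ≤ t) (a : HarmField) :
    ‖heatLp 4 t a‖ ≤ ‖heatLp 4 0 a‖ := by
  have h : ∀ t, ‖heatLp 4 t a‖ ^ 4 = ∫ x : S2, (∑ j, ev (heatPoly t (a j)) x ^ 2) ^ 2 ∂surf :=
    fun t => by
      change ‖ContinuousMap.toLp (E := E3) 4 surf ℝ (heatField t a)‖ ^ 4 = _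
      rw [norm_toLp_four_pow]
      congr 1 with x
      rw [show 4 = 2 * 2 from rfl, pow_mul, EuclideanSpace.norm_sq_eq]
      simp only [Real.norm_eq_abs, sq_abs, heatField_apply]
  refine (pow_le_pow_iff_left₀ (norm_nonneg _) (norm_nonneg _) four_ne_zero).1 ?_
  rw [h, h]
  exact integral_heatPoly_sq_sq_le a ht

/-- The heat semigroup on vector valued functions in `L⁴`. -/
def heatL (t : ℝ) : Lp E3 4 surf →L[ℝ] Lp E3 4 surf := (heatLp 4 t).extendOfNorm (heatLp 4 0)

theorem heatL_heatLp {t : ℝ} (ht : 0 ≤ t) (a : HarmField) :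
    heatL t (heatLp 4 0 a) = heatLp 4 t a :=
  LinearMap.extendOfNorm_eq (denseRange_heatLp 4 (ENNReal.ofNat_ne_top (n := 4)))
    ⟨1, fun a => by rw [one_mul]; exact norm_heatLp_le ht a⟩ a

theorem norm_heatL_le {t : ℝ} (ht : 0 ≤ t) (f : Lp E3 4 surf) : ‖heatL t f‖ ≤ ‖f‖ := by
  refine (denseRange_heatLp 4 (ENNReal.ofNat_ne_top (n := 4))).induction_on (p := fun f => ‖heatL t f‖ ≤ ‖f‖) f
    (isClosed_le (heatL t).continuous.norm continuous_norm) fun a => ?_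
  rw [heatL_heatLp ht]
  exact norm_heatLp_le ht a

theorem continuous_heatLp (a : HarmField) : Continuous fun t => heatLp 4 t a := by
  refine (ContinuousMap.toLp (E := E3) 4 surf ℝ).continuous.comp (g := ContinuousMap.toLp (E := E3) 4 surf ℝ) (f := fun t => heatField t a) ?_
  refine ContinuousMap.continuous_of_continuous_uncurry _ ?_
  exact (PiLp.continuous_toLp 2 _).comp (continuous_pi fun j => continuous_ev_heatPoly (a j))

theorem tendsto_heatL (f : Lp E3 4 surf) : Tendsto (fun t => heatL t f) (𝓝[>] 0) (𝓝 f) := by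
  rw [Metric.tendsto_nhds]
  intro ε hε
  obtain ⟨a, ha⟩ := (denseRange_heatLp 4 (ENNReal.ofNat_ne_top (n := 4))).exists_dist_lt f (by positivity : 0 < ε / 3)
  have h1 : ∀ᶠ t in 𝓝[>] (0 : ℝ), dist (heatLp 4 t a) (heatLp 4 0 a) < ε / 3 :=
    Metric.tendsto_nhds.1 (((continuous_heatLp a).tendsto 0).mono_left nhdsWithin_le_nhds) _
      (by positivity)
  filter_upwards [h1, self_mem_nhdsWithin] with t ht ht0
  have ht0' : (0 : ℝ) ≤ t := le_of_lt ht0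
  have h2 : dist (heatL t f) (heatLp 4 t a) ≤ dist f (heatLp 4 0 a) := by
    rw [← heatL_heatLp ht0', dist_eq_norm, ← map_sub, dist_eq_norm]
    exact norm_heatL_le ht0' _
  calc dist (heatL t f) f
      ≤ dist (heatL t f) (heatLp 4 t a) + dist (heatLp 4 t a) (heatLp 4 0 a)
        + dist (heatLp 4 0 a) f := dist_triangle4 _ _ _ _
    _ < ε := by rw [dist_comm _ f]; linarith

/-! ### The heat semigroup on `X` -/

theorem integrable_ev_mul_ev (p q : Poly) : Integrable (fun x : S2 => ev p x * ev q x) surf :=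
  integrable_ev_mul p (contDiff_ev q)

theorem integral_mul_heatPoly {n : ℕ} {p : Poly} (hp : IsHarm n p) (t : ℝ) (a : HarmSum) :
    ∫ x : S2, ev p x * ev (heatPoly t a) x ∂surf = Real.exp (-((n : ℝ) * (n + 1) * t)) *
      ∫ x : S2, ev p x * ev (heatPoly 0 a) x ∂surf := by
  induction a using DirectSum.induction_on with
  | zero => simp
  | of m q =>
    simp only [heatPoly_of, ev_smul, mul_left_comm (ev p _), integral_const_mul]
    rcases eq_or_ne n m with rfl | h
    · simp
    · rw [IsHarm.integral_mul_eq_zero h hp q.2]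
      simp
  | add a b ha hb =>
    simp only [map_add, ev_add, mul_add (ev p _)]
    rw [integral_add (integrable_ev_mul_ev _ _) (integrable_ev_mul_ev _ _),
      integral_add (integrable_ev_mul_ev _ _) (integrable_ev_mul_ev _ _), ha, hb]
    ring

/-- The heat flow is symmetric. -/
theorem integral_heatPoly_mul (t : ℝ) (a b : HarmSum) :
    ∫ x : S2, ev (heatPoly t a) x * ev (heatPoly 0 b) x ∂surf
      = ∫ x : S2, ev (heatPoly 0 a) x * ev (heatPoly t b) x ∂surf := by
  induction a using DirectSum.induction_on with
  | zero => simp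
  | of m q =>
    simp only [heatPoly_of, ev_smul, mul_assoc (Real.exp _), integral_const_mul]
    rw [integral_mul_heatPoly q.2 t b]
    simp
  | add a c ha hc =>
    simp only [map_add, ev_add, add_mul]
    rw [integral_add (integrable_ev_mul_ev _ _) (integrable_ev_mul_ev _ _),
      integral_add (integrable_ev_mul_ev _ _) (integrable_ev_mul_ev _ _), ha, hc]

theorem inner_heatLp_heatLp (s t : ℝ) (a b : HarmField) :
    ⟪heatLp 2 s a, heatLp 2 t b⟫_ℝ
      = ∑ j, ∫ x : S2, ev (heatPoly s (a j)) x * ev (heatPoly t (b j)) x ∂surf := by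
  rw [← integral_finsetSum _ fun j _ => integrable_ev_mul_ev _ _, L2.inner_def]
  refine integral_congr_ae ?_
  filter_upwards [heatLp_ae 2 s a, heatLp_ae 2 t b] with x hx hy
  rw [hx, hy, inner_eq_sum]
  rfl

theorem inner_angH_heatLp (p : Poly) (t : ℝ) (b : HarmField) :
    ⟪(angH p : Lp E3 2 surf), heatLp 2 t b⟫_ℝ
      = ∑ j, ∫ x : S2, ev (ang j p) x * ev (heatPoly t (b j)) x ∂surf := by
  rw [← integral_finsetSum _ fun j _ => integrable_ev_mul_ev _ _, L2.inner_def]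
  refine integral_congr_ae ?_
  filter_upwards [angH_ae p, heatLp_ae 2 t b] with x hx hy
  rw [hx, hy, inner_eq_sum]
  rfl

/-- The inclusion of `L⁴` in `L²`, as a linear map. -/
def lpInclₗ : Lp E3 4 surf →ₗ[ℝ] Lp E3 2 surf where
  toFun f := ⟨f.1, Lp.antitone (by norm_num) f.2⟩
  map_add' _ _ := rfl
  map_smul' _ _ := rfl

theorem norm_lpInclₗ_le (f : Lp E3 4 surf) :
    ‖lpInclₗ f‖ ≤ ((surf univ) ^ (1 / (2 : ℝ≥0∞).toReal - 1 / (4 : ℝ≥0∞).toReal)).toReal * ‖f‖ := by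
  have h := eLpNorm_le_eLpNorm_mul_rpow_measure_univ (μ := surf) (p := 2) (q := 4) (by norm_num)
    (Lp.aestronglyMeasurable f)
  have h2 : (surf univ) ^ (1 / (2 : ℝ≥0∞).toReal - 1 / (4 : ℝ≥0∞).toReal) ≠ ⊤ :=
    ENNReal.rpow_ne_top_of_nonneg (by norm_num) (measure_ne_top _ _)
  rw [mul_comm, Lp.norm_def, Lp.norm_def, ← ENNReal.toReal_mul]
  exact ENNReal.toReal_mono (ENNReal.mul_ne_top (Lp.eLpNorm_ne_top f) h2) h

/-- The inclusion of `L⁴` in `L²`. -/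
def lpIncl : Lp E3 4 surf →L[ℝ] Lp E3 2 surf := lpInclₗ.mkContinuous _ norm_lpInclₗ_le

theorem lpIncl_heatLp (t : ℝ) (a : HarmField) : lpIncl (heatLp 4 t a) = heatLp 2 t a :=
  Lp.ext ((heatLp_ae 4 t a).trans (heatLp_ae 2 t a).symm)

theorem inner_lpIncl_heatL {t : ℝ} (ht : 0 ≤ t) (f : Lp E3 4 surf) (a : HarmField) :
    ⟪lpIncl (heatL t f), heatLp 2 0 a⟫_ℝ = ⟪lpIncl f, heatLp 2 t a⟫_ℝ := by
  refine (denseRange_heatLp 4 (ENNReal.ofNat_ne_top (n := 4))).induction_on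
    (p := fun f => ⟪lpIncl (heatL t f), heatLp 2 0 a⟫_ℝ = ⟪lpIncl f, heatLp 2 t a⟫_ℝ) f
    (isClosed_eq (((lpIncl.continuous.comp (heatL t).continuous)).inner continuous_const)
      (lpIncl.continuous.inner continuous_const)) fun b => ?_
  rw [heatL_heatLp ht, lpIncl_heatLp, lpIncl_heatLp, inner_heatLp_heatLp, inner_heatLp_heatLp]
  exact Finset.sum_congr rfl fun j _ => integral_heatPoly_mul t _ _

theorem inner_heatLp_of_mem_eigSp {n : ℕ} {v : H} (hv : v ∈ eigSp n) (t : ℝ) (a : HarmField) :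
    ⟪(v : Lp E3 2 surf), heatLp 2 t a⟫_ℝ
      = Real.exp (-((n : ℝ) * (n + 1) * t)) * ⟪(v : Lp E3 2 surf), heatLp 2 0 a⟫_ℝ := by
  obtain ⟨p, hp, rfl⟩ := exists_of_mem_eigSp hv
  rw [inner_angH_heatLp, inner_angH_heatLp, Finset.mul_sum]
  exact Finset.sum_congr rfl fun j _ => integral_mul_heatPoly (hp.ang j) t _

theorem hasSum_inner_heatLp (v : H) (t : ℝ) (a : HarmField) :
    HasSum (fun n : ℕ => Real.exp (-((n : ℝ) * (n + 1) * t)) *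
      ⟪(eigProj n v : Lp E3 2 surf), heatLp 2 0 a⟫_ℝ) ⟪(v : Lp E3 2 surf), heatLp 2 t a⟫_ℝ := by
  have h1 : HasSum (fun n => (eigProj n v : Lp E3 2 surf)) (v : Lp E3 2 surf) :=
    (hasSum_eigProj v).mapL H.subtypeL
  have h2 := h1.mapL (innerSL ℝ (heatLp 2 t a))
  simp only [innerSL_apply_apply, real_inner_comm _ (heatLp 2 t a)] at h2
  simpa only [← inner_heatLp_of_mem_eigSp (eigProj_mem _ v)] using h2

/-- The heat flow in `H` and the heat flow in `L⁴` agree. -/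
theorem lpIncl_heatL_eq {t : ℝ} (ht : 0 ≤ t) {f : Lp E3 4 surf} {v w : H}
    (hf : lpIncl f = v)
    (hw : ∀ n : ℕ, eigProj n w = Real.exp (-((n : ℝ) * (n + 1) * t)) • eigProj n v) :
    lpIncl (heatL t f) = w := by
  have h : ∀ a, ⟪lpIncl (heatL t f), heatLp 2 0 a⟫_ℝ = ⟪(w : Lp E3 2 surf), heatLp 2 0 a⟫_ℝ := by
    intro a
    rw [inner_lpIncl_heatL ht, hf]
    refine (hasSum_inner_heatLp v t a).unique ?_
    have h1 := hasSum_inner_heatLp w 0 a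
    simp only [hw, mul_zero, neg_zero, Real.exp_zero, one_mul, Submodule.coe_smul,
      real_inner_smul_left] at h1
    exact h1
  refine ext_inner_right ℝ fun g => ?_
  exact (denseRange_heatLp 2 (ENNReal.ofNat_ne_top (n := 2))).induction_on
    (p := fun g => ⟪lpIncl (heatL t f), g⟫_ℝ = ⟪(w : Lp E3 2 surf), g⟫_ℝ) g
    (isClosed_eq (continuous_const.inner continuous_id) (continuous_const.inner continuous_id)) h

theorem lpIncl_snd (u : X) : lpIncl (u : WithLp 1 (H × Lp E3 4 surf)).snd = toH u :=
  Lp.ext (EventuallyEq.symm u.2)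

/-- The element of `X` given by an element of `H` that belongs to `L⁴`. -/
def mkX (w : H) (g : Lp E3 4 surf) (h : lpIncl g = w) : X :=
  ⟨WithLp.toLp 1 (w, g), by
    change ((w : Lp E3 2 surf) : S2 → E3) =ᵐ[surf] g
    rw [← h]; rfl⟩

theorem norm_mkX (w : H) (g : Lp E3 4 surf) (h : lpIncl g = w) : ‖mkX w g h‖ = ‖w‖ + ‖g‖ :=
  norm_eq (mkX w g h)

/-- The heat flow acts on `X`, with the factor `exp (-n (n + 1) t)` in degree `n`. -/
theorem exists_heat {t : ℝ} (ht : 0 ≤ t) (u : X) : ∃ w : X,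
    (∀ n : ℕ, eigProj n (toH w) = Real.exp (-((n : ℝ) * (n + 1) * t)) • eigProj n (toH u)) ∧
    (w : WithLp 1 (H × Lp E3 4 surf)).snd
      = heatL t (u : WithLp 1 (H × Lp E3 4 surf)).snd ∧ ‖w‖ ≤ ‖u‖ := by
  obtain ⟨w, hw, hwn⟩ := exists_eigProj_eq
    (v := fun n : ℕ => Real.exp (-((n : ℝ) * (n + 1) * t)) • eigProj n (toH u))
    (fun n => (eigSp n).smul_mem _ (eigProj_mem n _)) (norm_nonneg (toH u)) fun N => by
      refine (Finset.sum_le_sum fun n _ => ?_).trans (sum_norm_eigProj_sq_le (toH u) N)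
      rw [norm_smul, Real.norm_of_nonneg (Real.exp_pos _).le]
      have h1 : Real.exp (-((n : ℝ) * (n + 1) * t)) ≤ 1 :=
        Real.exp_le_one_iff.2 (neg_nonpos.2 (by positivity))
      exact pow_le_pow_left₀ (by positivity) (mul_le_of_le_one_left (norm_nonneg _) h1) 2
  have h := lpIncl_heatL_eq ht (lpIncl_snd u) hw
  refine ⟨mkX w _ h, hw, rfl, ?_⟩
  rw [norm_mkX, norm_eq u]
  exact add_le_add hwn (norm_heatL_le ht _)

/-- The heat flow on `X`, as a function; the identity at negative times. -/
def heatFun (t : ℝ) (u : X) : X := (exists_heat (le_max_right t 0) u).choose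

theorem eigProj_heatFun (t : ℝ) (u : X) (n : ℕ) : eigProj n (toH (heatFun t u))
    = Real.exp (-((n : ℝ) * (n + 1) * max t 0)) • eigProj n (toH u) :=
  (exists_heat (le_max_right t 0) u).choose_spec.1 n

theorem snd_heatFun (t : ℝ) (u : X) : (heatFun t u : WithLp 1 (H × Lp E3 4 surf)).snd
    = heatL (max t 0) (u : WithLp 1 (H × Lp E3 4 surf)).snd :=
  (exists_heat (le_max_right t 0) u).choose_spec.2.1

theorem norm_heatFun_le (t : ℝ) (u : X) : ‖heatFun t u‖ ≤ ‖u‖ :=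
  (exists_heat (le_max_right t 0) u).choose_spec.2.2

theorem eq_of_eigProj_toH_eq {u v : X} (h : ∀ n, eigProj n (toH u) = eigProj n (toH v)) : u = v :=
  toH_injective (eq_of_eigProj_eq h)

theorem eigProj_toH_add (n : ℕ) (u v : X) :
    eigProj n (toH (u + v)) = eigProj n (toH u) + eigProj n (toH v) :=
  map_add (eigProj n) (toH u) (toH v)

theorem eigProj_toH_smul (n : ℕ) (c : ℝ) (u : X) :
    eigProj n (toH (c • u)) = c • eigProj n (toH u) :=
  map_smul (eigProj n) c (toH u)

theorem heatFun_add (t : ℝ) (u v : X) : heatFun t (u + v) = heatFun t u + heatFun t v :=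
  eq_of_eigProj_toH_eq fun n => by
    rw [eigProj_toH_add, eigProj_heatFun, eigProj_heatFun, eigProj_heatFun, eigProj_toH_add,
      smul_add]

theorem heatFun_smul (t c : ℝ) (u : X) : heatFun t (c • u) = c • heatFun t u :=
  eq_of_eigProj_toH_eq fun n => by
    rw [eigProj_toH_smul, eigProj_heatFun, eigProj_heatFun, eigProj_toH_smul, smul_comm]

/-- The heat flow on `X`, as a linear map. -/
def heatLin (t : ℝ) : X →ₗ[ℝ] X where
  toFun := heatFun t
  map_add' := heatFun_add t
  map_smul' := heatFun_smul t

theorem norm_heatLin_le (t : ℝ) (u : X) : ‖heatLin t u‖ ≤ 1 * ‖u‖ := by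
  rw [one_mul]; exact norm_heatFun_le t u

/-- The heat semigroup on `X`. -/
def heatX (t : ℝ) : X →L[ℝ] X := (heatLin t).mkContinuous 1 (norm_heatLin_le t)

theorem heatX_apply (t : ℝ) (u : X) : heatX t u = heatFun t u := rfl

theorem eigProj_heatX {t : ℝ} (ht : 0 ≤ t) (u : X) (n : ℕ) : eigProj n (toH (heatX t u))
    = Real.exp (-((n : ℝ) * (n + 1) * t)) • eigProj n (toH u) := by
  rw [heatX_apply, eigProj_heatFun, max_eq_left ht]

theorem snd_heatX {t : ℝ} (ht : 0 ≤ t) (u : X) : (heatX t u : WithLp 1 (H × Lp E3 4 surf)).snd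
    = heatL t (u : WithLp 1 (H × Lp E3 4 surf)).snd := by
  rw [heatX_apply, snd_heatFun, max_eq_left ht]

theorem norm_eq_toH_add (u : X) :
    ‖u‖ = ‖toH u‖ + ‖(u : WithLp 1 (H × Lp E3 4 surf)).snd‖ := norm_eq u

/-- The `X`-norm is controlled by the `L⁴` norm. -/
theorem norm_le_snd (u : X) :
    ‖u‖ ≤ (‖lpIncl‖ + 1) * ‖(u : WithLp 1 (H × Lp E3 4 surf)).snd‖ := by
  have h : ‖toH u‖ ≤ ‖lpIncl‖ * ‖(u : WithLp 1 (H × Lp E3 4 surf)).snd‖ := by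
    change ‖(toH u : Lp E3 2 surf)‖ ≤ _
    rw [← lpIncl_snd]
    exact lpIncl.le_opNorm _
  rw [norm_eq_toH_add, add_mul, one_mul]
  exact add_le_add h le_rfl

theorem eigProj_heatX_zero (u : X) (n : ℕ) :
    eigProj n (toH (heatX 0 u)) = eigProj n (toH u) := by
  refine (eigProj_heatX le_rfl u n).trans ?_
  rw [mul_zero, neg_zero, Real.exp_zero, one_smul]

theorem heatX_zero : heatX 0 = ContinuousLinearMap.id ℝ X :=
  ContinuousLinearMap.ext fun u => eq_of_eigProj_toH_eq (eigProj_heatX_zero u)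

theorem eigProj_heatX_heatX {s t : ℝ} (hs : 0 ≤ s) (ht : 0 ≤ t) (u : X) (n : ℕ) :
    eigProj n (toH (heatX (s + t) u)) = eigProj n (toH (heatX s (heatX t u))) := by
  refine (eigProj_heatX (add_nonneg hs ht) u n).trans (Eq.trans ?_
    ((eigProj_heatX hs (heatX t u) n).trans (congrArg _ (eigProj_heatX ht u n))).symm)
  rw [smul_smul, ← Real.exp_add]
  congr 2
  ring

theorem heatX_add {s t : ℝ} (hs : 0 ≤ s) (ht : 0 ≤ t) : heatX (s + t) = (heatX s).comp (heatX t) :=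
  ContinuousLinearMap.ext fun u => eq_of_eigProj_toH_eq (eigProj_heatX_heatX hs ht u)

theorem norm_heatX_sub_le {t : ℝ} (ht : 0 ≤ t) (u : X) : ‖heatX t u - u‖ ≤ (‖lpIncl‖ + 1) *
    ‖heatL t (u : WithLp 1 (H × Lp E3 4 surf)).snd - (u : WithLp 1 (H × Lp E3 4 surf)).snd‖ := by
  rw [← snd_heatX ht u]
  exact norm_le_snd (heatX t u - u)

theorem tendsto_of_norm_sub_le {E F : Type*} [NormedAddCommGroup E] [NormedAddCommGroup F]
    {f : ℝ → E} {g : ℝ → F} {x : E} {y : F} {c : ℝ} (h : ∀ t > 0, ‖f t - x‖ ≤ c * ‖g t - y‖)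
    (hg : Tendsto g (𝓝[>] 0) (𝓝 y)) : Tendsto f (𝓝[>] 0) (𝓝 x) := by
  rw [tendsto_iff_norm_sub_tendsto_zero] at hg ⊢
  have h' := hg.const_mul c
  rw [mul_zero] at h'
  refine squeeze_zero' (Eventually.of_forall fun t => norm_nonneg _) ?_ h'
  filter_upwards [self_mem_nhdsWithin] with t ht
  exact h t ht

theorem tendsto_heatX (u : X) : Tendsto (fun t => heatX t u) (𝓝[>] 0) (𝓝 u) :=
  tendsto_of_norm_sub_le (fun _ ht => norm_heatX_sub_le (le_of_lt ht) u)
    (tendsto_heatL (u : WithLp 1 (H × Lp E3 4 surf)).snd)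

theorem isC0Semigroup_heatX : IsC0Semigroup heatX :=
  ⟨heatX_zero, fun _ _ hs ht => heatX_add hs ht, tendsto_heatX⟩

/-! ### A Sobolev embedding -/

/-- The part of a sequence of potentials with degrees in a dyadic block. -/
def dyadicPart (p : ℕ → Poly) (j n : ℕ) : Poly := if Nat.log 2 (n + 1) = j then p n else 0

theorem isHarm_dyadicPart {p : ℕ → Poly} (hp : ∀ n, IsHarm n (p n)) (j n : ℕ) :
    IsHarm n (dyadicPart p j n) := by
  unfold dyadicPart
  split_ifs
  · exact hp n
  · exact (harmSpace n).zero_mem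

theorem two_pow_mul_norm_dyadicPart_le (p : ℕ → Poly) (j n : ℕ) :
    2 ^ j * ‖angH (dyadicPart p j n)‖ ≤ ((n : ℝ) + 1) * ‖angH (p n)‖ := by
  unfold dyadicPart
  split_ifs with h
  · have h1 : 2 ^ j ≤ n + 1 := h ▸ Nat.pow_log_le_self 2 n.succ_ne_zero
    have h2 : (2 : ℝ) ^ j ≤ n + 1 := by exact_mod_cast h1
    exact mul_le_mul_of_nonneg_right h2 (norm_nonneg _)
  · rw [map_zero, norm_zero, mul_zero]
    positivity

theorem norm_dyadicPart_le (p : ℕ → Poly) (j n : ℕ) :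
    ‖angH (dyadicPart p j n)‖ ≤ ‖angH (p n)‖ := by
  unfold dyadicPart
  split_ifs
  · exact le_rfl
  · rw [map_zero, norm_zero]; exact norm_nonneg _

/-- The sum of the eigenfields with degrees in a dyadic block. -/
def dyadicBlock (p : ℕ → Poly) (j : ℕ) : X :=
  angX (∑ n ∈ Finset.range (2 ^ (j + 1)), dyadicPart p j n)

theorem norm_dyadicBlock_le {p : ℕ → Poly} (hp : ∀ n, IsHarm n (p n)) {Q : ℝ} (hQ0 : 0 ≤ Q)
    (hQ : ∀ N, ∑ n ∈ Finset.range N, (((n : ℝ) + 1) * ‖angH (p n)‖) ^ 2 ≤ Q ^ 2) (j : ℕ) :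
    ‖dyadicBlock p j‖ ≤ ((1 / 2) ^ j + √(supConst * √2) * √(√2 / 2) ^ j) * Q := by
  have h2j : (0 : ℝ) < 2 ^ j := by positivity
  have hs2 : √2 * √2 = 2 := Real.mul_self_sqrt (by norm_num)
  have hR : ∑ n ∈ Finset.range (2 ^ (j + 1)), ‖angH (dyadicPart p j n)‖ ^ 2
      ≤ ((1 / 2) ^ j * Q) ^ 2 := by
    have h1 : ∀ n, ‖angH (dyadicPart p j n)‖ ^ 2
        ≤ ((1 / 2) ^ j) ^ 2 * (((n : ℝ) + 1) * ‖angH (p n)‖) ^ 2 := fun n => by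
      rw [← mul_pow]
      refine pow_le_pow_left₀ (norm_nonneg _) ?_ 2
      rw [one_div, inv_pow, ← div_eq_inv_mul, le_div_iff₀' h2j]
      exact two_pow_mul_norm_dyadicPart_le p j n
    refine (Finset.sum_le_sum fun n _ => h1 n).trans ?_
    rw [← Finset.mul_sum, mul_pow]
    exact mul_le_mul_of_nonneg_left (hQ _) (by positivity)
  have hB : ∑ n ∈ Finset.range (2 ^ (j + 1)), ((n : ℝ) + 1) * ‖angH (dyadicPart p j n)‖
      ≤ √2 ^ (j + 1) * Q := by
    refine (Finset.sum_le_sum fun n _ => mul_le_mul_of_nonneg_left (norm_dyadicPart_le p j n)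
      (by positivity)).trans ?_
    refine (sq_le_sq₀ (Finset.sum_nonneg fun n _ => by positivity) (by positivity)).1 ?_
    refine sq_sum_le_card_mul_sum_sq.trans ?_
    rw [Finset.card_range, mul_pow, ← pow_mul, mul_comm (j + 1) 2, pow_mul, Real.sq_sqrt two_pos.le]
    push_cast
    exact mul_le_mul_of_nonneg_left (hQ _) (by positivity)
  have h := norm_angX_sum_le (isHarm_dyadicPart hp j) (by positivity) _ hR hB
  refine h.trans_eq ?_
  have e : supConst * (√2 ^ (j + 1) * Q) * ((1 / 2) ^ j * Q)
      = supConst * √2 * (√(√2 / 2) ^ j * Q) ^ 2 := by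
    rw [mul_pow, ← pow_mul, mul_comm j 2, pow_mul, Real.sq_sqrt (by positivity), div_pow, pow_succ,
      div_pow, one_pow]
    ring
  rw [e, Real.sqrt_mul (by have := supConst_pos; positivity), Real.sqrt_sq (by positivity)]
  ring

theorem summable_dyadic_bound :
    Summable fun j : ℕ => (1 / 2 : ℝ) ^ j + √(supConst * √2) * √(√2 / 2) ^ j := by
  refine (summable_geometric_of_lt_one (by norm_num) (by norm_num)).add
    ((summable_geometric_of_lt_one (by positivity) ?_).mul_left _)
  rw [Real.sqrt_lt' one_pos, one_pow, div_lt_one two_pos, Real.sqrt_lt' two_pos]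
  norm_num

/-- The constant of the Sobolev embedding. -/
def sobolevConst : ℝ := ∑' j : ℕ, ((1 / 2 : ℝ) ^ j + √(supConst * √2) * √(√2 / 2) ^ j)

theorem toH_dyadicBlock (p : ℕ → Poly) (j : ℕ) :
    toH (dyadicBlock p j) = ∑ n ∈ Finset.range (2 ^ (j + 1)), angH (dyadicPart p j n) := by
  rw [dyadicBlock, toH_angX, map_sum]

theorem eigProj_dyadicBlock {p : ℕ → Poly} (hp : ∀ n, IsHarm n (p n)) (m j : ℕ) :
    eigProj m (toH (dyadicBlock p j)) = if Nat.log 2 (m + 1) = j then angH (p m) else 0 := by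
  rw [toH_dyadicBlock, map_sum]
  have h : ∀ n, n ≠ m → eigProj m (angH (dyadicPart p j n)) = 0 := fun n hn =>
    eigProj_of_mem_of_ne hn.symm (angH_mem_eigSp (isHarm_dyadicPart hp j n))
  have h' : eigProj m (angH (dyadicPart p j m)) = angH (dyadicPart p j m) :=
    eigProj_of_mem (angH_mem_eigSp (isHarm_dyadicPart hp j m))
  rw [Finset.sum_eq_single m (fun n _ hn => h n hn), h', dyadicPart, apply_ite angH, map_zero]
  intro hm
  have hne : Nat.log 2 (m + 1) ≠ j := fun hj => hm <| Finset.mem_range.2 <| by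
    have := Nat.lt_pow_succ_log_self one_lt_two (m + 1)
    rw [hj] at this
    exact (Nat.lt_succ_self m).trans this
  rw [h', dyadicPart, if_neg hne, map_zero]

/-- The embedding of `H¹` in `X`, by dyadic decomposition: a family of eigenfields `vₙ` for which
`∑ (n + 1)² ‖vₙ‖²` is finite is the expansion of an element of `X`. -/
theorem exists_toH_of_sobolev {v : ℕ → H} (hv : ∀ n, v n ∈ eigSp n) {Q : ℝ} (hQ0 : 0 ≤ Q)
    (hQ : ∀ N, ∑ n ∈ Finset.range N, (((n : ℝ) + 1) * ‖v n‖) ^ 2 ≤ Q ^ 2) :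
    ∃ z : X, (∀ n, eigProj n (toH z) = v n) ∧ ‖z‖ ≤ sobolevConst * Q := by
  choose p hp hpv using fun n => exists_of_mem_eigSp (hv n)
  simp_rw [← hpv] at hQ ⊢
  have hb := norm_dyadicBlock_le hp hQ0 hQ
  have hsb := summable_dyadic_bound.mul_right Q
  have hs : Summable (dyadicBlock p) := Summable.of_norm_bounded hsb hb
  refine ⟨∑' j, dyadicBlock p j, fun m => ?_, ?_⟩
  · have h1 := (((eigProj m).comp toHL).map_tsum hs)
    have h2 : ∀ j, ((eigProj m).comp toHL) (dyadicBlock p j)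
        = if Nat.log 2 (m + 1) = j then angH (p m) else 0 := eigProj_dyadicBlock hp m
    simp_rw [h2] at h1
    rw [tsum_ite_eq'] at h1
    exact h1
  · have := tsum_of_norm_bounded hsb.hasSum hb
    rwa [tsum_mul_right] at this

/-! ### The Coriolis operator as a bounded operator from `H` to `X` -/

theorem IsHarm.norm_angH_sq {n : ℕ} {p : Poly} (hp : IsHarm n p) :
    ‖angH p‖ ^ 2 = (n : ℝ) * (n + 1) * ∫ x : S2, ev p x * ev p x ∂surf := by
  rw [← real_inner_self_eq_norm_sq, inner_angH_angH, hp.integral_mul_casimir p]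

theorem IsHarm.norm_angH_ang_sq_le {n : ℕ} {p : Poly} (hp : IsHarm n p) (i : Fin 3) :
    ‖angH (AngularMomentum.ang i p)‖ ^ 2 ≤ (n : ℝ) * (n + 1) * ‖angH p‖ ^ 2 := by
  rw [(hp.ang i).norm_angH_sq]
  refine mul_le_mul_of_nonneg_left ?_ (by positivity)
  rw [← real_inner_self_eq_norm_sq, inner_angH_angH]
  exact Finset.single_le_sum
    (f := fun i => ∫ x : S2, ev (AngularMomentum.ang i p) x * ev (AngularMomentum.ang i p) x ∂surf)
    (fun j _ => integral_nonneg fun x => mul_self_nonneg _) (Finset.mem_univ i)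

/-- The Coriolis operator gains one derivative. -/
theorem succ_mul_norm_coriolis_sq_le {Om : ℝ} {n : ℕ} {z d : H} (hz : z ∈ eigSp n)
    (hd : IsCoriolis Om z d) : (((n : ℝ) + 1) * ‖d‖) ^ 2 ≤ 8 * Om ^ 2 * ‖z‖ ^ 2 := by
  obtain ⟨p, hp, rfl⟩ := exists_of_mem_eigSp hz
  rw [hd.unique (isCoriolis_of_isHarm Om hp), norm_smul, mul_pow, mul_pow, Real.norm_eq_abs, sq_abs]
  rcases Nat.eq_zero_or_pos n with rfl | hn
  · simp only [coriolisFactor, Nat.cast_zero, zero_mul, div_zero]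
    norm_num
    positivity
  have hn' : (1 : ℝ) ≤ n := by exact_mod_cast hn
  have h := hp.norm_angH_ang_sq_le 2
  have e : ((n : ℝ) + 1) ^ 2 * (coriolisFactor Om n ^ 2 * ((n : ℝ) * (n + 1) * ‖angH p‖ ^ 2))
      = 4 * Om ^ 2 * (((n : ℝ) + 1) / n) * ‖angH p‖ ^ 2 := by
    unfold coriolisFactor
    field_simp
    ring
  have h2 : ((n : ℝ) + 1) / n ≤ 2 := by rw [div_le_iff₀ (by linarith)]; linarith
  calc _ ≤ ((n : ℝ) + 1) ^ 2 * (coriolisFactor Om n ^ 2 * ((n : ℝ) * (n + 1) * ‖angH p‖ ^ 2)) := by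
        gcongr
    _ = 4 * Om ^ 2 * (((n : ℝ) + 1) / n) * ‖angH p‖ ^ 2 := e
    _ ≤ 4 * Om ^ 2 * 2 * ‖angH p‖ ^ 2 := by gcongr
    _ = _ := by ring

theorem exists_isCoriolis_X (Om : ℝ) (u : H) :
    ∃ z : X, IsCoriolis Om u (toH z) ∧ ‖z‖ ≤ sobolevConst * (√8 * |Om|) * ‖u‖ := by
  choose d hd hdc using fun n => exists_isCoriolis Om (eigProj_mem n u)
  obtain ⟨z, hz, hzn⟩ := exists_toH_of_sobolev hd (Q := √8 * |Om| * ‖u‖) (by positivity) fun N => by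
    refine (Finset.sum_le_sum fun n _ =>
      succ_mul_norm_coriolis_sq_le (eigProj_mem n u) (hdc n)).trans ?_
    rw [← Finset.mul_sum, mul_pow, mul_pow, Real.sq_sqrt (by norm_num), sq_abs]
    exact mul_le_mul_of_nonneg_left (sum_norm_eigProj_sq_le u N) (by positivity)
  refine ⟨z, IsCoriolis.of_hasSum hdc (hasSum_eigProj u) ?_, by rwa [mul_assoc]⟩
  have := hasSum_eigProj (toH z)
  simpa only [hz] using this

/-- The Coriolis operator from `H` to `X`, as a function. -/
def coriolisFun (Om : ℝ) (u : H) : X := (exists_isCoriolis_X Om u).choose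

theorem isCoriolis_coriolisFun (Om : ℝ) (u : H) : IsCoriolis Om u (toH (coriolisFun Om u)) :=
  (exists_isCoriolis_X Om u).choose_spec.1

theorem norm_coriolisFun_le (Om : ℝ) (u : H) :
    ‖coriolisFun Om u‖ ≤ sobolevConst * (√8 * |Om|) * ‖u‖ :=
  (exists_isCoriolis_X Om u).choose_spec.2

theorem inner_coriolisFun (Om : ℝ) (u v : H) :
    ⟪toH (coriolisFun Om u), v⟫_ℝ = - ⟪u, toH (coriolisFun Om v)⟫_ℝ :=
  (isCoriolis_coriolisFun Om u).inner_eq_neg (isCoriolis_coriolisFun Om v)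

theorem toH_add (u v : X) : toH (u + v) = toH u + toH v := rfl

theorem toH_smul (c : ℝ) (u : X) : toH (c • u) = c • toH u := rfl

theorem coriolisFun_add (Om : ℝ) (u v : H) :
    coriolisFun Om (u + v) = coriolisFun Om u + coriolisFun Om v :=
  toH_injective <| ext_inner_right ℝ fun w => by
    rw [toH_add, inner_add_left, inner_coriolisFun, inner_coriolisFun, inner_coriolisFun,
      inner_add_left, neg_add]

theorem coriolisFun_smul (Om c : ℝ) (u : H) :
    coriolisFun Om (c • u) = c • coriolisFun Om u :=
  toH_injective <| ext_inner_right ℝ fun w => by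
    rw [toH_smul, inner_smul_H, inner_coriolisFun, inner_coriolisFun, inner_smul_H, mul_neg]

/-- The Coriolis operator from `H` to `X`, as a linear map. -/
def coriolisLin (Om : ℝ) : H →ₗ[ℝ] X where
  toFun := coriolisFun Om
  map_add' := coriolisFun_add Om
  map_smul' := coriolisFun_smul Om

/-- The Coriolis operator from `H` to `X`. -/
def coriolisHX (Om : ℝ) : H →L[ℝ] X := (coriolisLin Om).mkContinuous _ (norm_coriolisFun_le Om)

/-- The Coriolis operator on `X`. -/
def coriolisX (Om : ℝ) : X →L[ℝ] X := (coriolisHX Om).comp toHL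

theorem isCoriolis_coriolisX (Om : ℝ) (u : X) : IsCoriolis Om (toH u) (toH (coriolisX Om u)) :=
  isCoriolis_coriolisFun Om (toH u)

theorem toH_coriolisFun_mem_eigSp (Om : ℝ) {n : ℕ} {u : H} (hu : u ∈ eigSp n) :
    toH (coriolisFun Om u) ∈ eigSp n := by
  obtain ⟨d, hd, h⟩ := exists_isCoriolis Om hu
  rwa [(isCoriolis_coriolisFun Om u).unique h]

theorem eigProj_coriolisFun (Om : ℝ) (n : ℕ) (u : H) :
    eigProj n (toH (coriolisFun Om u)) = toH (coriolisFun Om (eigProj n u)) :=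
  ext_inner_right ℝ fun w => by
    have h1 := toH_coriolisFun_mem_eigSp Om (eigProj_mem n u)
    have h2 := toH_coriolisFun_mem_eigSp Om (eigProj_mem n w)
    rw [inner_eigProj_left, inner_coriolisFun, ← inner_eigProj_of_mem u h2, ← inner_coriolisFun,
      ← inner_eigProj_left, eigProj_of_mem h1]

theorem eigProj_coriolisX (Om : ℝ) (n : ℕ) (u : X) :
    eigProj n (toH (coriolisX Om u)) = toH (coriolisFun Om (eigProj n (toH u))) :=
  eigProj_coriolisFun Om n (toH u)

theorem inner_eigProj_coriolisX (Om : ℝ) (n : ℕ) (u : X) :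
    ⟪eigProj n (toH (coriolisX Om u)), eigProj n (toH u)⟫_ℝ = 0 := by
  rw [eigProj_coriolisX]
  have h := inner_coriolisFun Om (eigProj n (toH u)) (eigProj n (toH u))
  rw [real_inner_comm] at h
  rw [real_inner_comm]
  linarith

theorem eigProj_coriolisX_heatX (Om : ℝ) {t : ℝ} (ht : 0 ≤ t) (u : X) (n : ℕ) :
    eigProj n (toH (coriolisX Om (heatX t u))) = eigProj n (toH (heatX t (coriolisX Om u))) := by
  refine (eigProj_coriolisX Om n (heatX t u)).trans (Eq.trans ?_
    ((eigProj_heatX ht (coriolisX Om u) n).trans (congrArg _ (eigProj_coriolisX Om n u))).symm)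
  refine (congrArg (fun v => toH (coriolisFun Om v)) (eigProj_heatX ht u n)).trans ?_
  exact congrArg toH (coriolisFun_smul Om _ _)

theorem coriolisX_heatX (Om : ℝ) {t : ℝ} (ht : 0 ≤ t) (u : X) :
    coriolisX Om (heatX t u) = heatX t (coriolisX Om u) :=
  eq_of_eigProj_toH_eq (eigProj_coriolisX_heatX Om ht u)

/-! ### Bounded commuting perturbations of a diagonal semigroup -/

section Perturbation

variable {E F : Type*} [NormedAddCommGroup E] [NormedSpace ℝ E]

theorem exp_add_smul [CompleteSpace E] (D : E →L[ℝ] E) (s t : ℝ) :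
    NormedSpace.exp ((s + t) • D) = NormedSpace.exp (s • D) * NormedSpace.exp (t • D) := by
  let _ : NormedAlgebra ℚ (E →L[ℝ] E) := NormedAlgebra.restrictScalars ℚ ℝ (E →L[ℝ] E)
  rw [add_smul]
  exact NormedSpace.exp_add_of_commute (((Commute.refl D).smul_left s).smul_right t)

theorem hasDerivAt_exp_smul_apply [CompleteSpace E] (D : E →L[ℝ] E) (x : E) (t : ℝ) :
    HasDerivAt (fun t : ℝ => NormedSpace.exp (t • D) x) (D (NormedSpace.exp (t • D) x)) t := by
  have h := (hasDerivAt_exp_smul_const' (𝕂 := ℝ) D t).clm_apply (hasDerivAt_const t x)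
  simpa using h

theorem continuous_exp_smul [CompleteSpace E] (D : E →L[ℝ] E) : Continuous fun t : ℝ => NormedSpace.exp (t • D) :=
  continuous_iff_continuousAt.2 fun t => (hasDerivAt_exp_smul_const' (𝕂 := ℝ) D t).continuousAt

/-- A strongly continuous semigroup composed with the exponential of a bounded operator that
commutes with it. -/
def expMul (D : E →L[ℝ] E) (T : ℝ → E →L[ℝ] E) (t : ℝ) : E →L[ℝ] E := NormedSpace.exp (t • D) * T t

variable {D : E →L[ℝ] E} {T : ℝ → E →L[ℝ] E}

theorem IsC0Semigroup.expMul [CompleteSpace E] (hT : IsC0Semigroup T) (hD : ∀ t, 0 ≤ t → Commute D (T t)) :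
    IsC0Semigroup (expMul D T) where
  zero := by
    rw [RotatingSphere.expMul, hT.zero, zero_smul, NormedSpace.exp_zero]
    rfl
  add s t hs ht := by
    have h : Commute (NormedSpace.exp (t • D)) (T s) := ((hD s hs).smul_left t).exp_left
    change NormedSpace.exp ((s + t) • D) * T (s + t)
      = NormedSpace.exp (s • D) * T s * (NormedSpace.exp (t • D) * T t)
    have h2 : T (s + t) = T s * T t := hT.add s t hs ht
    rw [exp_add_smul, h2, mul_assoc, mul_assoc, ← mul_assoc _ (T s), h.eq, mul_assoc]
  cont x := by
    have h1 : Tendsto (fun t : ℝ => NormedSpace.exp (t • D)) (𝓝[>] 0) (𝓝 1) := by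
      have := (continuous_exp_smul D).tendsto 0
      rw [zero_smul, NormedSpace.exp_zero] at this
      exact this.mono_left nhdsWithin_le_nhds
    exact (isBoundedBilinearMap_apply.continuous.tendsto (1, x)).comp (h1.prodMk_nhds (hT.cont x))

variable [NormedAddCommGroup F] [InnerProductSpace ℝ F] {L : E →L[ℝ] F} {d m : ℝ}

/-- If `⟪L (D x), L x⟫ = d ‖L x‖²`, the kernel of `L` is invariant under the exponential of `D`. -/
theorem apply_exp_smul_eq_zero [CompleteSpace E] (hLD : ∀ x, ⟪L (D x), L x⟫_ℝ = d * ‖L x‖ ^ 2) {x : E}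
    (hx : L x = 0) {t : ℝ} (ht : 0 ≤ t) : L (NormedSpace.exp (t • D) x) = 0 := by
  have hd : ∀ s, HasDerivAt (fun s : ℝ => L (NormedSpace.exp (s • D) x))
      (L (D (NormedSpace.exp (s • D) x))) s := fun s =>
    L.hasFDerivAt.comp_hasDerivAt s (hasDerivAt_exp_smul_apply D x s)
  have h := norm_eq_exp_mul (m := -d) ht (fun s _ => (hd s).continuousAt.continuousWithinAt)
    (fun s _ => (hd s).hasDerivWithinAt) (fun s _ => by rw [hLD]; ring)
  rw [zero_smul, NormedSpace.exp_zero, one_apply_eq_self, hx, norm_zero, mul_zero] at h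
  exact norm_eq_zero.1 h

theorem apply_expMul (hD : ∀ t, 0 ≤ t → Commute D (T t))
    (hLT : ∀ t, 0 ≤ t → ∀ x, L (T t x) = Real.exp (-(m * t)) • L x) {t : ℝ} (ht : 0 ≤ t) (x : E) :
    L (expMul D T t x) = Real.exp (-(m * t)) • L (NormedSpace.exp (t • D) x) := by
  have h : expMul D T t = T t * NormedSpace.exp (t • D) := (((hD t ht).smul_left t).exp_left).eq
  rw [h, mul_apply_eq_comp, hLT t ht]

theorem hasDerivAt_exp_smul_apply_exp [CompleteSpace E] (L : E →L[ℝ] F) (D : E →L[ℝ] E) (m : ℝ) (x : E) (t : ℝ) :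
    HasDerivAt (fun t : ℝ => Real.exp (-(m * t)) • L (NormedSpace.exp (t • D) x))
      (Real.exp (-(m * t)) • (L (D (NormedSpace.exp (t • D) x)) - m • L (NormedSpace.exp (t • D) x)))
      t := by
  have h1 : HasDerivAt (fun s : ℝ => L (NormedSpace.exp (s • D) x))
      (L (D (NormedSpace.exp (t • D) x))) t :=
    L.hasFDerivAt.comp_hasDerivAt t (hasDerivAt_exp_smul_apply D x t)
  have h2 : HasDerivAt (fun t : ℝ => Real.exp (-(m * t))) (Real.exp (-(m * t)) * -m) t := by
    have := ((hasDerivAt_id t).const_mul m).fun_neg.exp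
    simpa using this
  refine (h2.smul h1).congr_deriv ?_
  module

theorem exp_smul_apply_comm (D : E →L[ℝ] E) (t : ℝ) (x : E) :
    D (NormedSpace.exp (t • D) x) = NormedSpace.exp (t • D) (D x) := by
  have h : Commute D (NormedSpace.exp (t • D)) := ((Commute.refl D).smul_right t).exp_right
  exact congrArg (fun A : E →L[ℝ] E => A x) h.eq

/-- Along an orbit of `expMul D T`, each component moves with the velocity that the generator
prescribes. -/
theorem hasDerivAt_component [CompleteSpace E] (hLD : ∀ x, ⟪L (D x), L x⟫_ℝ = d * ‖L x‖ ^ 2) {u f : E}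
    (hf : L f = L (D u) - m • L u) {t : ℝ} (ht : 0 ≤ t) :
    HasDerivAt (fun t : ℝ => Real.exp (-(m * t)) • L (NormedSpace.exp (t • D) u))
      (Real.exp (-(m * t)) • L (NormedSpace.exp (t • D) f)) t := by
  refine (hasDerivAt_exp_smul_apply_exp L D m u t).congr_deriv ?_
  have h0 : L (f - (D u - m • u)) = 0 := by
    rw [map_sub, map_sub, map_smul, hf, sub_self]
  have h := apply_exp_smul_eq_zero hLD h0 ht
  rw [map_sub, map_sub, sub_eq_zero, map_sub, map_sub, map_smul, map_smul] at h
  rw [h, exp_smul_apply_comm]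

end Perturbation

/-- The generator of `expMul D T`, when `T` is diagonal with respect to the components `L n`. -/
theorem tendsto_expMul_iff {E F : Type*} [NormedAddCommGroup E] [NormedSpace ℝ E] [CompleteSpace E]
    [NormedAddCommGroup F] [InnerProductSpace ℝ F] [CompleteSpace F] {D : E →L[ℝ] E}
    {T : ℝ → E →L[ℝ] E} (hT : IsC0Semigroup T) (hD : ∀ t, 0 ≤ t → Commute D (T t))
    {L : ℕ → E →L[ℝ] F} (hL : ∀ x y, (∀ n, L n x = L n y) → x = y) {d : ℝ} {m : ℕ → ℝ}
    (hLD : ∀ n x, ⟪L n (D x), L n x⟫_ℝ = d * ‖L n x‖ ^ 2)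
    (hLT : ∀ n t, 0 ≤ t → ∀ x, L n (T t x) = Real.exp (-(m n * t)) • L n x) (u f : E) :
    Tendsto (fun h : ℝ => h⁻¹ • (expMul D T h u - u)) (𝓝[>] 0) (𝓝 f) ↔
      ∀ n, L n f = L n (D u) - m n • L n u := by
  have hS := hT.expMul hD
  constructor
  · intro h n
    have h1 : Tendsto (fun h : ℝ => L n (h⁻¹ • (expMul D T h u - u))) (𝓝[>] 0) (𝓝 (L n f)) :=
      ((L n).continuous.tendsto f).comp h
    have h2 := (hasDerivAt_exp_smul_apply_exp (L n) D (m n) u 0).tendsto_slope_zero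
    simp only [zero_smul, NormedSpace.exp_zero, mul_zero, neg_zero, Real.exp_zero, one_smul,
      one_apply_eq_self, zero_add] at h2
    refine tendsto_nhds_unique h1 ((h2.mono_left (nhdsWithin_mono _ fun y hy => ne_of_gt hy)).congr' ?_)
    filter_upwards [self_mem_nhdsWithin] with h hh
    rw [map_smul, map_sub, apply_expMul hD (hLT n) (le_of_lt hh)]
  · intro hf
    have hc : Continuous (fun s : ℝ => expMul D T (max s 0) f) :=
      hS.continuous_uncurry.comp (by fun_prop : Continuous (fun s : ℝ => (s, f)))
    -- the orbit is the integral of the prescribed velocity, since this holds for each component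
    have key : ∀ h : ℝ, 0 ≤ h → expMul D T h u - u = ∫ s in (0 : ℝ)..h, expMul D T (max s 0) f := by
      intro h hh
      refine hL _ _ fun n => ?_
      rw [← ContinuousLinearMap.intervalIntegral_comp_comm _ (hc.intervalIntegrable _ _)]
      have hd : ∀ s ∈ uIcc 0 h, HasDerivAt
          (fun t : ℝ => Real.exp (-(m n * t)) • L n (NormedSpace.exp (t • D) u))
          (L n (expMul D T (max s 0) f)) s := fun s hs => by
        rw [uIcc_of_le hh] at hs
        rw [max_eq_left hs.1, apply_expMul hD (hLT n) hs.1]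
        exact hasDerivAt_component (hLD n) (hf n) hs.1
      rw [intervalIntegral.integral_eq_sub_of_hasDerivAt hd
        (((L n).continuous.comp hc).intervalIntegrable _ _), map_sub, apply_expMul hD (hLT n) hh]
      simp
    have hFd := (intervalIntegral.integral_hasDerivAt_right (hc.intervalIntegrable 0 0)
      (hc.stronglyMeasurableAtFilter _ _) hc.continuousAt).tendsto_slope_zero
    rw [max_self, hS.zero] at hFd
    simp only [zero_add, intervalIntegral.integral_same, sub_zero] at hFd
    refine (hFd.mono_left (nhdsWithin_mono _ fun y hy => ne_of_gt hy)).congr' ?_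
    filter_upwards [self_mem_nhdsWithin] with h hh
    rw [key h (le_of_lt hh)]

/-! ### The semigroup generated by `-Â` -/

theorem IsC0Semigroup.comp_mul {E : Type*} [NormedAddCommGroup E] [NormedSpace ℝ E]
    {T : ℝ → E →L[ℝ] E} (hT : IsC0Semigroup T) {c : ℝ} (hc : 0 < c) :
    IsC0Semigroup fun t => T (c * t) where
  zero := by rw [mul_zero, hT.zero]
  add s t hs ht := by rw [mul_add, hT.add _ _ (by positivity) (by positivity)]
  cont x := (hT.cont x).comp <| tendsto_nhdsWithin_iff.2 ⟨by
      have : Tendsto (fun t : ℝ => c * t) (𝓝 0) (𝓝 (c * 0)) :=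
        (continuous_const.mul continuous_id).tendsto 0
      rw [mul_zero] at this
      exact this.mono_left nhdsWithin_le_nhds, by
      filter_upwards [self_mem_nhdsWithin] with t ht
      exact mul_pos hc ht⟩

/-- The bounded part of `-Â`; the Ricci term contributes `2 ν`. -/
def boundedPart (nu Om : ℝ) : X →L[ℝ] X :=
  (2 * nu) • ContinuousLinearMap.id ℝ X - coriolisX Om

/-- The component of an element of `X` in the `n`-th eigenspace. -/
def eigX (n : ℕ) : X →L[ℝ] H := (eigProj n).comp toHL

theorem eigX_boundedPart (nu Om : ℝ) (n : ℕ) (u : X) : eigX n (boundedPart nu Om u)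
    = (2 * nu) • eigX n u - eigX n (coriolisX Om u) :=
  (map_sub (eigX n) ((2 * nu) • u) (coriolisX Om u)).trans
    (congrArg (fun v => v - eigX n (coriolisX Om u)) (map_smul (eigX n) (2 * nu) u))

theorem inner_smul_sub_of_inner_eq_zero {a b : H} (h : ⟪b, a⟫_ℝ = 0) (c : ℝ) :
    ⟪c • a - b, a⟫_ℝ = c * ‖a‖ ^ 2 := by
  rw [inner_sub_left, h, sub_zero, inner_smul_H, real_inner_self_eq_norm_sq]

theorem inner_eigX_boundedPart (nu Om : ℝ) (n : ℕ) (u : X) :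
    ⟪eigX n (boundedPart nu Om u), eigX n u⟫_ℝ = 2 * nu * ‖eigX n u‖ ^ 2 := by
  rw [eigX_boundedPart]
  exact inner_smul_sub_of_inner_eq_zero (inner_eigProj_coriolisX Om n u) _

theorem commute_smul_id_sub {E : Type*} [NormedAddCommGroup E] [NormedSpace ℝ E]
    {C T : E →L[ℝ] E} (h : ∀ x, C (T x) = T (C x)) (c : ℝ) :
    Commute (c • ContinuousLinearMap.id ℝ E - C) T :=
  ContinuousLinearMap.ext fun x => by simp [h]

theorem commute_boundedPart_heatX (nu Om : ℝ) {t : ℝ} (ht : 0 ≤ t) :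
    Commute (boundedPart nu Om) (heatX t) := commute_smul_id_sub (coriolisX_heatX Om ht) _

theorem eigX_heatX {t : ℝ} (ht : 0 ≤ t) (u : X) (n : ℕ) :
    eigX n (heatX t u) = Real.exp (-((n : ℝ) * (n + 1) * t)) • eigX n u := eigProj_heatX ht u n

theorem IsStokes.eigProj_eq {u f : H} (h : IsStokes u f) (n : ℕ) :
    eigProj n f = stokesEv n • eigProj n u :=
  ext_inner_right ℝ fun w => by
    rw [inner_eigProj_left, h.inner_eigSp (eigProj_mem n w), inner_smul_H, inner_eigProj_left]

theorem isStokes_of_mem_eigSp {n : ℕ} {u : H} (hu : u ∈ eigSp n) : IsStokes u (stokesEv n • u) := by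
  obtain ⟨p, hp, rfl⟩ := exists_of_mem_eigSp hu
  exact isStokes_angH hp

theorem isStokes_iff {u f : H} : IsStokes u f ↔ ∀ n, eigProj n f = stokesEv n • eigProj n u := by
  refine ⟨fun h n => h.eigProj_eq n, fun h => ?_⟩
  refine IsStokes.of_hasSum (fun n => ?_) (hasSum_eigProj u) (hasSum_eigProj f)
  rw [h n]
  exact isStokes_of_mem_eigSp (eigProj_mem n u)

theorem isAhat_iff_isStokes {nu Om : ℝ} (hnu : nu ≠ 0) {u g : X} :
    IsAhat nu Om u g ↔ IsStokes (toH u) (nu⁻¹ • (toH g - toH (coriolisX Om u))) := by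
  constructor
  · rintro ⟨a, c, ha, hc, h⟩
    rwa [h, hc.unique (isCoriolis_coriolisX Om u), add_sub_cancel_right, inv_smul_smul₀ hnu]
  · intro h
    refine ⟨_, _, h, isCoriolis_coriolisX Om u, ?_⟩
    rw [smul_inv_smul₀ hnu, sub_add_cancel]

theorem eigProj_inv_smul_sub_eq_iff {nu : ℝ} (hnu : nu ≠ 0) (n : ℕ) (s : ℝ) (g c a : H) :
    eigProj n (nu⁻¹ • (g - c)) = s • a ↔ eigProj n g = (nu * s) • a + eigProj n c := by
  rw [map_smul, map_sub, inv_smul_eq_iff₀ hnu, smul_smul, sub_eq_iff_eq_add]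

/-- The operator `Â` acts on the `n`-th component as `ν μₙ` plus the Coriolis operator. -/
theorem isAhat_iff {nu Om : ℝ} (hnu : nu ≠ 0) {u g : X} : IsAhat nu Om u g ↔
    ∀ n, eigX n g = (nu * stokesEv n) • eigX n u + eigX n (coriolisX Om u) := by
  refine (isAhat_iff_isStokes hnu).trans (isStokes_iff.trans (forall_congr' fun n => ?_))
  exact eigProj_inv_smul_sub_eq_iff hnu n (stokesEv n) (toH g) (toH (coriolisX Om u))
    (eigProj n (toH u))

theorem eq_stokesEv_smul_add_iff (nu : ℝ) (n : ℕ) {x x' y z w : H} (hx : x' = -x)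
    (hw : w = (2 * nu) • y - z) :
    x' = (nu * stokesEv n) • y + z ↔ x = w - (nu * ((n : ℝ) * (n + 1))) • y := by
  have : -((nu * stokesEv n) • y + z) = (2 * nu) • y - z - (nu * ((n : ℝ) * (n + 1))) • y := by
    unfold stokesEv
    module
  rw [hx, hw, neg_eq_iff_eq_neg, this]

theorem isAhat_neg_iff {nu Om : ℝ} (hnu : nu ≠ 0) {u f : X} : IsAhat nu Om u (-f) ↔
    ∀ n, eigX n f = eigX n (boundedPart nu Om u) - (nu * ((n : ℝ) * (n + 1))) • eigX n u :=
  (isAhat_iff hnu).trans (forall_congr' fun n =>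
    eq_stokesEv_smul_add_iff nu n (map_neg (eigX n) f) (eigX_boundedPart nu Om n u))

/-- The operator `-Â` generates a strongly continuous semigroup on `X`: the heat semigroup,
composed with the exponential of the bounded part of `-Â`. -/
theorem exists_isStokesCoriolisSemigroup {nu : ℝ} (hnu : 0 < nu) (Om : ℝ) :
    ∃ S, IsStokesCoriolisSemigroup nu Om S := by
  have hT := isC0Semigroup_heatX.comp_mul hnu
  have hD : ∀ t, 0 ≤ t → Commute (boundedPart nu Om) (heatX (nu * t)) := fun t ht =>
    commute_boundedPart_heatX nu Om (by positivity)
  refine ⟨expMul (boundedPart nu Om) fun t => heatX (nu * t), hT.expMul hD, fun u f => ?_⟩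
  have h := tendsto_expMul_iff hT hD (L := eigX) (d := 2 * nu)
    (m := fun n : ℕ => nu * ((n : ℝ) * (n + 1))) (fun x y => eq_of_eigProj_toH_eq)
    (inner_eigX_boundedPart nu Om) (fun n t ht x => by
      rw [eigX_heatX (by positivity) x n]
      congr 2
      ring) u f
  exact (isAhat_neg_iff hnu.ne').trans h.symm

theorem isStokesCoriolisSemigroup_expNegAhat {nu : ℝ} (hnu : 0 < nu) (Om : ℝ) :
    IsStokesCoriolisSemigroup nu Om (expNegAhat nu Om) := by
  have h := exists_isStokesCoriolisSemigroup hnu Om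
  rw [expNegAhat, dif_pos h]
  exact h.choose_spec

end RotatingSphere
end

theorem mainTheorem5
    (nu Om beta : ℝ) (hnu : 0 < nu) (hbeta1 : 1 < beta) (hbeta2 : beta < 2)
    (e : HilbertBasis ℕ ℝ RotatingSphere.H) (lam sigma : ℕ → ℝ)
    (heig : ∀ l, RotatingSphere.IsStokes (e l) (lam l • e l))
    (hpos : ∀ l, sigma l ≠ 0 → 0 < lam l)
    (hsum : Summable (fun l => |sigma l| ^ beta * lam l ^ (beta / 2)))
    (P : Measure RotatingSphere.PathSpace) [IsProbabilityMeasure P]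
    (hP : RotatingSphere.IsNoiseLaw beta e sigma P) :
    ∀ᵐ w ∂P, ∀ s t : ℝ,
      RotatingSphere.OUWellDefined nu Om w (t + s) ∧
      RotatingSphere.OUWellDefined nu Om (RotatingSphere.shift s w) t ∧
      RotatingSphere.ouFunctional nu Om (RotatingSphere.shift s w) t =
        RotatingSphere.ouFunctional nu Om w (t + s) := by
  filter_upwards [RotatingSphere.ae_hasModerateGrowth hbeta1 hbeta2 hpos hsum hP] with w hw s t
  have h : RotatingSphere.OUWellDefined nu Om w (t + s) := hw.ouWellDefined hnu heig
    (RotatingSphere.isStokesCoriolisSemigroup_expNegAhat hnu Om) (t + s)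
  exact ⟨h, h.shift, RotatingSphere.ouFunctional_shift nu Om w s t⟩
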